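/- Let $p_Z$ be a probability density function on $\mathbb{R}$ such that, for some $\zeta\in(0,1)$, $$\int_{\mathbb R} p_Z(\ln p_Z)^4\,dz<\infty,\qquad \int_{\mathbb R} p_Z^{\zeta}\,dz<\infty,\qquad \int_{\mathbb R} p_Z^{\zeta}(\ln p_Z)^4\,dz<\infty$$ (the integrands being $0$ where $p_Z=0$). Assume moreover that 1. $p_Z$ is bounded; 2. $z\mapsto p_Z(z)\ln p_Z(z)$ is uniformly continuous on $\{z: p_Z(z)>0\}$; 3. there is $\xi\in(0,1)$ such that for every $\gamma\in[0,\xi)$ there is a random variable $X$, independent of $Z\sim p_Z$, for which $X+Z$ has the density $\alpha\,p_Z^{1-\gamma}$ with $\alpha=\bigl(\int_{\mathbb R} p_Z^{1-\gamma}\,dz\bigr)^{-1}$. Consider the memoryless channel $Y_i=X_i+Z_i$, with $Z_1,Z_2,\dots$ i.i.d. with density $p_Z$. A code of length $n$ consists of finite nonempty sets $\mathcal M$ (messages) and $\mathcal K$ (keys), an encoder $f\colon\mathcal M\times\mathcal K\to\mathbb R^n$ and a decoder $g\colon\mathbb R^n\times\mathcal K\to\mathcal M$. The message and the key are uniform,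 independent of each other and of the noise; $Y^n=f(m,k)+Z^n$; the average error probability is the probability that $g(Y^n,k)\ne m$. Fix $\Delta>0$. A code is called covert if $D(P_{Y^n}\|P_{Z^n})\le\Delta$, where $D$ is the Kullback–Leibler divergence in nats and $P_{Y^n}$ is averaged over message and key. Let $A_n(\Delta,\epsilon)$ be the supremum of $\ln|\mathcal M|$ over all covert codes of length $n$ (with keys of any length) whose average error probability is at most $\epsilon$, and let $$L=\lim_{\epsilon\downarrow0}\liminf_{n\to\infty}\frac{A_n(\Delta,\epsilon)}{\sqrt{n\Delta}}.$$ Then $L=\sqrt2\,\sqrt{\mathrm{Var}[\ln p_Z(Z)]}$, and there is a sequence of codes $\mathcal C_n$ of length $n=0,1,2,\dots$, with message sets $\mathcal M_n$ and key sets $\mathcal K_n$, such that every $\mathcal C_n$ is covert, the average error probability of $\mathcal C_n$ tends to $0$, $$\lim_{n\to\infty}\frac{\ln|\mathcal M_n|}{\sqrt{n\Delta}}=L,\qquad\text{and}\qquad \ln|\mathcal K_n|=O(n).$$ -/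

import Mathlib

open MeasureTheory ProbabilityTheory Filter Topology
open scoped ENNReal

noncomputable section

namespace CovertChannel

/-- `p` is a probability density function on the real line: nonnegative, Lebesgue-measurable
(contained in `Integrable`) and of total integral one. -/
structure IsPDF (p : ℝ → ℝ) : Prop where
  nonneg : ∀ z, 0 ≤ p z
  integrable : Integrable p
  integral_eq_one : ∫ z, p z = 1

/-- The law `P_Z` on `ℝ` with density `p`. -/
def noiseLaw (p : ℝ → ℝ) : Measure ℝ :=
  volume.withDensity fun z => ENNReal.ofReal (p z)

instance (p : ℝ → ℝ) : SigmaFinite (noiseLaw p) := by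
  unfold noiseLaw; infer_instance

/-- The law `P_{Z^n}` of `n` i.i.d. noise variables with density `p`. -/
def noiseLawN (p : ℝ → ℝ) (n : ℕ) : Measure (Fin n → ℝ) :=
  Measure.pi fun _ => noiseLaw p

/-- The integrability conditions on the noise density. The integrands are nonnegative and
vanish where `p` does. -/
def IntegrabilityConditions (p : ℝ → ℝ) : Prop :=
  ∃ ζ : ℝ, 0 < ζ ∧ ζ < 1 ∧
    Integrable (fun z => p z * Real.log (p z) ^ 4) ∧
    Integrable (fun z => p z ^ ζ) ∧
    Integrable (fun z => p z ^ ζ * Real.log (p z) ^ 4)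

/-- The tilted density `α p ^ (1 - γ)` with `α = (∫ p ^ (1 - γ))⁻¹`. -/
def tiltedDensity (p : ℝ → ℝ) (γ : ℝ) (z : ℝ) : ℝ :=
  (∫ t, p t ^ (1 - γ))⁻¹ * p z ^ (1 - γ)

/-- The three further assumptions on the noise density. -/
structure NoiseAssumption (p : ℝ → ℝ) : Prop where
  bounded : ∃ b : ℝ, 0 < b ∧ ∀ z, p z ≤ b
  uniformContinuousOn :
    UniformContinuousOn (fun z => p z * Real.log (p z)) (Function.support p)
  /-- For every `γ ∈ [0, ξ)` some law `P_X` on `ℝ` is such that `X + Z`, for independent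
  `X ∼ P_X` and `Z ∼ P_Z`, has the tilted density. The law of that sum is the convolution. -/
  decomposable : ∃ ξ : ℝ, 0 < ξ ∧ ξ < 1 ∧ ∀ γ : ℝ, 0 ≤ γ → γ < ξ →
    ∃ PX : Measure ℝ, IsProbabilityMeasure PX ∧
      PX.conv (noiseLaw p) = volume.withDensity fun z => ENNReal.ofReal (tiltedDensity p γ z)

/-- A code of length `n`: finite nonempty message and key sets, an encoder, and a decoder that
also knows the key. -/
structure Code (n : ℕ) where
  /-- The number `|M|` of messages. -/
  numMsg : ℕ
  /-- The number `|K|` of keys. -/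
  numKey : ℕ
  numMsg_pos : 0 < numMsg
  numKey_pos : 0 < numKey
  /-- The encoder. -/
  enc : Fin numMsg → Fin numKey → Fin n → ℝ
  /-- The decoder. -/
  dec : (Fin n → ℝ) → Fin numKey → Fin numMsg
  measurable_dec : ∀ k, Measurable fun y => dec y k

namespace Code

variable {n : ℕ} (C : Code n)

/-- The law `P_{Y^n}` of the output `Y^n = f(m,k) + Z^n`, averaged over the uniform message and
the uniform key. -/
def outputLaw (p : ℝ → ℝ) : Measure (Fin n → ℝ) :=
  ((C.numMsg : ℝ≥0∞) * (C.numKey : ℝ≥0∞))⁻¹ •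
    ∑ m, ∑ k, (noiseLawN p n).map fun z => C.enc m k + z

/-- The covertness condition `D(P_{Y^n} ‖ P_{Z^n}) ≤ Δ`, in nats. -/
def IsCovert (p : ℝ → ℝ) (Δ : ℝ) : Prop :=
  InformationTheory.klDiv (C.outputLaw p) (noiseLawN p n) ≤ ENNReal.ofReal Δ

/-- The probability of decoding error, averaged over the uniform message and the uniform key. -/
def avgError (p : ℝ → ℝ) : ℝ :=
  ((C.numMsg : ℝ) * (C.numKey : ℝ))⁻¹ *
    ∑ m, ∑ k, (noiseLawN p n).real {z | C.dec (C.enc m k + z) k ≠ m}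

end Code

/-- `A_n(Δ, ε)`: the largest `ln |M|` over all codes of length `n`, with keys of any length, that
are covert and have average error at most `ε`; a supremum in `[0, ∞]`. -/
def maxLogMsg (p : ℝ → ℝ) (n : ℕ) (Δ ε : ℝ) : ℝ≥0∞ :=
  ⨆ (C : Code n) (_ : C.IsCovert p Δ ∧ C.avgError p ≤ ε), ENNReal.ofReal (Real.log C.numMsg)

/-- `L = lim_{ε ↓ 0} liminf_{n → ∞} A_n(Δ, ε) / √(n Δ)`. -/
def IsScalingConstant (p : ℝ → ℝ) (Δ L : ℝ) : Prop :=
  0 ≤ L ∧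
  Tendsto
    (fun ε : ℝ =>
      liminf (fun n : ℕ => maxLogMsg p n Δ ε / ENNReal.ofReal (Real.sqrt (n * Δ))) atTop)
    (𝓝[>] 0) (𝓝 (ENNReal.ofReal L))

end CovertChannel

end

/-! Let S = -ln p be the surprisal, m = E S(Z) the entropy of the noise, V = Var S(Z), and φ the
cumulant generating function of S(Z). Tilting P_Z by e ^ (γ S) gives exactly the density α p ^ (1 -
γ). As p is bounded and p ^ ζ is integrable, φ is finite on a neighbourhood of 0, hence analytic
there, and φ(γ) = γ m + γ² V / 2 + o(γ²). The tilted law Q_γ satisfies D(Q_γ ‖ P_Z) = γ φ'(γ) - φ(γ)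
~ γ² V / 2, while an input X with X + Z ∼ Q_γ conveys I = (1 - γ) φ'(γ) + φ(γ) - m ~ γ V nats. At γ
= t / √n the covertness budget over n uses reads t² V / 2 ≤ Δ and the information is about t V √n;
the best t yields √(2 Δ V n).

Converse (`Code.log_numMsg_le`). Donsker–Varadhan, applied to the log-density of the tilted law,
turns covertness into a bound on the mean surprisal of the output. Gibbs' inequality, with a bonus
ln |M| where the decoder answers correctly, turns that bound into (1 - error) ln |M| ≤ ln 2 - Δ + Δ
/ γ + n (φ(γ) - γ m) / γ. Taking γ of order 1 / √n gives the constant.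

Achievability (`exists_code`). The codewords are drawn independently with i.i.d. letters distributed
as X. By `soft_covering` the mean divergence of the output law exceeds n D(Q_γ ‖ P_Z) by an
exponential moment over a power of |M| |K|; a key of length O(n) makes this excess negligible. A
threshold decoder knowing the key succeeds by Chebyshev's inequality at distance of order √n below
the mean n I, which requires the variance of the information density to vanish as γ → 0. This comes
from `sq_le_mul_add_pow_four_div`: the second moment is controlled by I, which tends to 0, and a
bounded fourth moment. One codebook is good for divergence and error at once because t² V / 2 < Δ
leaves slack, and a diagonal argument produces the sequence. -/

noncomputable section

namespace CovertChannel

/-! ### Product measures: densities and convolutions. -/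

section ProductMeasures

/-- The product of measures with densities has the product density. -/
lemma pi_withDensity_ofReal {ι : Type*} [Fintype ι] {f : ℝ → ℝ} (hf0 : ∀ z, 0 ≤ f z)
    (hfi : Integrable f) :
    Measure.pi (fun _ : ι => (volume : Measure ℝ).withDensity fun z => ENNReal.ofReal (f z)) =
      (volume : Measure (ι → ℝ)).withDensity fun y => ENNReal.ofReal (∏ i, f (y i)) := by
  refine Measure.pi_eq fun s hs => ?_
  have hs' : MeasurableSet (Set.pi Set.univ s) := MeasurableSet.univ_pi hs
  have hind : ∀ i, Integrable ((s i).indicator f) := fun i => hfi.indicator (hs i)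
  have hnn : ∀ i z, 0 ≤ (s i).indicator f z := fun i z =>
    Set.indicator_nonneg (fun z _ => hf0 z) z
  rw [withDensity_apply _ hs', ← lintegral_indicator hs']
  -- On a box the indicator factors, so Fubini applies to a product of one-variable functions.
  have h1 : ∀ y : ι → ℝ, (Set.pi Set.univ s).indicator
      (fun y => ENNReal.ofReal (∏ i, f (y i))) y =
      ENNReal.ofReal (∏ i, (s i).indicator f (y i)) := by
    intro y
    by_cases hy : y ∈ Set.pi Set.univ s
    · rw [Set.indicator_of_mem hy]
      congr 1
      refine Finset.prod_congr rfl fun i _ => ?_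
      rw [Set.indicator_of_mem (hy i (Set.mem_univ i))]
    · rw [Set.indicator_of_notMem hy]
      have : ∃ i, y i ∉ s i := by simpa [Set.mem_pi] using hy
      obtain ⟨i, hi⟩ := this
      rw [Finset.prod_eq_zero (Finset.mem_univ i) (Set.indicator_of_notMem hi f)]
      simp
  simp_rw [h1]
  rw [← ofReal_integral_eq_lintegral_ofReal, integral_fintype_prod_volume_eq_prod
      (f := fun i => (s i).indicator f),
    ENNReal.ofReal_prod_of_nonneg fun i _ => integral_nonneg (hnn i)]
  · refine Finset.prod_congr rfl fun i _ => ?_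
    rw [ofReal_integral_eq_lintegral_ofReal (hind i) (ae_of_all _ (hnn i)),
      withDensity_apply _ (hs i), ← lintegral_indicator (hs i)]
    congr 1
    ext z
    by_cases hz : z ∈ s i <;> simp [hz]
  · exact Integrable.fintype_prod (f := fun i => (s i).indicator f) hind
  · exact ae_of_all _ fun y => Finset.prod_nonneg fun i _ => hnn i _

/-- The convolution of product measures is the product of the convolutions. -/
lemma conv_pi {ι : Type*} [Fintype ι] (μ ν : Measure ℝ) [IsProbabilityMeasure μ]
    [IsProbabilityMeasure ν] :
    (Measure.pi fun _ : ι => μ).conv (Measure.pi fun _ : ι => ν) =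
      Measure.pi fun _ : ι => μ.conv ν := by
  have h := (measurePreserving_arrowProdEquivProdArrow ℝ ℝ ι (fun _ => μ) (fun _ => ν)).map_eq
  unfold Measure.conv
  have hp : ∀ i : ι, IsProbabilityMeasure
      ((fun _ : ι => (μ.prod ν).map fun x : ℝ × ℝ => x.1 + x.2) i) := fun i =>
    Measure.isProbabilityMeasure_map (by fun_prop)
  have h2 := Measure.pi_map_pi (μ := fun _ : ι => μ.prod ν)
    (f := fun _ : ι => fun x : ℝ × ℝ => x.1 + x.2) (fun _ => by fun_prop)
  -- Addition in each coordinate becomes addition of vectors under the identification of sequences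
  -- of pairs with pairs of sequences.
  rw [← h2, ← h, Measure.map_map (by fun_prop) (MeasurableEquiv.measurable _)]
  rfl

end ProductMeasures

/-! ### Translates of a law with a density. -/

section Shift

variable {E : Type*} [AddCommGroup E] [MeasurableSpace E] [MeasurableAdd₂ E]
  {ν : Measure E} [ν.IsAddLeftInvariant]

lemma lintegral_withDensity_add_left {f : E → ℝ} (hf : Measurable f) {h : E → ℝ≥0∞}
    (hh : Measurable h) (x : E) :
    ∫⁻ z, h (x + z) ∂(ν.withDensity fun z => ENNReal.ofReal (f z)) =
      ∫⁻ y, ENNReal.ofReal (f (y - x)) * h y ∂ν := by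
  rw [lintegral_withDensity_eq_lintegral_mul _ (by fun_prop) (by fun_prop)]
  rw [← lintegral_add_left_eq_self (fun y => ENNReal.ofReal (f (y - x)) * h y) x]
  simp

lemma map_add_left_withDensity [MeasurableSub₂ E] {f : E → ℝ} (hf : Measurable f) (x : E) :
    (ν.withDensity fun z => ENNReal.ofReal (f z)).map (fun z => x + z) =
      ν.withDensity fun y => ENNReal.ofReal (f (y - x)) := by
  ext s hs
  rw [← lintegral_indicator_one hs, lintegral_map (measurable_one.indicator hs) (by fun_prop),
    lintegral_withDensity_add_left hf (measurable_one.indicator hs), withDensity_apply _ hs,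
    ← lintegral_indicator hs]
  congr 1
  ext y
  by_cases hy : y ∈ s <;> simp [hy]

end Shift

/-! ### Two variational inequalities for the converse. -/

section Converse

/-- Young's inequality for the conjugate functions a ln a - a and e ^ b; for a > 0 it is x + 1 ≤ e ^
x at x = b - ln a. -/
lemma mul_le_klFun_add_exp {a : ℝ} (ha : 0 ≤ a) (b : ℝ) :
    a * b ≤ InformationTheory.klFun a - 1 + Real.exp b := by
  unfold InformationTheory.klFun
  rcases ha.eq_or_lt with rfl | ha
  · simp [Real.exp_nonneg]
  · have h := Real.add_one_le_exp (b - Real.log a)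
    rw [Real.exp_sub, Real.exp_log ha, le_div_iff₀ ha] at h
    linarith

/-- The Donsker–Varadhan inequality for a test function that is bounded below. -/
lemma integrable_and_integral_le_of_klDiv_le {Ω : Type*} [MeasurableSpace Ω]
    {P μ : Measure Ω} [IsProbabilityMeasure P] [IsProbabilityMeasure μ] {b : Ω → ℝ}
    (hb : Measurable b) {β : ℝ} (hβ : ∀ ω, β ≤ b ω)
    (hexp : Integrable (fun ω => Real.exp (b ω)) μ) {Δ : ℝ} (hΔ : 0 ≤ Δ)
    (hkl : InformationTheory.klDiv P μ ≤ ENNReal.ofReal Δ) :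
    Integrable b P ∧ ∫ ω, b ω ∂P ≤ Δ - 1 + ∫ ω, Real.exp (b ω) ∂μ := by
  obtain ⟨hac, hllr⟩ := InformationTheory.klDiv_ne_top_iff.1
    (ne_top_of_le_ne_top ENNReal.ofReal_ne_top hkl)
  have hkli : Integrable (fun ω => InformationTheory.klFun (P.rnDeriv μ ω).toReal) μ :=
    (InformationTheory.integrable_klFun_rnDeriv_iff hac).2 hllr
  have hkld : ∫ ω, InformationTheory.klFun (P.rnDeriv μ ω).toReal ∂μ ≤ Δ := by
    rw [← InformationTheory.toReal_klDiv_eq_integral_klFun hac]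
    exact ENNReal.toReal_le_of_le_ofReal hΔ hkl
  have hup : ∀ ω, (P.rnDeriv μ ω).toReal * b ω ≤
      InformationTheory.klFun (P.rnDeriv μ ω).toReal - 1 + Real.exp (b ω) :=
    fun ω => mul_le_klFun_add_exp ENNReal.toReal_nonneg _
  have hupi : Integrable (fun ω => InformationTheory.klFun (P.rnDeriv μ ω).toReal - 1
      + Real.exp (b ω)) μ := (hkli.sub (integrable_const 1)).add hexp
  have hrn : Integrable (fun ω => (P.rnDeriv μ ω).toReal) μ :=
    Measure.integrable_toReal_rnDeriv
  have hlow : Integrable (fun ω => (P.rnDeriv μ ω).toReal * β) μ := hrn.mul_const β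
  -- Squeezed between β times the density and the Young bound; the lower bound on `b` stands in for
  -- its integrability under `P`, which is not assumed.
  have hab : Integrable (fun ω => (P.rnDeriv μ ω).toReal * b ω) μ := by
    refine integrable_of_le_of_le (g₁ := fun ω => (P.rnDeriv μ ω).toReal * β) ?_
      (ae_of_all _ fun ω => mul_le_mul_of_nonneg_left (hβ ω) ENNReal.toReal_nonneg)
      (ae_of_all _ hup) hlow hupi
    exact Measurable.aestronglyMeasurable (by fun_prop)
  refine ⟨(integrable_rnDeriv_smul_iff hac).1 hab, ?_⟩
  have h := integral_mono hab hupi hup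
  have hk1 : Integrable (fun ω => InformationTheory.klFun (P.rnDeriv μ ω).toReal - 1) μ :=
    hkli.sub (integrable_const 1)
  rw [integral_add hk1 hexp, integral_sub hkli (integrable_const 1)] at h
  rw [← integral_rnDeriv_smul hac]
  simp only [smul_eq_mul]
  simp only [integral_const, probReal_univ, smul_eq_mul, mul_one] at h
  linarith

variable {E : Type*} [AddCommGroup E] [MeasurableSpace E] [MeasurableAdd₂ E]
  {ν : Measure E} [ν.IsAddLeftInvariant]

/-- The Gibbs inequality for the translate of a law with density `f` against the law with density
`f e ^ a`. -/
lemma integral_log_translate_le {f : E → ℝ} (hf : Measurable f) (hf0 : ∀ y, 0 ≤ f y)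
    {μ : Measure E} [IsProbabilityMeasure μ]
    (hμ : μ = ν.withDensity fun z => ENNReal.ofReal (f z)) {a : E → ℝ} (ha : Measurable a)
    (hexp : Integrable (fun z => Real.exp (a z)) μ) {x : E} (hx : ∀ᵐ z ∂μ, f (x + z) ≠ 0)
    (hi : Integrable (fun z => Real.log (f (x + z)) + a (x + z) - Real.log (f z)) μ) :
    ∫ z, (Real.log (f (x + z)) + a (x + z) - Real.log (f z)) ∂μ ≤
      ∫ z, Real.exp (a z) ∂μ - 1 := by
  set t : E → ℝ := fun z => f (x + z) * Real.exp (a (x + z)) / f z with ht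
  have htm : Measurable t := by fun_prop
  have ht0 : ∀ z, 0 ≤ t z := fun z => by have := hf0 z; have := hf0 (x + z); positivity
  have hpos : ∀ᵐ z ∂μ, 0 < f z := by
    rw [hμ, ae_withDensity_iff (by fun_prop)]
    exact ae_of_all _ fun z hz => by simpa using hz
  -- Translation invariance turns the mean of `t` into the mass of f e ^ a. It is only an
  -- inequality, since points with `f z = 0` do not count on the left.
  have hle : ∫⁻ z, ENNReal.ofReal (t z) ∂μ ≤ ∫⁻ z, ENNReal.ofReal (Real.exp (a z)) ∂μ := by
    rw [hμ, lintegral_withDensity_eq_lintegral_mul _ (by fun_prop) (by fun_prop),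
      lintegral_withDensity_eq_lintegral_mul _ (by fun_prop) (by fun_prop),
      ← lintegral_add_left_eq_self ((fun z => ENNReal.ofReal (f z)) *
        fun z => ENNReal.ofReal (Real.exp (a z))) x]
    refine lintegral_mono fun z => ?_
    simp only [Pi.mul_apply]
    rw [← ENNReal.ofReal_mul (hf0 _), ← ENNReal.ofReal_mul (hf0 _)]
    refine ENNReal.ofReal_le_ofReal ?_
    rcases (hf0 z).eq_or_lt with h | h
    · rw [← h, zero_mul]
      exact mul_nonneg (hf0 _) (Real.exp_nonneg _)
    · simp only [ht]
      rw [mul_div_cancel₀ _ h.ne']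
  have hexpl : ∫⁻ z, ENNReal.ofReal (Real.exp (a z)) ∂μ = ENNReal.ofReal (∫ z, Real.exp (a z) ∂μ) :=
    (ofReal_integral_eq_lintegral_ofReal hexp (ae_of_all _ fun z => Real.exp_nonneg _)).symm
  have hti : Integrable t μ := by
    rw [← lintegral_ofReal_ne_top_iff_integrable htm.aestronglyMeasurable (ae_of_all _ ht0)]
    exact ne_top_of_le_ne_top (hexpl ▸ ENNReal.ofReal_ne_top) hle
  have htle : ∫ z, t z ∂μ ≤ ∫ z, Real.exp (a z) ∂μ := by
    rw [hexpl, ← ofReal_integral_eq_lintegral_ofReal hti (ae_of_all _ ht0)] at hle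
    exact (ENNReal.ofReal_le_ofReal_iff (integral_nonneg fun z => Real.exp_nonneg _)).1 hle
  have hmono : ∫ z, (Real.log (f (x + z)) + a (x + z) - Real.log (f z)) ∂μ ≤
      ∫ z, (t z - 1) ∂μ := by
    refine integral_mono_ae hi (hti.sub (integrable_const 1)) ?_
    filter_upwards [hx, hpos] with z hz1 hz2
    have h1 : 0 < f (x + z) := lt_of_le_of_ne (hf0 _) (Ne.symm hz1)
    have h2 : Real.log (t z) = Real.log (f (x + z)) + a (x + z) - Real.log (f z) := by
      simp only [ht]
      rw [Real.log_div (by positivity) hz2.ne', Real.log_mul h1.ne' (Real.exp_ne_zero _),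
        Real.log_exp]
    rw [← h2]
    exact Real.log_le_sub_one_of_pos (by simp only [ht]; positivity)
  rw [integral_sub hti (integrable_const 1)] at hmono
  simp only [integral_const, probReal_univ, smul_eq_mul, mul_one] at hmono
  linarith

end Converse

/-! ### The one-shot converse. -/

namespace Code

variable {n : ℕ} (C : Code n) (p : ℝ → ℝ)

lemma numMsg_mul_numKey_pos : 0 < (C.numMsg : ℝ) * C.numKey := by
  have := C.numMsg_pos
  have := C.numKey_pos
  positivity

/-- Every codeword has weight 1 / (|M| |K|) in the mixture. Through this domination integrability
and null sets pass from the averaged output law to each translate. -/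
lemma map_enc_le_smul_outputLaw (m : Fin C.numMsg) (k : Fin C.numKey) :
    (noiseLawN p n).map (fun z => C.enc m k + z) ≤
      ((C.numMsg : ℝ≥0∞) * C.numKey) • C.outputLaw p := by
  have hM : (C.numMsg : ℝ≥0∞) ≠ 0 := by exact_mod_cast C.numMsg_pos.ne'
  have hK : (C.numKey : ℝ≥0∞) ≠ 0 := by exact_mod_cast C.numKey_pos.ne'
  unfold outputLaw
  rw [smul_smul, ENNReal.mul_inv_cancel (mul_ne_zero hM hK)
    (ENNReal.mul_ne_top (ENNReal.natCast_ne_top _) (ENNReal.natCast_ne_top _)), one_smul]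
  intro s
  simp only [Measure.coe_finsetSum, Finset.sum_apply]
  exact (Finset.single_le_sum (f := fun k => (noiseLawN p n).map (fun z => C.enc m k + z) s)
      (fun _ _ => zero_le) (Finset.mem_univ k)).trans
    (Finset.single_le_sum
      (f := fun m => ∑ k, (noiseLawN p n).map (fun z => C.enc m k + z) s)
      (fun _ _ => zero_le) (Finset.mem_univ m))

lemma isProbabilityMeasure_outputLaw [IsProbabilityMeasure (noiseLawN p n)] :
    IsProbabilityMeasure (C.outputLaw p) := by
  have hM : (C.numMsg : ℝ≥0∞) ≠ 0 := by exact_mod_cast C.numMsg_pos.ne'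
  have hK : (C.numKey : ℝ≥0∞) ≠ 0 := by exact_mod_cast C.numKey_pos.ne'
  constructor
  unfold outputLaw
  have h : ∀ m k, (noiseLawN p n).map (fun z => C.enc m k + z) Set.univ = 1 := fun m k => by
    rw [Measure.map_apply (by fun_prop) MeasurableSet.univ]
    simp
  simp only [Measure.smul_apply, Measure.coe_finsetSum, Finset.sum_apply, h, smul_eq_mul]
  simp only [Finset.sum_const, Finset.card_univ, Fintype.card_fin, nsmul_eq_mul, mul_one]
  exact ENNReal.inv_mul_cancel (mul_ne_zero hM hK)
    (ENNReal.mul_ne_top (ENNReal.natCast_ne_top _) (ENNReal.natCast_ne_top _))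

variable {p}

lemma integrable_enc_add {b : (Fin n → ℝ) → ℝ} (hb : Integrable b (C.outputLaw p))
    (m : Fin C.numMsg) (k : Fin C.numKey) :
    Integrable (fun z => b (C.enc m k + z)) (noiseLawN p n) := by
  have h1 : Integrable b (((C.numMsg : ℝ≥0∞) * C.numKey) • C.outputLaw p) :=
    hb.smul_measure (ENNReal.mul_ne_top (ENNReal.natCast_ne_top _) (ENNReal.natCast_ne_top _))
  have h2 := h1.mono_measure (C.map_enc_le_smul_outputLaw p m k)
  exact h2.comp_measurable (by fun_prop)

lemma integral_outputLaw {b : (Fin n → ℝ) → ℝ} (hb : Integrable b (C.outputLaw p)) :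
    ∫ y, b y ∂C.outputLaw p = ((C.numMsg : ℝ) * C.numKey)⁻¹ *
      ∑ m, ∑ k, ∫ z, b (C.enc m k + z) ∂noiseLawN p n := by
  have h : ∀ m k, Integrable b ((noiseLawN p n).map fun z => C.enc m k + z) := fun m k =>
    (hb.smul_measure (ENNReal.mul_ne_top (ENNReal.natCast_ne_top C.numMsg)
      (ENNReal.natCast_ne_top C.numKey))).mono_measure (C.map_enc_le_smul_outputLaw p m k)
  unfold outputLaw
  rw [integral_smul_measure, integral_finsetSum_measure]
  · simp only [smul_eq_mul, ENNReal.toReal_inv, ENNReal.toReal_mul, ENNReal.toReal_natCast]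
    congr 1
    refine Finset.sum_congr rfl fun m _ => ?_
    rw [integral_finsetSum_measure fun k _ => h m k]
    exact Finset.sum_congr rfl fun k _ =>
      integral_map (by fun_prop) (h m k).aestronglyMeasurable
  · exact fun m _ => integrable_finsetSum_measure.2 fun k _ => h m k

/-- Finite divergence forces absolute continuity of the output law, so no codeword of a covert code
moves noise off the support of the noise density. -/
lemma ae_enc_add_of_isCovert {Δ : ℝ} [IsProbabilityMeasure (noiseLawN p n)]
    (hcov : C.IsCovert p Δ) {q : (Fin n → ℝ) → Prop} (hq : ∀ᵐ y ∂noiseLawN p n, q y)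
    (m : Fin C.numMsg) (k : Fin C.numKey) :
    ∀ᵐ z ∂noiseLawN p n, q (C.enc m k + z) := by
  have hac := (InformationTheory.klDiv_ne_top_iff.1
    (ne_top_of_le_ne_top ENNReal.ofReal_ne_top hcov)).1
  have h1 : ∀ᵐ y ∂((C.numMsg : ℝ≥0∞) * C.numKey) • C.outputLaw p, q y :=
    Measure.ae_smul_measure (hac.ae_le hq) _
  have h2 := ae_mono (C.map_enc_le_smul_outputLaw p m k) h1
  exact ae_of_ae_map (by fun_prop) h2

/-- The decoder names exactly one message, so the sum is |M| + (|M| - 1). The factor 2 is the origin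
of ln 2 in the converse. -/
lemma sum_exp_indicator_dec_le (y : Fin n → ℝ) (k : Fin C.numKey) :
    ∑ m, Real.exp ({y | C.dec y k = m}.indicator (fun _ => Real.log C.numMsg) y) ≤
      2 * C.numMsg := by
  have hM : (0 : ℝ) < C.numMsg := by exact_mod_cast C.numMsg_pos
  have h : ∀ m, Real.exp ({y | C.dec y k = m}.indicator (fun _ => Real.log C.numMsg) y) ≤
      1 + if C.dec y k = m then (C.numMsg : ℝ) else 0 := by
    intro m
    by_cases hm : C.dec y k = m
    · simp [hm, Real.exp_log hM]
    · simp [hm]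
  refine (Finset.sum_le_sum fun m _ => h m).trans ?_
  rw [Finset.sum_add_distrib]
  simp
  linarith

/-- The one-shot converse. -/
lemma log_numMsg_le [IsProbabilityMeasure (noiseLawN p n)] {f : (Fin n → ℝ) → ℝ}
    (hf : Measurable f) (hf0 : ∀ y, 0 ≤ f y) {B : ℝ} (hB1 : 1 ≤ B) (hB : ∀ y, f y ≤ B)
    (hμ : noiseLawN p n = volume.withDensity fun y => ENNReal.ofReal (f y))
    (hlog : Integrable (fun y => Real.log (f y)) (noiseLawN p n))
    {γ Φ Δ : ℝ} (hγ : 0 < γ) (hγ1 : γ < 1) (hΔ : 0 ≤ Δ)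
    (hmgfi : Integrable (fun y => Real.exp (-γ * Real.log (f y))) (noiseLawN p n))
    (hmgf : ∫ y, Real.exp (-γ * Real.log (f y)) ∂noiseLawN p n = Real.exp Φ)
    (hcov : C.IsCovert p Δ) :
    (1 - C.avgError p) * Real.log C.numMsg ≤
      Real.log 2 + (Δ + Φ) / γ - Δ + ∫ y, Real.log (f y) ∂noiseLawN p n := by
  set μ := noiseLawN p n with hμdef
  have hPY := C.isProbabilityMeasure_outputLaw p
  have hNpos := C.numMsg_mul_numKey_pos
  set N : ℝ := (C.numMsg : ℝ) * C.numKey with hN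
  -- The log-density of the tilted law with respect to the noise law. As e ^ b has mean 1,
  -- Donsker–Varadhan bounds the output mean of `b` by `Δ`.
  set b : (Fin n → ℝ) → ℝ := fun y => -γ * Real.log (f y) - Φ with hb
  have hbm : Measurable b := by fun_prop
  -- Where `f` vanishes its logarithm defaults to 0, which `1 ≤ B` accommodates.
  have hlogB : ∀ y, Real.log (f y) ≤ Real.log B := fun y => by
    rcases (hf0 y).eq_or_lt with h | h
    · rw [← h, Real.log_zero]; exact Real.log_nonneg hB1
    · exact Real.log_le_log h (hB y)
  have hexpb : ∀ y, Real.exp (b y) = Real.exp (-γ * Real.log (f y)) * Real.exp (-Φ) := fun y => by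
    rw [← Real.exp_add]; rfl
  have hexpbi : Integrable (fun y => Real.exp (b y)) μ := by
    simp_rw [hexpb]; exact hmgfi.mul_const _
  have hexpb1 : ∫ y, Real.exp (b y) ∂μ = 1 := by
    simp_rw [hexpb]
    rw [integral_mul_const, hmgf, ← Real.exp_add]
    simp
  obtain ⟨hbi, hble⟩ := integrable_and_integral_le_of_klDiv_le (P := C.outputLaw p) (μ := μ) hbm
    (β := -γ * Real.log B - Φ) (fun y => by
      have := mul_le_mul_of_nonneg_left (hlogB y) hγ.le
      simp only [hb]; linarith) hexpbi hΔ hcov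
  rw [hexpb1] at hble
  have hpos : ∀ᵐ z ∂μ, f z ≠ 0 := by
    rw [hμ, ae_withDensity_iff (by fun_prop)]
    exact ae_of_all _ fun z hz => by
      have : 0 < f z := by simpa using hz
      exact this.ne'
  -- A bonus ln |M| on the region decoded as `m`; after translation by the codeword its mean is ln
  -- |M| times the probability of success.
  set S : Fin C.numMsg → Fin C.numKey → (Fin n → ℝ) → ℝ := fun m k =>
    {y | C.dec y k = m}.indicator (fun _ => Real.log C.numMsg) with hS
  have hSset : ∀ m k, MeasurableSet {y | C.dec y k = m} := fun m k =>
    C.measurable_dec k (measurableSet_singleton m)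
  have hSm : ∀ m k, Measurable (S m k) := fun m k => measurable_const.indicator (hSset m k)
  have hSb : ∀ m k y, |S m k y| ≤ Real.log C.numMsg := fun m k y => by
    have : 0 ≤ Real.log C.numMsg := Real.log_natCast_nonneg _
    by_cases h : C.dec y k = m <;> simp [hS, h, abs_of_nonneg this, this]
  have hSi : ∀ m k x, Integrable (fun z => S m k (x + z)) μ := fun m k x =>
    Integrable.of_bound (((hSm m k).comp (measurable_const_add x)).aestronglyMeasurable)
      (Real.log C.numMsg) (ae_of_all _ fun z => hSb m k _)
  have hSint : ∀ m k, ∫ z, S m k (C.enc m k + z) ∂μ =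
      Real.log C.numMsg * (1 - μ.real {z | C.dec (C.enc m k + z) k ≠ m}) := by
    intro m k
    have hms : MeasurableSet {z | C.dec (C.enc m k + z) k = m} :=
      (measurable_const_add (C.enc m k)) (hSset m k)
    have h1 : (fun z => S m k (C.enc m k + z)) =
        {z | C.dec (C.enc m k + z) k = m}.indicator (fun _ => Real.log C.numMsg) := by
      ext z
      by_cases h : C.dec (C.enc m k + z) k = m <;> simp [hS, h]
    rw [h1, integral_indicator_const _ hms, smul_eq_mul, mul_comm]
    congr 1
    have := probReal_compl_eq_one_sub (μ := μ) hms
    have h3 : {z | C.dec (C.enc m k + z) k = m}ᶜ = {z | C.dec (C.enc m k + z) k ≠ m} := rfl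
    rw [h3] at this
    linarith
  have hSexpi : ∀ m k, Integrable (fun y => Real.exp (S m k y) * Real.exp (b y)) μ := fun m k => by
    refine hexpbi.bdd_mul (c := Real.exp (Real.log C.numMsg))
      (by have := hSm m k; exact Measurable.aestronglyMeasurable (by fun_prop))
      (ae_of_all _ fun y => ?_)
    rw [Real.norm_eq_abs, abs_of_pos (Real.exp_pos _)]
    exact Real.exp_le_exp.2 ((le_abs_self _).trans (hSb m k y))
  -- Gibbs' inequality against the reference density f e ^ (b + S - ln 2). Since ln f = -(b + Φ) /
  -- γ, the sum ln f + b is affine in `b`.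
  have hgibbs : ∀ m k, (1 - γ⁻¹) * (∫ z, b (C.enc m k + z) ∂μ + Φ) - Φ +
      Real.log C.numMsg * (1 - μ.real {z | C.dec (C.enc m k + z) k ≠ m}) - Real.log 2 -
      ∫ z, Real.log (f z) ∂μ ≤ 2⁻¹ * ∫ y, Real.exp (S m k y) * Real.exp (b y) ∂μ - 1 := by
    intro m k
    have hbi' := C.integrable_enc_add hbi m k
    have hSi' := hSi m k (C.enc m k)
    have heq : ∀ z, Real.log (f (C.enc m k + z)) +
        (b (C.enc m k + z) + S m k (C.enc m k + z) - Real.log 2) - Real.log (f z) =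
        (((1 - γ⁻¹) * (b (C.enc m k + z) + Φ) - Φ) + S m k (C.enc m k + z) - Real.log 2)
          - Real.log (f z) := by
      intro z
      simp only [hb]
      field_simp
      ring
    have hi0 : Integrable (fun z => (1 - γ⁻¹) * (b (C.enc m k + z) + Φ)) μ :=
      (hbi'.add (integrable_const Φ)).const_mul _
    have hi1 : Integrable (fun z => (1 - γ⁻¹) * (b (C.enc m k + z) + Φ) - Φ) μ :=
      hi0.sub (integrable_const Φ)
    have hi2 : Integrable (fun z => ((1 - γ⁻¹) * (b (C.enc m k + z) + Φ) - Φ) +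
        S m k (C.enc m k + z)) μ := hi1.add hSi'
    have hi3 : Integrable (fun z => ((1 - γ⁻¹) * (b (C.enc m k + z) + Φ) - Φ) +
        S m k (C.enc m k + z) - Real.log 2) μ := hi2.sub (integrable_const _)
    have hexpeq : ∀ y, Real.exp (b y + S m k y - Real.log 2) =
        2⁻¹ * (Real.exp (S m k y) * Real.exp (b y)) := fun y => by
      rw [Real.exp_sub, Real.exp_log two_pos, Real.exp_add]; ring
    have h := integral_log_translate_le (ν := volume) hf hf0 hμ
      (a := fun y => b y + S m k y - Real.log 2) (by have := hSm m k; fun_prop)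
      (by simp_rw [hexpeq]; exact (hSexpi m k).const_mul _)
      (x := C.enc m k) (C.ae_enc_add_of_isCovert hcov hpos m k)
      (by simp_rw [heq]; exact hi3.sub hlog)
    simp_rw [heq, hexpeq] at h
    rw [integral_sub hi3 hlog, integral_sub hi2 (integrable_const _), integral_add hi1 hSi',
      integral_sub hi0 (integrable_const Φ),
      integral_const_mul, integral_add hbi' (integrable_const Φ), integral_const_mul, hSint] at h
    simpa using h
  have hsum := Finset.sum_le_sum fun m (_ : m ∈ Finset.univ) =>
    Finset.sum_le_sum fun k (_ : k ∈ Finset.univ) => hgibbs m k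
  -- At a fixed key the masses of the |M| reference densities add up to at most |M|, so the
  -- right-hand sides sum to at most 0.
  have hR : ∑ m, ∑ k, (2⁻¹ * ∫ y, Real.exp (S m k y) * Real.exp (b y) ∂μ - 1) ≤ 0 := by
    rw [Finset.sum_comm]
    refine Finset.sum_nonpos fun k _ => ?_
    rw [Finset.sum_sub_distrib, ← Finset.mul_sum, ← integral_finsetSum _ fun m _ => hSexpi m k]
    have h1 : ∫ y, ∑ m, Real.exp (S m k y) * Real.exp (b y) ∂μ ≤
        ∫ y, (2 * C.numMsg) * Real.exp (b y) ∂μ := by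
      refine integral_mono (integrable_finsetSum _ fun m _ => hSexpi m k)
        (hexpbi.const_mul _) fun y => ?_
      simp only
      rw [← Finset.sum_mul]
      exact mul_le_mul_of_nonneg_right (C.sum_exp_indicator_dec_le y k) (Real.exp_nonneg _)
    rw [integral_const_mul, hexpb1] at h1
    simp
    linarith
  have hL := hsum.trans hR
  have hPYb := C.integral_outputLaw hbi
  have hexpand : ∑ m, ∑ k, ((1 - γ⁻¹) * (∫ z, b (C.enc m k + z) ∂μ + Φ) - Φ +
      Real.log C.numMsg * (1 - μ.real {z | C.dec (C.enc m k + z) k ≠ m}) - Real.log 2 -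
      ∫ z, Real.log (f z) ∂μ) = N * ((1 - γ⁻¹) * (∫ y, b y ∂C.outputLaw p + Φ) - Φ +
      Real.log C.numMsg * (1 - C.avgError p) - Real.log 2 - ∫ z, Real.log (f z) ∂μ) := by
    rw [hPYb]
    unfold avgError
    simp only [mul_add, mul_sub, Finset.sum_add_distrib, Finset.sum_sub_distrib, ← Finset.mul_sum,
      Finset.sum_const, Finset.card_univ, Fintype.card_fin, nsmul_eq_mul]
    rw [← hN]
    have hN' : N ≠ 0 := hNpos.ne'
    have hN2 : (C.numMsg : ℝ) * (C.numKey) = N := rfl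
    field_simp
    simp only [← hN2]
    ring
  rw [hexpand] at hL
  have hL2 := nonpos_of_mul_nonpos_right hL hNpos
  -- The covertness bound on the mean of `b` is multiplied by γ⁻¹ - 1, which must be nonnegative;
  -- here γ < 1 enters.
  have hγi : 1 ≤ γ⁻¹ := (one_le_inv₀ hγ).2 hγ1.le
  have h3 : (γ⁻¹ - 1) * (∫ y, b y ∂C.outputLaw p) ≤ (γ⁻¹ - 1) * Δ :=
    mul_le_mul_of_nonneg_left (by linarith) (by linarith)
  have h4 : (Δ + Φ) / γ = γ⁻¹ * Δ + γ⁻¹ * Φ := by field_simp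
  rw [h4]
  nlinarith [h3, hL2]

end Code

/-! ### Soft covering by a random codebook. -/

section SoftCovering

lemma log_one_add_le_rpow_div {u s : ℝ} (hu : 0 ≤ u) (hs : 0 < s) (hs1 : s ≤ 1) :
    Real.log (1 + u) ≤ u ^ s / s := by
  rw [le_div_iff₀ hs, mul_comm, ← Real.log_rpow (by linarith)]
  have h1 : (1 + u) ^ s ≤ 1 + u ^ s := by
    simpa using Real.rpow_add_le_add_rpow zero_le_one hu hs.le hs1
  have h2 : 0 < (1 + u) ^ s := Real.rpow_pos_of_pos (by linarith) _
  have h3 := Real.log_le_sub_one_of_pos h2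
  linarith

/-- Meant for a the likelihood ratio of one codeword and t the average over N codewords. Split ln t
= ln (1 + a / N) + ln (t / (1 + a / N)). The first part is bounded by a power. The second is bounded
by ln x ≤ x - 1, and its weighted mean is at most 0 because 1 + a / N dominates the mean of t given
that codeword. This replaces Jensen's inequality by a pointwise one. -/
lemma mul_log_le_of_pos {a t N s : ℝ} (ha : 0 ≤ a) (hN : 0 < N) (hat : 0 < a → 0 < t)
    (hs : 0 < s) (hs1 : s ≤ 1) :
    a * Real.log t ≤ (s * N ^ s)⁻¹ * (a * a ^ s) + t * (a / (1 + a / N)) - a := by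
  rcases ha.eq_or_lt with rfl | ha'
  · simp
  have ht := hat ha'
  have hv : 0 < 1 + a / N := by positivity
  have h1 := log_one_add_le_rpow_div (u := a / N) (by positivity) hs hs1
  have h2 := Real.log_le_sub_one_of_pos (div_pos ht hv)
  rw [Real.log_div ht.ne' hv.ne'] at h2
  rw [Real.div_rpow ha hN.le] at h1
  have h3 : Real.log t ≤ a ^ s / N ^ s / s + t / (1 + a / N) - 1 := by linarith
  have h4 := mul_le_mul_of_nonneg_left h3 ha
  refine h4.trans (le_of_eq ?_)
  have : 0 < N ^ s := Real.rpow_pos_of_pos hN _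
  field_simp

variable {X Y : Type*} [MeasurableSpace X] [MeasurableSpace Y] {PX : Measure X} {ρ : Measure Y}
  [IsProbabilityMeasure PX] [IsProbabilityMeasure ρ] {r : X → Y → ℝ}

/-- `r` plays the density of the joint law of codeword and output relative to the product of the
marginals; weighting by it preserves the output marginal. -/
lemma lintegral_prod_ofReal_mul (hr : Measurable (Function.uncurry r))
    (hr1 : ∀ᵐ y ∂ρ, ∫⁻ x, ENNReal.ofReal (r x y) ∂PX = 1) {h : Y → ℝ≥0∞} (hh : Measurable h) :
    ∫⁻ q, ENNReal.ofReal (r q.1 q.2) * h q.2 ∂(PX.prod ρ) = ∫⁻ y, h y ∂ρ := by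
  have hr' : Measurable fun q : X × Y => r q.1 q.2 := hr
  rw [lintegral_prod_symm _ (by fun_prop)]
  refine lintegral_congr_ae ?_
  filter_upwards [hr1] with y hy
  have : Measurable fun x => r x y := hr.comp (measurable_id.prodMk measurable_const)
  rw [lintegral_mul_const _ (by fun_prop), hy, one_mul]

lemma integrable_prod_mul (hr : Measurable (Function.uncurry r)) (hr0 : ∀ x y, 0 ≤ r x y)
    (hr1 : ∀ᵐ y ∂ρ, ∫⁻ x, ENNReal.ofReal (r x y) ∂PX = 1) {l : Y → ℝ} (hl : Measurable l)
    (hli : Integrable l ρ) : Integrable (fun q => r q.1 q.2 * l q.2) (PX.prod ρ) := by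
  have hr' : Measurable fun q : X × Y => r q.1 q.2 := hr
  refine ⟨by fun_prop, ?_⟩
  unfold HasFiniteIntegral
  have h := lintegral_prod_ofReal_mul hr hr1 (h := fun y => ‖l y‖ₑ) (by fun_prop)
  simp_rw [enorm_mul, Real.enorm_of_nonneg (hr0 _ _)]
  rw [h]
  exact hli.2

lemma integral_prod_mul_eq (hr : Measurable (Function.uncurry r)) (hr0 : ∀ x y, 0 ≤ r x y)
    (hr1 : ∀ᵐ y ∂ρ, ∫⁻ x, ENNReal.ofReal (r x y) ∂PX = 1) {l : Y → ℝ} (hl : Measurable l)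
    (hli : Integrable l ρ) : ∫ q, r q.1 q.2 * l q.2 ∂(PX.prod ρ) = ∫ y, l y ∂ρ := by
  rw [integral_prod_symm _ (integrable_prod_mul hr hr0 hr1 hl hli)]
  refine integral_congr_ae ?_
  filter_upwards [hr1] with y hy
  have hm : Measurable fun x => r x y := hr.comp (measurable_id.prodMk measurable_const)
  rw [integral_mul_const, integral_eq_lintegral_of_nonneg_ae (ae_of_all _ fun x => hr0 x y)
    hm.aestronglyMeasurable, hy]
  simp

variable {J : Type*} [Fintype J]

lemma measurePreserving_eval_prod (j : J) :
    MeasurePreserving (fun q : (J → X) × Y => (q.1 j, q.2))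
      ((Measure.pi fun _ : J => PX).prod ρ) (PX.prod ρ) :=
  (measurePreserving_eval (fun _ : J => PX) j).prod (MeasurePreserving.id ρ)

lemma lintegral_pi_mul_of_ne {i j : J} (hij : i ≠ j) {g h : X → ℝ≥0∞} (hg : Measurable g)
    (hh : Measurable h) :
    ∫⁻ c, g (c i) * h (c j) ∂(Measure.pi fun _ : J => PX) = (∫⁻ x, g x ∂PX) * ∫⁻ x, h x ∂PX := by
  have hind : IndepFun (fun c : J → X => c i) (fun c => c j) (Measure.pi fun _ : J => PX) :=
    (iIndepFun_pi (μ := fun _ : J => PX) (X := fun _ => id)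
      (fun _ => aemeasurable_id)).indepFun hij
  have h1 := lintegral_mul_eq_lintegral_mul_lintegral_of_indepFun
    (f := fun c : J → X => g (c i)) (g := fun c => h (c j))
    (μ := Measure.pi fun _ : J => PX) (by fun_prop) (by fun_prop) (hind.comp hg hh)
  simp only [Pi.mul_apply] at h1
  rw [h1, (measurePreserving_eval (fun _ : J => PX) i).lintegral_comp hg,
    (measurePreserving_eval (fun _ : J => PX) j).lintegral_comp hh]

/-- Fix y and put A = r / (1 + r / N). The term i = j contributes ∫ r A, and the others, independent
of codeword j, contribute at most N ∫ A. Divided by N this is ∫ A (1 + r / N) = ∫ r = 1. -/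
lemma lintegral_average_mul_div_le [Nonempty J] (hr : Measurable (Function.uncurry r))
    (hr0 : ∀ x y, 0 ≤ r x y) (hr1 : ∀ᵐ y ∂ρ, ∫⁻ x, ENNReal.ofReal (r x y) ∂PX = 1) (j : J) :
    ∫⁻ q, ENNReal.ofReal (((Fintype.card J : ℝ)⁻¹ * ∑ i, r (q.1 i) q.2) *
      (r (q.1 j) q.2 / (1 + r (q.1 j) q.2 / Fintype.card J)))
      ∂((Measure.pi fun _ : J => PX).prod ρ) ≤ 1 := by
  classical
  set N : ℝ := (Fintype.card J : ℝ) with hN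
  have hNpos : 0 < N := by rw [hN]; exact_mod_cast Fintype.card_pos
  have hr' : Measurable fun q : X × Y => r q.1 q.2 := hr
  have hri : ∀ i : J, Measurable fun q : (J → X) × Y => r (q.1 i) q.2 := fun i =>
    hr'.comp (by fun_prop : Measurable fun q : (J → X) × Y => (q.1 i, q.2))
  have hmeas : Measurable fun q : (J → X) × Y => ENNReal.ofReal ((N⁻¹ * ∑ i, r (q.1 i) q.2) *
      (r (q.1 j) q.2 / (1 + r (q.1 j) q.2 / N))) := by fun_prop
  rw [lintegral_prod_symm _ hmeas.aemeasurable]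
  have hone : (1 : ℝ≥0∞) = ∫⁻ _ : Y, 1 ∂ρ := by simp
  rw [hone]
  refine lintegral_mono_ae ?_
  filter_upwards [hr1] with y hy
  have hry : Measurable fun x => r x y := hr.comp (measurable_id.prodMk measurable_const)
  set A : X → ℝ := fun x => r x y / (1 + r x y / N) with hA
  have hAm : Measurable A := by fun_prop
  have hA0 : ∀ x, 0 ≤ A x := fun x => by have := hr0 x y; positivity
  have hexp : ∀ c : J → X, ENNReal.ofReal ((N⁻¹ * ∑ i, r (c i) y) * A (c j)) =
      ENNReal.ofReal N⁻¹ * ∑ i, ENNReal.ofReal (r (c i) y) * ENNReal.ofReal (A (c j)) := by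
    intro c
    rw [mul_assoc, ENNReal.ofReal_mul (by positivity), Finset.sum_mul,
      ENNReal.ofReal_sum_of_nonneg fun i _ => mul_nonneg (hr0 _ _) (hA0 _)]
    congr 1
    exact Finset.sum_congr rfl fun i _ => ENNReal.ofReal_mul (hr0 _ _)
  have hterm : ∀ i : J, ∫⁻ c, ENNReal.ofReal (r (c i) y) * ENNReal.ofReal (A (c j))
      ∂(Measure.pi fun _ : J => PX) ≤
      (if i = j then ∫⁻ x, ENNReal.ofReal (r x y) * ENNReal.ofReal (A x) ∂PX else 0) +
        ∫⁻ x, ENNReal.ofReal (A x) ∂PX := by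
    intro i
    by_cases hij : i = j
    · subst hij
      rw [if_pos rfl, (measurePreserving_eval (fun _ : J => PX) i).lintegral_comp
        (f := fun x => ENNReal.ofReal (r x y) * ENNReal.ofReal (A x)) (by fun_prop)]
      exact le_self_add
    · rw [if_neg hij, zero_add, lintegral_pi_mul_of_ne hij
        (g := fun x => ENNReal.ofReal (r x y)) (h := fun x => ENNReal.ofReal (A x))
        (by fun_prop) (by fun_prop), hy, one_mul]
  calc ∫⁻ c, ENNReal.ofReal ((N⁻¹ * ∑ i, r (c i) y) * A (c j)) ∂(Measure.pi fun _ : J => PX)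
      = ENNReal.ofReal N⁻¹ * ∑ i, ∫⁻ c, ENNReal.ofReal (r (c i) y) * ENNReal.ofReal (A (c j))
          ∂(Measure.pi fun _ : J => PX) := by
        simp_rw [hexp]
        rw [lintegral_const_mul _ (by fun_prop), lintegral_finsetSum _ (by fun_prop)]
    _ ≤ ENNReal.ofReal N⁻¹ * (∫⁻ x, ENNReal.ofReal (r x y) * ENNReal.ofReal (A x) ∂PX +
          ENNReal.ofReal N * ∫⁻ x, ENNReal.ofReal (A x) ∂PX) := by
        refine mul_le_mul_right ((Finset.sum_le_sum fun i _ => hterm i).trans (le_of_eq ?_)) _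
        rw [Finset.sum_add_distrib]
        simp [hN]
    _ = ∫⁻ x, ENNReal.ofReal (r x y) ∂PX := by
        rw [← lintegral_const_mul _ (by fun_prop), ← lintegral_add_left (by fun_prop),
          ← lintegral_const_mul _ (by fun_prop)]
        refine lintegral_congr fun x => ?_
        have h0 := hr0 x y
        rw [← ENNReal.ofReal_mul h0, ← ENNReal.ofReal_mul hNpos.le,
          ← ENNReal.ofReal_add (mul_nonneg h0 (hA0 x)) (mul_nonneg hNpos.le (hA0 x)),
          ← ENNReal.ofReal_mul (by positivity)]
        congr 1
        simp only [hA]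
        have : N + r x y ≠ 0 := by positivity
        field_simp
        ring
    _ ≤ 1 := hy.le

/-- **Soft covering.** For a random codebook `c` with independent entries of law `PX`, the mean of
the divergence of the averaged output law, whose density with respect to `ρ` is the average of the
`r (c j) ·`, from the law with density `e ^ (-l)` with respect to `ρ`. -/
lemma soft_covering [Nonempty J] (hr : Measurable (Function.uncurry r))
    (hr0 : ∀ x y, 0 ≤ r x y) (hr1 : ∀ᵐ y ∂ρ, ∫⁻ x, ENNReal.ofReal (r x y) ∂PX = 1)
    {l : Y → ℝ} (hl : Measurable l) (hli : Integrable l ρ)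
    (hlexpi : Integrable (fun y => Real.exp (-l y)) ρ) (hlexp : ∫ y, Real.exp (-l y) ∂ρ ≤ 1)
    {s T : ℝ} (hs : 0 < s) (hs1 : s ≤ 1) (hT0 : 0 ≤ T)
    (hT : ∫⁻ q, ENNReal.ofReal (r q.1 q.2 * r q.1 q.2 ^ s) ∂(PX.prod ρ) ≤ ENNReal.ofReal T) :
    ∫⁻ c, ∫⁻ y, ENNReal.ofReal (Real.exp (-l y) * InformationTheory.klFun
        (((Fintype.card J : ℝ)⁻¹ * ∑ j, r (c j) y) * Real.exp (l y))) ∂ρ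
        ∂(Measure.pi fun _ : J => PX) ≤
      ENNReal.ofReal (∫ y, l y ∂ρ + (s * (Fintype.card J : ℝ) ^ s)⁻¹ * T) := by
  set N : ℝ := (Fintype.card J : ℝ) with hN
  have hNpos : 0 < N := by rw [hN]; exact_mod_cast Fintype.card_pos
  set Pc := Measure.pi fun _ : J => PX with hPc
  have hr' : Measurable fun q : X × Y => r q.1 q.2 := hr
  have hri : ∀ i : J, Measurable fun q : (J → X) × Y => r (q.1 i) q.2 := fun i =>
    hr'.comp (by fun_prop : Measurable fun q : (J → X) × Y => (q.1 i, q.2))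
  set t : (J → X) × Y → ℝ := fun q => N⁻¹ * ∑ j, r (q.1 j) q.2 with ht
  have htm : Measurable t := by fun_prop
  have ht0 : ∀ q, 0 ≤ t q := fun q =>
    mul_nonneg (by positivity) (Finset.sum_nonneg fun j _ => hr0 _ _)
  set A : J → (J → X) × Y → ℝ := fun j q => r (q.1 j) q.2 / (1 + r (q.1 j) q.2 / N) with hA
  have hAm : ∀ j, Measurable (A j) := fun j => by have := hri j; fun_prop
  have hA0 : ∀ j q, 0 ≤ A j q := fun j q => by have := hr0 (q.1 j) q.2; positivity
  set κ : ℝ := (s * N ^ s)⁻¹ with hκ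
  have hκ0 : 0 ≤ κ := by positivity
  set H : (J → X) × Y → ℝ := fun q =>
    Real.exp (-l q.2) * InformationTheory.klFun (t q * Real.exp (l q.2)) with hH
  have hHm : Measurable H := by fun_prop
  have hH0 : ∀ q, 0 ≤ H q := fun q => mul_nonneg (Real.exp_nonneg _)
    (InformationTheory.klFun_nonneg (mul_nonneg (ht0 q) (Real.exp_nonneg _)))
  -- The factor 1 makes the subtracted term an instance of `integrable_prod_mul` for the constant
  -- function.
  set F : J → (J → X) × Y → ℝ := fun j q =>
    κ * (r (q.1 j) q.2 * r (q.1 j) q.2 ^ s) + t q * A j q - r (q.1 j) q.2 * 1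
      + r (q.1 j) q.2 * l q.2 with hF
  set G : (J → X) × Y → ℝ := fun q => N⁻¹ * (∑ j, F j q) + Real.exp (-l q.2)
      - N⁻¹ * ∑ j, r (q.1 j) q.2 * 1 with hG
  -- Expanded, H = t ln t + t l + e ^ (-l) - t. Here t ln t is the average over codewords of r ln t,
  -- and `mul_log_le_of_pos` applies to each term.
  have hHG : ∀ q, H q ≤ G q := by
    intro q
    have h1 : H q = t q * Real.log (t q) + t q * l q.2 + Real.exp (-l q.2) - t q := by
      simp only [hH, InformationTheory.klFun]
      rcases (ht0 q).eq_or_lt with h | h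
      · simp [← h]
      · rw [Real.log_mul h.ne' (Real.exp_ne_zero _), Real.log_exp]
        have he : Real.exp (-l q.2) * Real.exp (l q.2) = 1 := by
          rw [← Real.exp_add]; simp
        linear_combination (t q * (Real.log (t q) + l q.2) - t q) * he
    have h2 : ∀ j, r (q.1 j) q.2 * Real.log (t q) ≤
        κ * (r (q.1 j) q.2 * r (q.1 j) q.2 ^ s) + t q * A j q - r (q.1 j) q.2 := by
      intro j
      refine mul_log_le_of_pos (hr0 _ _) hNpos (fun hpos => ?_) hs hs1
      refine mul_pos (by positivity) (hpos.trans_le ?_)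
      exact Finset.single_le_sum (f := fun j => r (q.1 j) q.2) (fun j _ => hr0 _ _)
        (Finset.mem_univ j)
    have h3 : t q * Real.log (t q) + t q * l q.2 = N⁻¹ * ∑ j,
        (r (q.1 j) q.2 * Real.log (t q) + r (q.1 j) q.2 * l q.2) := by
      rw [Finset.sum_add_distrib, ← Finset.sum_mul, ← Finset.sum_mul]
      simp only [ht]
      ring
    have h4 : N⁻¹ * ∑ j, (r (q.1 j) q.2 * Real.log (t q) + r (q.1 j) q.2 * l q.2) ≤
        N⁻¹ * ∑ j, F j q := by
      refine mul_le_mul_of_nonneg_left (Finset.sum_le_sum fun j _ => ?_) (by positivity)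
      have := h2 j
      simp only [hF]
      linarith
    have h5 : N⁻¹ * ∑ j, r (q.1 j) q.2 * 1 = t q := by simp [ht]
    simp only [hG]
    rw [h1, h5]
    linarith
  have hrone : Integrable (fun q => r q.1 q.2 * 1) (PX.prod ρ) :=
    integrable_prod_mul hr hr0 hr1 (l := fun _ => 1) measurable_const (integrable_const 1)
  have hrone1 : ∫ q, r q.1 q.2 * 1 ∂(PX.prod ρ) = 1 := by
    rw [integral_prod_mul_eq hr hr0 hr1 (l := fun _ => 1) measurable_const (integrable_const 1)]
    simp
  have hpull : ∀ {h : X × Y → ℝ}, Measurable h → Integrable h (PX.prod ρ) → ∀ j : J,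
      Integrable (fun q : (J → X) × Y => h (q.1 j, q.2)) (Pc.prod ρ) ∧
      ∫ q : (J → X) × Y, h (q.1 j, q.2) ∂(Pc.prod ρ) = ∫ q, h q ∂(PX.prod ρ) := by
    intro h hm hi j
    have hmp := measurePreserving_eval_prod (PX := PX) (ρ := ρ) j
    refine ⟨hmp.integrable_comp_of_integrable hi, ?_⟩
    rw [← hmp.map_eq, integral_map hmp.measurable.aemeasurable]
    exact hm.aestronglyMeasurable
  have hTi : Integrable (fun q => r q.1 q.2 * r q.1 q.2 ^ s) (PX.prod ρ) := by
    rw [← lintegral_ofReal_ne_top_iff_integrable (by fun_prop)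
      (ae_of_all _ fun q => mul_nonneg (hr0 _ _) (Real.rpow_nonneg (hr0 _ _) _))]
    exact ne_top_of_le_ne_top ENNReal.ofReal_ne_top hT
  have hTle : ∫ q, r q.1 q.2 * r q.1 q.2 ^ s ∂(PX.prod ρ) ≤ T := by
    rw [← ofReal_integral_eq_lintegral_ofReal hTi
      (ae_of_all _ fun q => mul_nonneg (hr0 _ _) (Real.rpow_nonneg (hr0 _ _) _))] at hT
    exact (ENNReal.ofReal_le_ofReal_iff hT0).1 hT
  have hli' := integrable_prod_mul (PX := PX) hr hr0 hr1 hl hli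
  have hli1 := integral_prod_mul_eq (PX := PX) hr hr0 hr1 hl hli
  have htA : ∀ j, Integrable (fun q => t q * A j q) (Pc.prod ρ) ∧
      ∫ q, t q * A j q ∂(Pc.prod ρ) ≤ 1 := by
    intro j
    have hle := lintegral_average_mul_div_le (PX := PX) (ρ := ρ) hr hr0 hr1 j
    have hm : Measurable fun q => t q * A j q := by have := hAm j; fun_prop
    have h0 : ∀ q, 0 ≤ t q * A j q := fun q => mul_nonneg (ht0 q) (hA0 j q)
    have hi : Integrable (fun q => t q * A j q) (Pc.prod ρ) := by
      rw [← lintegral_ofReal_ne_top_iff_integrable hm.aestronglyMeasurable (ae_of_all _ h0)]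
      exact ne_top_of_le_ne_top ENNReal.one_ne_top hle
    refine ⟨hi, ?_⟩
    rw [integral_eq_lintegral_of_nonneg_ae (ae_of_all _ h0) hm.aestronglyMeasurable]
    exact ENNReal.toReal_mono ENNReal.one_ne_top hle
  have hp1 := fun j : J => hpull (by fun_prop) hTi j
  have hp2 := fun j : J => hpull (by fun_prop) hrone j
  have hp3 := fun j : J => hpull (by fun_prop) hli' j
  have hFi : ∀ j, Integrable (F j) (Pc.prod ρ) := fun j =>
    ((((hp1 j).1.const_mul κ).add (htA j).1).sub (hp2 j).1).add (hp3 j).1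
  have hFle : ∀ j, ∫ q, F j q ∂(Pc.prod ρ) ≤ κ * T + ∫ y, l y ∂ρ := by
    intro j
    have e1 : Integrable (fun q : (J → X) × Y => κ * (r (q.1 j) q.2 * r (q.1 j) q.2 ^ s))
      (Pc.prod ρ) := (hp1 j).1.const_mul κ
    have e2 : Integrable (fun q : (J → X) × Y => κ * (r (q.1 j) q.2 * r (q.1 j) q.2 ^ s)
      + t q * A j q) (Pc.prod ρ) := e1.add (htA j).1
    have e3 : Integrable (fun q : (J → X) × Y => κ * (r (q.1 j) q.2 * r (q.1 j) q.2 ^ s)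
      + t q * A j q - r (q.1 j) q.2 * 1) (Pc.prod ρ) := e2.sub (hp2 j).1
    simp only [hF]
    rw [integral_add e3 (hp3 j).1, integral_sub e2 (hp2 j).1, integral_add e1 (htA j).1,
      integral_const_mul, (hp1 j).2, (hp2 j).2, (hp3 j).2, hli1, hrone1]
    have := mul_le_mul_of_nonneg_left hTle hκ0
    have := (htA j).2
    linarith
  have hexp' : Integrable (fun q : (J → X) × Y => Real.exp (-l q.2)) (Pc.prod ρ) :=
    hlexpi.comp_snd Pc
  have hexp1 : ∫ q : (J → X) × Y, Real.exp (-l q.2) ∂(Pc.prod ρ) ≤ 1 := by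
    have := integral_fun_snd (μ := Pc) (ν := ρ) (fun y => Real.exp (-l y))
    rw [this]
    simpa using hlexp
  have hsumFi : Integrable (fun q => N⁻¹ * ∑ j, F j q) (Pc.prod ρ) :=
    (integrable_finsetSum _ fun j _ => hFi j).const_mul _
  have hsumri : Integrable (fun q : (J → X) × Y => N⁻¹ * ∑ j, r (q.1 j) q.2 * 1) (Pc.prod ρ) :=
    (integrable_finsetSum _ fun j _ => (hp2 j).1).const_mul _
  have hGi1 : Integrable (fun q => N⁻¹ * (∑ j, F j q) + Real.exp (-l q.2)) (Pc.prod ρ) :=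
    hsumFi.add hexp'
  have hGi : Integrable G (Pc.prod ρ) := hGi1.sub hsumri
  have hGle : ∫ q, G q ∂(Pc.prod ρ) ≤ ∫ y, l y ∂ρ + κ * T := by
    simp only [hG]
    rw [integral_sub hGi1 hsumri, integral_add hsumFi hexp', integral_const_mul,
      integral_const_mul, integral_finsetSum _ fun j _ => hFi j,
      integral_finsetSum _ fun j _ => (hp2 j).1]
    simp_rw [fun j => (hp2 j).2, hrone1]
    have h1 : ∑ j, ∫ q, F j q ∂(Pc.prod ρ) ≤ N * (κ * T + ∫ y, l y ∂ρ) := by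
      refine (Finset.sum_le_sum fun j _ => hFle j).trans (le_of_eq ?_)
      rw [Finset.sum_const, Finset.card_univ, nsmul_eq_mul]
    have h2 : N⁻¹ * ∑ j : J, (1 : ℝ) = 1 := by
      simp only [Finset.sum_const, Finset.card_univ, nsmul_eq_mul, mul_one]
      exact inv_mul_cancel₀ hNpos.ne'
    have h3 := mul_le_mul_of_nonneg_left h1 (inv_nonneg.2 hNpos.le)
    rw [inv_mul_cancel_left₀ hNpos.ne'] at h3
    rw [h2]
    linarith
  calc ∫⁻ c, ∫⁻ y, ENNReal.ofReal (H (c, y)) ∂ρ ∂Pc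
      = ∫⁻ q, ENNReal.ofReal (H q) ∂(Pc.prod ρ) := by
        rw [lintegral_prod _ (by fun_prop)]
    _ ≤ ∫⁻ q, ENNReal.ofReal (G q) ∂(Pc.prod ρ) :=
        lintegral_mono fun q => ENNReal.ofReal_le_ofReal (hHG q)
    _ = ENNReal.ofReal (∫ q, G q ∂(Pc.prod ρ)) :=
        (ofReal_integral_eq_lintegral_ofReal hGi
          (ae_of_all _ fun q => (hH0 q).trans (hHG q))).symm
    _ ≤ _ := ENNReal.ofReal_le_ofReal hGle

end SoftCovering

/-! ### The additive channel: output densities and likelihood ratios. -/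

section AdditiveChannel

/-- A density is almost surely nonzero under its own law; Fubini then shows that almost every input
keeps the output inside the support of g. -/
lemma ae_ae_add_ne_zero {E : Type*} [AddCommGroup E] [MeasurableSpace E] [MeasurableAdd₂ E]
    {ν PX μ ρ : Measure E} [SFinite PX] [SFinite μ] {g : E → ℝ} (hg : Measurable g)
    (hρ : ρ = ν.withDensity fun y => ENNReal.ofReal (g y)) (hconv : PX.conv μ = ρ) :
    ∀ᵐ x ∂PX, ∀ᵐ z ∂μ, g (x + z) ≠ 0 := by
  have h1 : ∀ᵐ y ∂ρ, g y ≠ 0 := by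
    rw [hρ, ae_withDensity_iff (by fun_prop)]
    exact ae_of_all _ fun z hz h0 => by simp [h0] at hz
  rw [← hconv] at h1
  unfold Measure.conv at h1
  exact Measure.ae_ae_of_ae_prod (ae_of_ae_map (by fun_prop) h1)

lemma klDiv_withDensity_ofReal {E : Type*} [MeasurableSpace E] {μ : Measure E}
    [IsFiniteMeasure μ] {u : E → ℝ} (hu : Measurable u) (hu0 : ∀ y, 0 ≤ u y)
    [IsFiniteMeasure (μ.withDensity fun y => ENNReal.ofReal (u y))] :
    InformationTheory.klDiv (μ.withDensity fun y => ENNReal.ofReal (u y)) μ =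
      ∫⁻ y, ENNReal.ofReal (InformationTheory.klFun (u y)) ∂μ := by
  rw [InformationTheory.klDiv_eq_lintegral_klFun_of_ac (withDensity_absolutelyContinuous _ _)]
  refine lintegral_congr_ae ?_
  filter_upwards [Measure.rnDeriv_withDensity μ (f := fun y => ENNReal.ofReal (u y))
    (by fun_prop)] with y hy
  rw [hy, ENNReal.toReal_ofReal (hu0 y)]

variable {E : Type*} [AddCommGroup E] [MeasurableSpace E] [MeasurableAdd₂ E] [MeasurableSub₂ E]
  {ν : Measure E} [ν.IsAddLeftInvariant] {f g : E → ℝ} {PX μ ρ : Measure E}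
  [IsProbabilityMeasure PX] [IsProbabilityMeasure ρ]

/-- By Tonelli the convolution has the mixture of translates as a density, and two densities of one
finite measure agree almost everywhere. -/
lemma ae_lintegral_sub_eq [SigmaFinite ν] [IsProbabilityMeasure μ] (hf : Measurable f)
    (hg : Measurable g)
    (hμ : μ = ν.withDensity fun y => ENNReal.ofReal (f y))
    (hρ : ρ = ν.withDensity fun y => ENNReal.ofReal (g y)) (hconv : PX.conv μ = ρ) :
    ∀ᵐ y ∂ν, ∫⁻ x, ENNReal.ofReal (f (y - x)) ∂PX = ENNReal.ofReal (g y) := by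
  have h1 : PX.conv μ = ν.withDensity fun y => ∫⁻ x, ENNReal.ofReal (f (y - x)) ∂PX := by
    ext s hs
    rw [← lintegral_indicator_one hs, Measure.lintegral_conv (measurable_one.indicator hs),
      withDensity_apply _ hs, ← lintegral_indicator hs]
    have hx : ∀ x, ∫⁻ z, s.indicator (1 : E → ℝ≥0∞) (x + z) ∂μ =
        ∫⁻ y, ENNReal.ofReal (f (y - x)) * s.indicator 1 y ∂ν := fun x => by
      rw [hμ, lintegral_withDensity_add_left hf (measurable_one.indicator hs)]
    have hind : Measurable (s.indicator (1 : E → ℝ≥0∞)) := measurable_one.indicator hs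
    simp_rw [hx]
    rw [lintegral_lintegral_swap (by fun_prop)]
    refine lintegral_congr fun y => ?_
    rw [lintegral_mul_const _ (by fun_prop)]
    by_cases hy : y ∈ s <;> simp [hy]
  rw [h1, hρ] at hconv
  refine (withDensity_eq_iff ?_ ?_ ?_).1 hconv
  · exact Measurable.aemeasurable (Measurable.lintegral_prod_right' (ν := PX)
      (f := fun q : E × E => ENNReal.ofReal (f (q.1 - q.2))) (by fun_prop))
  · fun_prop
  · rw [← setLIntegral_univ, ← withDensity_apply _ MeasurableSet.univ, hconv, ← hρ]
    simp

lemma ae_lintegral_ratio_eq_one [SigmaFinite ν] [IsProbabilityMeasure μ] (hf : Measurable f)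
    (hg : Measurable g)
    (hμ : μ = ν.withDensity fun y => ENNReal.ofReal (f y))
    (hρ : ρ = ν.withDensity fun y => ENNReal.ofReal (g y)) (hconv : PX.conv μ = ρ) :
    ∀ᵐ y ∂ρ, ∫⁻ x, ENNReal.ofReal (f (y - x) / g y) ∂PX = 1 := by
  rw [hρ, ae_withDensity_iff (by fun_prop)]
  filter_upwards [ae_lintegral_sub_eq hf hg hμ hρ hconv] with y hy hy0
  have hpos : 0 < g y := by simpa using hy0
  simp_rw [div_eq_mul_inv]
  simp_rw [fun x => ENNReal.ofReal_mul' (p := f (y - x)) (inv_nonneg.2 hpos.le)]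
  rw [lintegral_mul_const _ (by fun_prop), hy, ← ENNReal.ofReal_mul hpos.le,
    mul_inv_cancel₀ hpos.ne', ENNReal.ofReal_one]

/-- The joint law of input and output has density `f (y - x) / g y` with respect to the product of
its marginals. -/
lemma lintegral_joint_eq [IsProbabilityMeasure μ] (hf : Measurable f) (hf0 : ∀ y, 0 ≤ f y)
    (hg : Measurable g)
    (hg0 : ∀ y, 0 ≤ g y)
    (hμ : μ = ν.withDensity fun y => ENNReal.ofReal (f y))
    (hρ : ρ = ν.withDensity fun y => ENNReal.ofReal (g y)) (hconv : PX.conv μ = ρ)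
    {h : E × E → ℝ≥0∞} (hh : Measurable h) :
    ∫⁻ q, h (q.1, q.1 + q.2) ∂(PX.prod μ) =
      ∫⁻ q, ENNReal.ofReal (f (q.2 - q.1) / g q.2) * h q ∂(PX.prod ρ) := by
  rw [lintegral_prod _ (by fun_prop), lintegral_prod _ (by fun_prop)]
  refine lintegral_congr_ae ?_
  filter_upwards [ae_ae_add_ne_zero hg hρ hconv] with x hx
  have hz : ∀ᵐ y ∂ν, ENNReal.ofReal (f (y - x)) ≠ 0 → g y ≠ 0 := by
    rw [← ae_withDensity_iff (by fun_prop), ← map_add_left_withDensity hf x, ← hμ]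
    exact (ae_map_iff (p := fun y => g y ≠ 0) (by fun_prop)
      (measurableSet_eq_fun hg measurable_const).compl).2 hx
  have h1 : ∫⁻ z, h (x, x + z) ∂μ = ∫⁻ y, ENNReal.ofReal (f (y - x)) * h (x, y) ∂ν := by
    rw [hμ, lintegral_withDensity_add_left (h := fun y => h (x, y)) hf (by fun_prop)]
  have h2 : ∫⁻ y, ENNReal.ofReal (f (y - x) / g y) * h (x, y) ∂ρ =
      ∫⁻ y, ENNReal.ofReal (g y) * (ENNReal.ofReal (f (y - x) / g y) * h (x, y)) ∂ν := by
    rw [hρ, lintegral_withDensity_eq_lintegral_mul _ (by fun_prop) (by fun_prop)]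
    rfl
  rw [h1, h2]
  refine lintegral_congr_ae ?_
  filter_upwards [hz] with y hy
  by_cases h0 : ENNReal.ofReal (f (y - x)) = 0
  · have hfy : f (y - x) = 0 := le_antisymm (ENNReal.ofReal_eq_zero.1 h0) (hf0 _)
    simp [hfy]
  · rw [← mul_assoc, ← ENNReal.ofReal_mul (hg0 y), mul_div_cancel₀ _ (hy h0)]

/-- The condition on `x` places the translate on the support of `f`; any mass outside would be lost,
as the quotient by 0 defaults to 0. -/
lemma map_add_left_eq_withDensity (hf : Measurable f) (hf0 : ∀ y, 0 ≤ f y)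
    (hμ : μ = ν.withDensity fun y => ENNReal.ofReal (f y)) {x : E}
    (hx : ∀ᵐ z ∂μ, f (x + z) ≠ 0) :
    μ.map (fun z => x + z) = μ.withDensity fun y => ENNReal.ofReal (f (y - x) / f y) := by
  have hz : ∀ᵐ y ∂ν, ENNReal.ofReal (f (y - x)) ≠ 0 → f y ≠ 0 := by
    rw [← ae_withDensity_iff (by fun_prop), ← map_add_left_withDensity hf x, ← hμ]
    exact (ae_map_iff (p := fun y => f y ≠ 0) (by fun_prop)
      (measurableSet_eq_fun hf measurable_const).compl).2 hx
  conv_rhs => rw [hμ]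
  rw [hμ, map_add_left_withDensity hf x, ← withDensity_mul _ (by fun_prop) (by fun_prop)]
  refine withDensity_congr_ae ?_
  filter_upwards [hz] with y hy
  simp only [Pi.mul_apply]
  by_cases h0 : ENNReal.ofReal (f (y - x)) = 0
  · have hfy : f (y - x) = 0 := le_antisymm (ENNReal.ofReal_eq_zero.1 h0) (hf0 _)
    simp [hfy]
  · rw [← ENNReal.ofReal_mul (hf0 y), mul_div_cancel₀ _ (hy h0)]

end AdditiveChannel

/-! ### Threshold decoding and pairs of independent codewords. -/

section Decoder

lemma exists_threshold_decoder {Y : Type*} [MeasurableSpace Y] {M : ℕ} (hM : 0 < M)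
    {u : Fin M → Y → ℝ} (hu : ∀ m, Measurable (u m)) (θ : ℝ) :
    ∃ d : Y → Fin M, Measurable d ∧
      ∀ y m, θ < u m y → (∀ m', m' ≠ m → u m' y ≤ θ) → d y = m := by
  classical
  let sel : (Fin M → Prop) → Fin M := fun b => if h : ∃ m, b m then h.choose else ⟨0, hM⟩
  refine ⟨fun y => sel fun m => θ < u m y, ?_, ?_⟩
  · have h1 : Measurable sel := Measurable.of_discrete
    refine h1.comp (measurable_pi_lambda _ fun m => ?_)
    exact measurableSet_setOfPred.1 (measurableSet_lt measurable_const (hu m))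
  · intro y m hm hother
    have hex : ∃ m, θ < u m y := ⟨m, hm⟩
    simp only [sel, dif_pos hex]
    by_contra hne
    exact absurd hex.choose_spec (not_lt.2 (hother _ hne))

lemma measurePreserving_eval_pair {X J : Type*} [MeasurableSpace X] [Fintype J] {PX : Measure X}
    [IsProbabilityMeasure PX] {i j : J} (hij : i ≠ j) :
    MeasurePreserving (fun c : J → X => (c i, c j)) (Measure.pi fun _ : J => PX)
      (PX.prod PX) := by
  refine ⟨by fun_prop, ?_⟩
  have hind : IndepFun (fun c : J → X => c i) (fun c => c j) (Measure.pi fun _ : J => PX) :=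
    (iIndepFun_pi (μ := fun _ : J => PX) (X := fun _ => id)
      (fun _ => aemeasurable_id)).indepFun hij
  rw [(indepFun_iff_map_prod_eq_prod_map_map (measurable_pi_apply i).aemeasurable
    (measurable_pi_apply j).aemeasurable).1 hind,
    (measurePreserving_eval (fun _ : J => PX) i).map_eq,
    (measurePreserving_eval (fun _ : J => PX) j).map_eq]

end Decoder

/-! ### One-shot random coding. -/

section RandomCoding

variable {n : ℕ} {p : ℝ → ℝ} {f g : (Fin n → ℝ) → ℝ} {PX ρ : Measure (Fin n → ℝ)}
  [IsProbabilityMeasure PX] [IsProbabilityMeasure (noiseLawN p n)]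

/-- The divergence of the output law of a codebook, in terms of the density of the target output
law. -/
lemma klDiv_outputLaw_eq (C : Code n) (hf : Measurable f) (hf0 : ∀ y, 0 ≤ f y)
    (hg : Measurable g) (hg0 : ∀ y, 0 ≤ g y) (hfg : ∀ y, f y = 0 ↔ g y = 0)
    (hμ : noiseLawN p n = volume.withDensity fun y => ENNReal.ofReal (f y))
    (hρ : ρ = volume.withDensity fun y => ENNReal.ofReal (g y))
    (hC : ∀ m k, ∀ᵐ z ∂noiseLawN p n, g (C.enc m k + z) ≠ 0) :
    InformationTheory.klDiv (C.outputLaw p) (noiseLawN p n) =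
      ∫⁻ y, ENNReal.ofReal (Real.exp (-Real.log (g y / f y)) * InformationTheory.klFun
        ((((C.numMsg : ℝ) * C.numKey)⁻¹ * ∑ m, ∑ k, f (y - C.enc m k) / g y) *
          Real.exp (Real.log (g y / f y)))) ∂ρ := by
  set μ := noiseLawN p n with hμdef
  have hNpos := C.numMsg_mul_numKey_pos
  set u : (Fin n → ℝ) → ℝ := fun y =>
    ((C.numMsg : ℝ) * C.numKey)⁻¹ * ∑ m, ∑ k, f (y - C.enc m k) / f y with hu
  have hu0 : ∀ y, 0 ≤ u y := fun y => mul_nonneg (inv_nonneg.2 hNpos.le)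
    (Finset.sum_nonneg fun m _ => Finset.sum_nonneg fun k _ => div_nonneg (hf0 _) (hf0 _))
  have hum : Measurable u := by fun_prop
  have hPY : C.outputLaw p = μ.withDensity fun y => ENNReal.ofReal (u y) := by
    unfold Code.outputLaw
    have h1 : ∀ m k, μ.map (fun z => C.enc m k + z) =
        μ.withDensity fun y => ENNReal.ofReal (f (y - C.enc m k) / f y) := fun m k =>
      map_add_left_eq_withDensity hf hf0 hμ ((hC m k).mono fun z hz h0 => hz ((hfg _).1 h0))
    have h2 : (fun y => ENNReal.ofReal (u y)) = ((C.numMsg : ℝ≥0∞) * (C.numKey : ℝ≥0∞))⁻¹ •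
        fun y => ∑ m, ∑ k, ENNReal.ofReal (f (y - C.enc m k) / f y) := by
      ext y
      simp only [hu, Pi.smul_apply, smul_eq_mul]
      rw [ENNReal.ofReal_mul (inv_nonneg.2 hNpos.le), ENNReal.ofReal_inv_of_pos hNpos,
        ENNReal.ofReal_mul (by positivity), ENNReal.ofReal_natCast, ENNReal.ofReal_natCast,
        ENNReal.ofReal_sum_of_nonneg fun m _ => Finset.sum_nonneg fun k _ =>
          div_nonneg (hf0 _) (hf0 _)]
      congr 1
      exact Finset.sum_congr rfl fun m _ =>
        ENNReal.ofReal_sum_of_nonneg fun k _ => div_nonneg (hf0 _) (hf0 _)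
    rw [h2, withDensity_smul _ (by fun_prop)]
    congr 1
    ext s hs
    simp only [← hμdef, h1]
    simp only [Measure.coe_finsetSum, Finset.sum_apply, withDensity_apply _ hs]
    rw [lintegral_finsetSum _ (by fun_prop)]
    refine Finset.sum_congr rfl fun m _ => ?_
    rw [lintegral_finsetSum _ (by fun_prop)]
  have hfin : IsFiniteMeasure (μ.withDensity fun y => ENNReal.ofReal (u y)) := by
    rw [← hPY]
    have := C.isProbabilityMeasure_outputLaw p
    infer_instance
  rw [hPY, klDiv_withDensity_ofReal hum hu0, hρ]
  conv_lhs => rw [hμ]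
  rw [lintegral_withDensity_eq_lintegral_mul _ (by fun_prop) (by fun_prop),
    lintegral_withDensity_eq_lintegral_mul _ (by fun_prop) (by fun_prop)]
  refine lintegral_congr fun y => ?_
  simp only [Pi.mul_apply]
  -- Where `g` vanishes so does `f`, and both weights annihilate the integrand.
  rcases (hg0 y).eq_or_lt with h | h
  · rw [← h, (hfg y).2 h.symm]
    simp
  · have hfy : 0 < f y := lt_of_le_of_ne (hf0 y) fun h0 => h.ne' ((hfg y).1 h0.symm)
    rw [← ENNReal.ofReal_mul h.le, ← ENNReal.ofReal_mul hfy.le, Real.exp_neg,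
      Real.exp_log (div_pos h hfy)]
    congr 1
    have h1 : (((C.numMsg : ℝ) * C.numKey)⁻¹ * ∑ m, ∑ k, f (y - C.enc m k) / g y) *
        (g y / f y) = u y := by
      simp only [hu, ← Finset.sum_div]
      field_simp
    rw [h1]
    field_simp

/-- The mean of a sum of functions of single codewords and of pairs of codewords with the same key
over a random codebook. -/
lemma lintegral_codebook_le {X : Type*} [MeasurableSpace X] {PX : Measure X}
    [IsProbabilityMeasure PX] {M K : ℕ} (hM : 0 < M) (hK : 0 < K) {a : X → ℝ≥0∞}
    {b : X × X → ℝ≥0∞} (ha : Measurable a) (hb : Measurable b) :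
    ∫⁻ c : Fin M × Fin K → X, ((M : ℝ≥0∞) * K)⁻¹ * ∑ m, ∑ k,
        (a (c (m, k)) + ∑ m' ∈ Finset.univ.erase m, b (c (m, k), c (m', k)))
        ∂(Measure.pi fun _ => PX) ≤ ∫⁻ x, a x ∂PX + M * ∫⁻ q, b q ∂(PX.prod PX) := by
  have hM' : (M : ℝ≥0∞) ≠ 0 := by exact_mod_cast hM.ne'
  have hK' : (K : ℝ≥0∞) ≠ 0 := by exact_mod_cast hK.ne'
  have hterm : ∀ (m : Fin M) (k : Fin K), ∫⁻ c : Fin M × Fin K → X,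
      (a (c (m, k)) + ∑ m' ∈ Finset.univ.erase m, b (c (m, k), c (m', k)))
        ∂(Measure.pi fun _ => PX) ≤ ∫⁻ x, a x ∂PX + M * ∫⁻ q, b q ∂(PX.prod PX) := by
    intro m k
    rw [lintegral_add_left (by fun_prop), lintegral_finsetSum _ (by fun_prop),
      (measurePreserving_eval (fun _ : Fin M × Fin K => PX) (m, k)).lintegral_comp ha]
    refine add_le_add_right ?_ _
    -- The competing codewords share the key, so distinct messages have independent codewords and
    -- the price is a factor M rather than M K.
    have h4 : ∀ m' ∈ Finset.univ.erase m, ∫⁻ c : Fin M × Fin K → X,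
        b (c (m, k), c (m', k)) ∂(Measure.pi fun _ => PX) = ∫⁻ q, b q ∂(PX.prod PX) := by
      intro m' hm'
      have hne : ((m, k) : Fin M × Fin K) ≠ (m', k) := fun h =>
        (Finset.mem_erase.1 hm').1 (Prod.ext_iff.1 h).1.symm
      exact (measurePreserving_eval_pair (PX := PX) hne).lintegral_comp hb
    rw [Finset.sum_congr rfl h4, Finset.sum_const, nsmul_eq_mul]
    refine mul_le_mul_left ?_ _
    have : (Finset.univ.erase m).card ≤ M := by simp
    exact_mod_cast this
  rw [lintegral_const_mul _ (by fun_prop), lintegral_finsetSum _ (by fun_prop)]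
  have hsum : ∑ m : Fin M, ∫⁻ c : Fin M × Fin K → X, ∑ k,
      (a (c (m, k)) + ∑ m' ∈ Finset.univ.erase m, b (c (m, k), c (m', k)))
        ∂(Measure.pi fun _ => PX) ≤
      (M : ℝ≥0∞) * (K * (∫⁻ x, a x ∂PX + M * ∫⁻ q, b q ∂(PX.prod PX))) := by
    refine (Finset.sum_le_sum fun m _ => ?_).trans
      (le_of_eq (by rw [Finset.sum_const, Finset.card_univ, Fintype.card_fin, nsmul_eq_mul]))
    rw [lintegral_finsetSum _ (by fun_prop)]
    refine (Finset.sum_le_sum fun k _ => hterm m k).trans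
      (le_of_eq (by rw [Finset.sum_const, Finset.card_univ, Fintype.card_fin, nsmul_eq_mul]))
  refine (mul_le_mul_right hsum _).trans (le_of_eq ?_)
  rw [← mul_assoc, ← mul_assoc, mul_assoc _ (M : ℝ≥0∞), ENNReal.inv_mul_cancel
    (mul_ne_zero hM' hK') (ENNReal.mul_ne_top (ENNReal.natCast_ne_top _)
    (ENNReal.natCast_ne_top _)), one_mul]

/-- The likelihood ratio of an independent codeword has mean 1 at the output, so by Markov's
inequality a wrong message reaches the threshold θ with probability at most 1 / θ. -/
lemma lintegral_independent_ratio_eq_one (hf : Measurable f) (hg : Measurable g)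
    (hμ : noiseLawN p n = volume.withDensity fun y => ENNReal.ofReal (f y))
    [IsProbabilityMeasure ρ] (hρ : ρ = volume.withDensity fun y => ENNReal.ofReal (g y))
    (hconv : PX.conv (noiseLawN p n) = ρ) :
    ∫⁻ q, ∫⁻ z, ENNReal.ofReal (f (q.1 + z - q.2) / g (q.1 + z)) ∂noiseLawN p n
      ∂(PX.prod PX) = 1 := by
  have hm : Measurable fun q : (Fin n → ℝ) × (Fin n → ℝ) =>
      ∫⁻ z, ENNReal.ofReal (f (q.1 + z - q.2) / g (q.1 + z)) ∂noiseLawN p n :=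
    Measurable.lintegral_prod_right' (ν := noiseLawN p n)
      (f := fun w : ((Fin n → ℝ) × (Fin n → ℝ)) × (Fin n → ℝ) =>
        ENNReal.ofReal (f (w.1.1 + w.2 - w.1.2) / g (w.1.1 + w.2))) (by fun_prop)
  rw [lintegral_prod_symm _ hm.aemeasurable]
  have h3 : ∀ x', ∫⁻ x, ∫⁻ z, ENNReal.ofReal (f (x + z - x') / g (x + z)) ∂noiseLawN p n ∂PX =
      ∫⁻ y, ENNReal.ofReal (f (y - x') / g y) ∂ρ := by
    intro x'
    rw [← hconv, Measure.lintegral_conv (by fun_prop)]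
  simp_rw [h3]
  rw [lintegral_lintegral_swap (by fun_prop),
    lintegral_congr_ae (ae_lintegral_ratio_eq_one (ν := volume) hf hg hμ hρ hconv)]
  simp

/-- The one-shot achievability bound. -/
lemma exists_code {M K : ℕ} (hM : 0 < M) (hK : 0 < K)
    (hf : Measurable f) (hf0 : ∀ y, 0 ≤ f y) (hg : Measurable g) (hg0 : ∀ y, 0 ≤ g y)
    (hfg : ∀ y, f y = 0 ↔ g y = 0)
    (hμ : noiseLawN p n = volume.withDensity fun y => ENNReal.ofReal (f y))
    [IsProbabilityMeasure ρ] (hρ : ρ = volume.withDensity fun y => ENNReal.ofReal (g y))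
    (hconv : PX.conv (noiseLawN p n) = ρ)
    (hli : Integrable (fun y => Real.log (g y / f y)) ρ)
    {s T : ℝ} (hs : 0 < s) (hs1 : s ≤ 1) (hT0 : 0 ≤ T)
    (hT : ∫⁻ q, ENNReal.ofReal ((f q.2 / g (q.1 + q.2)) ^ s) ∂(PX.prod (noiseLawN p n)) ≤
      ENNReal.ofReal T)
    {θ : ℝ} (hθ : 0 < θ) {e : ℝ} (he0 : 0 ≤ e)
    (he : (PX.prod (noiseLawN p n)) {q | f q.2 / g (q.1 + q.2) ≤ θ} ≤ ENNReal.ofReal e)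
    {Δ η ε : ℝ} (hΔ : 0 < Δ) (hη : 0 ≤ η) (hη1 : η ≤ 1) (hε : 0 < ε)
    (hcov : ∫ y, Real.log (g y / f y) ∂ρ + (s * ((M : ℝ) * K) ^ s)⁻¹ * T ≤ (1 - η) * Δ)
    (herr : e + M / θ ≤ η * ε) :
    ∃ C : Code n, C.numMsg = M ∧ C.numKey = K ∧ C.IsCovert p Δ ∧ C.avgError p ≤ ε := by
  set μ := noiseLawN p n with hμdef
  have hMne : Nonempty (Fin M × Fin K) := ⟨(⟨0, hM⟩, ⟨0, hK⟩)⟩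
  set r : (Fin n → ℝ) → (Fin n → ℝ) → ℝ := fun x y => f (y - x) / g y with hr
  have hrm : Measurable (Function.uncurry r) := by
    have : Function.uncurry r = fun q : (Fin n → ℝ) × (Fin n → ℝ) => f (q.2 - q.1) / g q.2 := rfl
    rw [this]; fun_prop
  have hr0 : ∀ x y, 0 ≤ r x y := fun x y => div_nonneg (hf0 _) (hg0 _)
  have hlexpl : ∫⁻ y, ENNReal.ofReal (Real.exp (-Real.log (g y / f y))) ∂ρ ≤ 1 := by
    rw [hρ, lintegral_withDensity_eq_lintegral_mul _ (by fun_prop) (by fun_prop)]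
    have h1 : (1 : ℝ≥0∞) = ∫⁻ y, ENNReal.ofReal (f y) := by
      rw [← setLIntegral_univ, ← withDensity_apply _ MeasurableSet.univ, ← hμ]
      simp
    rw [h1]
    refine lintegral_mono fun y => ?_
    simp only [Pi.mul_apply]
    rcases (hg0 y).eq_or_lt with h | h
    · simp [← h]
    · have hfy : 0 < f y := lt_of_le_of_ne (hf0 y) fun h0 => h.ne' ((hfg y).1 h0.symm)
      rw [← ENNReal.ofReal_mul h.le, Real.exp_neg, Real.exp_log (div_pos h hfy), inv_div,
        mul_div_cancel₀ _ h.ne']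
  have hlexpi : Integrable (fun y => Real.exp (-Real.log (g y / f y))) ρ := by
    rw [← lintegral_ofReal_ne_top_iff_integrable (Measurable.aestronglyMeasurable (by fun_prop))
      (ae_of_all _ fun y => Real.exp_nonneg _)]
    exact ne_top_of_le_ne_top ENNReal.one_ne_top hlexpl
  have hlexp : ∫ y, Real.exp (-Real.log (g y / f y)) ∂ρ ≤ 1 := by
    rw [integral_eq_lintegral_of_nonneg_ae (ae_of_all _ fun y => Real.exp_nonneg _)
      (Measurable.aestronglyMeasurable (by fun_prop))]
    exact ENNReal.toReal_mono ENNReal.one_ne_top hlexpl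
  -- Change of measure: the moment of order s under the joint law is the moment of order 1 + s under
  -- the product of the marginals.
  have hT' : ∫⁻ q, ENNReal.ofReal (r q.1 q.2 * r q.1 q.2 ^ s) ∂(PX.prod ρ) ≤
      ENNReal.ofReal T := by
    have h1 := lintegral_joint_eq (ν := volume) hf hf0 hg hg0 hμ hρ hconv
      (h := fun q => ENNReal.ofReal ((f (q.2 - q.1) / g q.2) ^ s)) (by fun_prop)
    simp only [add_sub_cancel_left] at h1
    rw [h1] at hT
    simp_rw [ENNReal.ofReal_mul (hr0 _ _)]
    exact hT
  have hsoft := soft_covering (J := Fin M × Fin K) hrm hr0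
    (ae_lintegral_ratio_eq_one (ν := volume) hf hg hμ hρ hconv) (by fun_prop) hli hlexpi hlexp
    hs hs1 hT0 hT'
  have hset : MeasurableSet {q : (Fin n → ℝ) × (Fin n → ℝ) | f q.2 / g (q.1 + q.2) ≤ θ} :=
    measurableSet_le (by fun_prop) measurable_const
  -- `a` is the probability that the true codeword misses the threshold, `b` the Markov bound for
  -- one rival reaching it.
  set a : (Fin n → ℝ) → ℝ≥0∞ := fun x => μ {z | f z / g (x + z) ≤ θ} with ha
  set b : (Fin n → ℝ) × (Fin n → ℝ) → ℝ≥0∞ := fun q => (ENNReal.ofReal θ)⁻¹ *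
    ∫⁻ z, ENNReal.ofReal (f (q.1 + z - q.2) / g (q.1 + z)) ∂μ with hb
  have ham : Measurable a := measurable_measure_prodMk_left hset
  have hbm : Measurable b := Measurable.const_mul (Measurable.lintegral_prod_right' (ν := μ)
    (f := fun w : ((Fin n → ℝ) × (Fin n → ℝ)) × (Fin n → ℝ) =>
      ENNReal.ofReal (f (w.1.1 + w.2 - w.1.2) / g (w.1.1 + w.2))) (by fun_prop)) _
  have hai : ∫⁻ x, a x ∂PX ≤ ENNReal.ofReal e := by
    rw [Measure.prod_apply hset] at he
    exact he
  have hbi : ∫⁻ q, b q ∂(PX.prod PX) = (ENNReal.ofReal θ)⁻¹ := by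
    simp only [hb]
    rw [lintegral_const_mul' _ _ (by simp [hθ]),
      lintegral_independent_ratio_eq_one hf hg hμ hρ hconv, mul_one]
  set D : (Fin M × Fin K → (Fin n → ℝ)) → ℝ≥0∞ := fun c =>
    ∫⁻ y, ENNReal.ofReal (Real.exp (-Real.log (g y / f y)) * InformationTheory.klFun
        (((Fintype.card (Fin M × Fin K) : ℝ)⁻¹ * ∑ j, r (c j) y) *
          Real.exp (Real.log (g y / f y)))) ∂ρ with hD
  set Er : (Fin M × Fin K → (Fin n → ℝ)) → ℝ≥0∞ := fun c => ((M : ℝ≥0∞) * K)⁻¹ * ∑ m, ∑ k,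
    (a (c (m, k)) + ∑ m' ∈ Finset.univ.erase m, b (c (m, k), c (m', k))) with hEr
  have hErm : Measurable Er := by fun_prop
  have herrint : ∫⁻ c, Er c ∂(Measure.pi fun _ : Fin M × Fin K => PX) ≤
      ENNReal.ofReal (e + M / θ) := by
    refine (lintegral_codebook_le hM hK ham hbm).trans ?_
    rw [ENNReal.ofReal_add he0 (by positivity), ENNReal.ofReal_div_of_pos hθ,
      ENNReal.ofReal_natCast, div_eq_mul_inv, hbi]
    exact add_le_add_left hai _
  have hDm : Measurable D := by
    refine Measurable.lintegral_prod_right' (ν := ρ)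
      (f := fun w : (Fin M × Fin K → (Fin n → ℝ)) × (Fin n → ℝ) =>
        ENNReal.ofReal (Real.exp (-Real.log (g w.2 / f w.2)) * InformationTheory.klFun
        (((Fintype.card (Fin M × Fin K) : ℝ)⁻¹ * ∑ j, r (w.1 j) w.2) *
          Real.exp (Real.log (g w.2 / f w.2))))) ?_
    simp only [hr]
    fun_prop
  -- Divergence in units of `Δ` plus error in units of `ε` has mean at most (1 - η) + η = 1, so a
  -- single codebook can meet both constraints.
  have hsel : ∫⁻ c, ((ENNReal.ofReal Δ)⁻¹ * D c + (ENNReal.ofReal ε)⁻¹ * Er c)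
      ∂(Measure.pi fun _ : Fin M × Fin K => PX) ≤ 1 := by
    rw [lintegral_add_left (by fun_prop), lintegral_const_mul' _ _ (by simp [hΔ]),
      lintegral_const_mul' _ _ (by simp [hε])]
    have hcard : (Fintype.card (Fin M × Fin K) : ℝ) = (M : ℝ) * K := by simp
    rw [hcard] at hsoft
    calc _ ≤ (ENNReal.ofReal Δ)⁻¹ * ENNReal.ofReal ((1 - η) * Δ) +
        (ENNReal.ofReal ε)⁻¹ * ENNReal.ofReal (η * ε) := by
          refine add_le_add (mul_le_mul_right ?_ _) (mul_le_mul_right ?_ _)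
          · exact hsoft.trans (ENNReal.ofReal_le_ofReal hcov)
          · exact herrint.trans (ENNReal.ofReal_le_ofReal herr)
      _ = 1 := by
          rw [← ENNReal.ofReal_inv_of_pos hΔ, ← ENNReal.ofReal_inv_of_pos hε,
            ← ENNReal.ofReal_mul (by positivity), ← ENNReal.ofReal_mul (by positivity),
            ← ENNReal.ofReal_add]
          · rw [← ENNReal.ofReal_one]
            congr 1
            field_simp
            ring
          · have : 0 ≤ 1 - η := by linarith
            positivity
          · positivity
  -- The divergence formula needs outputs inside the support; the exceptional codebooks form a null
  -- set that the selection must avoid.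
  have hgood : ∀ᵐ c ∂(Measure.pi fun _ : Fin M × Fin K => PX), ∀ j, ∀ᵐ z ∂μ, g (c j + z) ≠ 0 := by
    rw [ae_all_iff]
    intro j
    exact (measurePreserving_eval (fun _ : Fin M × Fin K => PX) j).quasiMeasurePreserving.ae
      (ae_ae_add_ne_zero hg hρ hconv)
  obtain ⟨c, hc, hcle⟩ := exists_notMem_null_le_lintegral
    (f := fun c => (ENNReal.ofReal Δ)⁻¹ * D c + (ENNReal.ofReal ε)⁻¹ * Er c) (by fun_prop) hgood
  have hc' : ∀ j, ∀ᵐ z ∂μ, g (c j + z) ≠ 0 := by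
    by_contra h
    exact hc h
  have hcle1 := hcle.trans hsel
  have hDle : D c ≤ ENNReal.ofReal Δ := by
    have h1 : (ENNReal.ofReal Δ)⁻¹ * D c ≤ 1 := le_self_add.trans hcle1
    rwa [mul_comm, ← div_eq_mul_inv, ENNReal.div_le_iff (by simp [hΔ]) ENNReal.ofReal_ne_top,
      one_mul] at h1
  have hErle : Er c ≤ ENNReal.ofReal ε := by
    have h1 : (ENNReal.ofReal ε)⁻¹ * Er c ≤ 1 := le_add_self.trans hcle1
    rwa [mul_comm, ← div_eq_mul_inv, ENNReal.div_le_iff (by simp [hε]) ENNReal.ofReal_ne_top,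
      one_mul] at h1
  have hdec : ∀ k : Fin K, ∃ d : (Fin n → ℝ) → Fin M, Measurable d ∧
      ∀ y m, θ < r (c (m, k)) y → (∀ m', m' ≠ m → r (c (m', k)) y ≤ θ) → d y = m := fun k =>
    exists_threshold_decoder hM (u := fun m y => r (c (m, k)) y)
      (fun m => by simp only [hr]; fun_prop) θ
  choose d hdm hd using hdec
  let C : Code n :=
    { numMsg := M, numKey := K, numMsg_pos := hM, numKey_pos := hK,
      enc := fun m k => c (m, k), dec := fun y k => d k y, measurable_dec := hdm }
  refine ⟨C, rfl, rfl, ?_, ?_⟩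
  · unfold Code.IsCovert
    rw [klDiv_outputLaw_eq C hf hf0 hg hg0 hfg hμ hρ fun m k => hc' (m, k)]
    refine le_trans (le_of_eq ?_) hDle
    simp only [hD, hr, Fintype.sum_prod_type, Fintype.card_prod, Fintype.card_fin, Nat.cast_mul]
    rfl
  · have hbound : ∀ (m : Fin M) (k : Fin K), μ {z | d k (c (m, k) + z) ≠ m} ≤
        a (c (m, k)) + ∑ m' ∈ Finset.univ.erase m, b (c (m, k), c (m', k)) := by
      intro m k
      have hsub : {z | d k (c (m, k) + z) ≠ m} ⊆ {z | f z / g (c (m, k) + z) ≤ θ} ∪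
          ⋃ m' ∈ Finset.univ.erase m, {z | θ ≤ r (c (m', k)) (c (m, k) + z)} := by
        intro z hz
        by_contra hcon
        simp only [Set.mem_union, Set.mem_iUnion, Set.mem_ofPred_eq, not_or, not_exists, not_le,
          Finset.mem_erase, Finset.mem_univ, and_true] at hcon
        refine hz (hd k _ m ?_ fun m' hm' => (hcon.2 m' hm').le)
        simpa [hr] using hcon.1
      refine (measure_mono hsub).trans ((measure_union_le _ _).trans ?_)
      refine add_le_add_right ((measure_biUnion_finset_le _ _).trans ?_) _
      refine Finset.sum_le_sum fun m' _ => ?_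
      have hmk := meas_ge_le_lintegral_div (μ := μ)
        (f := fun z => ENNReal.ofReal (f (c (m, k) + z - c (m', k)) / g (c (m, k) + z)))
        (by fun_prop) (ε := ENNReal.ofReal θ) (by simp [hθ]) ENNReal.ofReal_ne_top
      rw [div_eq_mul_inv, mul_comm] at hmk
      refine le_trans (measure_mono fun z hz => ?_) hmk
      exact ENNReal.ofReal_le_ofReal hz
    have hsum : ENNReal.ofReal (C.avgError p) ≤ Er c := by
      unfold Code.avgError
      have hNpos := C.numMsg_mul_numKey_pos
      rw [ENNReal.ofReal_mul (inv_nonneg.2 hNpos.le), ENNReal.ofReal_inv_of_pos hNpos,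
        ENNReal.ofReal_mul (by positivity), ENNReal.ofReal_natCast, ENNReal.ofReal_natCast,
        ENNReal.ofReal_sum_of_nonneg fun m _ => Finset.sum_nonneg fun k _ => measureReal_nonneg]
      refine mul_le_mul_right (Finset.sum_le_sum fun m _ => ?_) _
      rw [ENNReal.ofReal_sum_of_nonneg fun k _ => measureReal_nonneg]
      refine Finset.sum_le_sum fun k _ => ?_
      rw [measureReal_def, ENNReal.ofReal_toReal (measure_ne_top _ _)]
      exact hbound m k
    exact (ENNReal.ofReal_le_ofReal_iff hε.le).1 (hsum.trans hErle)

end RandomCoding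

/-! ### The surprisal and its cumulant generating function. -/

/-- A measurable probability density that is bounded by `b` and whose `ζ`-th power is
integrable. -/
structure RegularDensity (p : ℝ → ℝ) (b ζ : ℝ) : Prop where
  measurable : Measurable p
  nonneg : ∀ z, 0 ≤ p z
  integrable : Integrable p
  integral_eq_one : ∫ z, p z = 1
  one_le : 1 ≤ b
  le_bound : ∀ z, p z ≤ b
  pos : 0 < ζ
  lt_one : ζ < 1
  integrable_rpow : Integrable fun z => p z ^ ζ

/-- The surprisal `-ln p`. -/
def surprisal (p : ℝ → ℝ) (z : ℝ) : ℝ := -Real.log (p z)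

namespace RegularDensity

variable {p : ℝ → ℝ} {b ζ : ℝ}

lemma isProbabilityMeasure_noiseLaw (h : RegularDensity p b ζ) :
    IsProbabilityMeasure (noiseLaw p) := by
  constructor
  rw [noiseLaw, withDensity_apply _ MeasurableSet.univ, setLIntegral_univ,
    ← ofReal_integral_eq_lintegral_ofReal h.integrable (ae_of_all _ h.nonneg), h.integral_eq_one,
    ENNReal.ofReal_one]

lemma ae_pos (h : RegularDensity p b ζ) : ∀ᵐ z ∂noiseLaw p, 0 < p z := by
  have := h.measurable
  rw [noiseLaw, ae_withDensity_iff (by fun_prop)]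
  exact ae_of_all _ fun z hz => by simpa using hz

lemma measurable_surprisal (h : RegularDensity p b ζ) : Measurable (surprisal p) := by
  have := h.measurable
  unfold surprisal
  fun_prop

lemma integrable_noiseLaw_iff (h : RegularDensity p b ζ) {k : ℝ → ℝ} :
    Integrable k (noiseLaw p) ↔ Integrable fun z => p z * k z := by
  have hm := h.measurable
  rw [noiseLaw, integrable_withDensity_iff_integrable_smul' (by fun_prop) (by simp)]
  simp [ENNReal.toReal_ofReal (h.nonneg _)]

lemma integral_noiseLaw (h : RegularDensity p b ζ) (k : ℝ → ℝ) :
    ∫ z, k z ∂noiseLaw p = ∫ z, p z * k z := by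
  have hm := h.measurable
  rw [noiseLaw, integral_withDensity_eq_integral_toReal_smul (by fun_prop) (by simp)]
  simp [ENNReal.toReal_ofReal (h.nonneg _)]

/-- Tilting by the surprisal changes the power of p. At p z = 0 the surprisal defaults to 0, and
both sides vanish because 1 - t > 0. -/
lemma mul_exp_surprisal (h : RegularDensity p b ζ) {t : ℝ} (ht : t < 1) (z : ℝ) :
    p z * Real.exp (t * surprisal p z) = p z ^ (1 - t) := by
  rcases (h.nonneg z).eq_or_lt with h0 | h0
  · rw [← h0, zero_mul, Real.zero_rpow (by linarith)]
  · rw [Real.rpow_sub h0, Real.rpow_one, Real.rpow_def_of_pos h0, surprisal, div_eq_mul_inv,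
      ← Real.exp_neg]
    congr 2
    ring

lemma rpow_le_add (h : RegularDensity p b ζ) {a : ℝ} (ha : ζ ≤ a) (ha1 : a ≤ 1) (z : ℝ) :
    p z ^ a ≤ p z ^ ζ + p z := by
  have hz := h.nonneg z
  rcases le_total (p z) 1 with h1 | h1
  · rcases hz.eq_or_lt with h0 | h0
    · have := h.pos
      rw [← h0, Real.zero_rpow (by linarith), Real.zero_rpow (by linarith), add_zero]
    · have := Real.rpow_le_rpow_of_exponent_ge h0 h1 ha
      linarith
  · have h2 := Real.rpow_le_rpow_of_exponent_le h1 ha1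
    rw [Real.rpow_one] at h2
    have := Real.rpow_nonneg hz ζ
    linarith

lemma integrable_rpow_of_mem (h : RegularDensity p b ζ) {a : ℝ} (ha : ζ ≤ a) (ha1 : a ≤ 1) :
    Integrable fun z => p z ^ a := by
  have := h.measurable
  refine (h.integrable_rpow.add h.integrable).mono'
    (this.pow_const a).aestronglyMeasurable (ae_of_all _ fun z => ?_)
  rw [Real.norm_of_nonneg (Real.rpow_nonneg (h.nonneg z) _)]
  exact h.rpow_le_add ha ha1 z

lemma integral_rpow_le (h : RegularDensity p b ζ) {a : ℝ} (ha : ζ ≤ a) (ha1 : a ≤ 1) :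
    ∫ z, p z ^ a ≤ (∫ z, p z ^ ζ) + 1 := by
  rw [← h.integral_eq_one, ← integral_add h.integrable_rpow h.integrable]
  exact integral_mono (h.integrable_rpow_of_mem ha ha1) (h.integrable_rpow.add h.integrable)
    (h.rpow_le_add ha ha1)

/-- For t ≥ 0 the power p ^ (1 - t) lies between p ^ ζ and p; for t < 0 boundedness of p suffices.
Hence 0 is interior to the domain of the moment generating function, which yields all moments and
analyticity. -/
lemma integrable_exp_surprisal (h : RegularDensity p b ζ) {t : ℝ} (ht : t ≤ 1 - ζ) :
    Integrable (fun z => Real.exp (t * surprisal p z)) (noiseLaw p) := by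
  have hζ := h.pos
  rw [h.integrable_noiseLaw_iff]
  simp_rw [h.mul_exp_surprisal (show t < 1 by linarith)]
  rcases le_total 0 t with h0 | h0
  · exact h.integrable_rpow_of_mem (by linarith) (by linarith)
  · have hm := h.measurable
    refine (h.integrable.mul_const (b ^ (-t))).mono'
      (hm.pow_const _).aestronglyMeasurable (ae_of_all _ fun z => ?_)
    have hz := h.nonneg z
    rw [Real.norm_of_nonneg (Real.rpow_nonneg hz _), sub_eq_add_neg,
      Real.rpow_add_of_nonneg hz zero_le_one (by linarith), Real.rpow_one]
    exact mul_le_mul_of_nonneg_left (Real.rpow_le_rpow hz (h.le_bound z) (by linarith)) hz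

lemma mem_interior_integrableExpSet (h : RegularDensity p b ζ) {t : ℝ} (ht : t < 1 - ζ) :
    t ∈ interior (integrableExpSet (surprisal p) (noiseLaw p)) := by
  rw [mem_interior]
  exact ⟨Set.Iio (1 - ζ), fun x hx => h.integrable_exp_surprisal (le_of_lt hx), isOpen_Iio, ht⟩

lemma mgf_surprisal (h : RegularDensity p b ζ) {t : ℝ} (ht : t < 1) :
    mgf (surprisal p) (noiseLaw p) t = ∫ z, p z ^ (1 - t) := by
  unfold mgf
  rw [h.integral_noiseLaw]
  simp_rw [h.mul_exp_surprisal ht]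

lemma mgf_surprisal_pos (h : RegularDensity p b ζ) {t : ℝ} (ht : t ≤ 1 - ζ) :
    0 < mgf (surprisal p) (noiseLaw p) t := by
  have := h.isProbabilityMeasure_noiseLaw
  exact mgf_pos (h.integrable_exp_surprisal ht)

lemma exp_cgf_surprisal (h : RegularDensity p b ζ) {t : ℝ} (ht : t ≤ 1 - ζ) :
    Real.exp (cgf (surprisal p) (noiseLaw p) t) = mgf (surprisal p) (noiseLaw p) t := by
  have := h.isProbabilityMeasure_noiseLaw
  exact exp_cgf (h.integrable_exp_surprisal ht)

lemma zero_mem_interior (h : RegularDensity p b ζ) :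
    0 ∈ interior (integrableExpSet (surprisal p) (noiseLaw p)) :=
  h.mem_interior_integrableExpSet (by have := h.lt_one; linarith)

lemma integrable_surprisal (h : RegularDensity p b ζ) : Integrable (surprisal p) (noiseLaw p) :=
  integrable_of_mem_interior_integrableExpSet h.zero_mem_interior

lemma deriv_cgf_zero_eq (h : RegularDensity p b ζ) :
    deriv (cgf (surprisal p) (noiseLaw p)) 0 = ∫ z, surprisal p z ∂noiseLaw p := by
  have := h.isProbabilityMeasure_noiseLaw
  rw [deriv_cgf_zero h.zero_mem_interior]
  simp

lemma hasDerivAt_deriv_cgf_zero (h : RegularDensity p b ζ) :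
    HasDerivAt (deriv (cgf (surprisal p) (noiseLaw p)))
      (variance (fun z => Real.log (p z)) (noiseLaw p)) 0 := by
  have := h.isProbabilityMeasure_noiseLaw
  have han := (analyticAt_cgf h.zero_mem_interior).deriv
  have hd := han.differentiableAt.hasDerivAt
  suffices heq : variance (fun z => Real.log (p z)) (noiseLaw p) =
      deriv (deriv (cgf (surprisal p) (noiseLaw p))) 0 by
    rw [heq]
    exact hd
  have h2 := iteratedDeriv_two_cgf_eq_integral h.zero_mem_interior
  rw [iteratedDeriv_succ, iteratedDeriv_one] at h2
  rw [h2, h.deriv_cgf_zero_eq]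
  have hm := h.measurable_surprisal
  have hv : variance (fun z => Real.log (p z)) (noiseLaw p) =
      variance (surprisal p) (noiseLaw p) := by
    rw [← variance_fun_neg]
    rfl
  rw [hv, variance_eq_integral hm.aemeasurable]
  simp

lemma tendsto_deriv_cgf (h : RegularDensity p b ζ) :
    Tendsto (fun γ => (deriv (cgf (surprisal p) (noiseLaw p)) γ -
      ∫ z, surprisal p z ∂noiseLaw p) / γ) (𝓝[>] 0)
      (𝓝 (variance (fun z => Real.log (p z)) (noiseLaw p))) := by
  have hd := h.hasDerivAt_deriv_cgf_zero.tendsto_slope_zero_right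
  rw [h.deriv_cgf_zero_eq] at hd
  refine hd.congr fun γ => ?_
  rw [zero_add, smul_eq_mul]
  field_simp

lemma tendsto_cgf (h : RegularDensity p b ζ) :
    Tendsto (fun γ => (cgf (surprisal p) (noiseLaw p) γ -
      γ * ∫ z, surprisal p z ∂noiseLaw p) / γ ^ 2) (𝓝[>] 0)
      (𝓝 (variance (fun z => Real.log (p z)) (noiseLaw p) / 2)) := by
  have := h.isProbabilityMeasure_noiseLaw
  set m := ∫ z, surprisal p z ∂noiseLaw p with hm
  set φ := cgf (surprisal p) (noiseLaw p) with hφ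
  have hζ : 0 < 1 - ζ := by have := h.lt_one; linarith
  have hdiff : ∀ γ < 1 - ζ, HasDerivAt φ (deriv φ γ) γ := fun γ hγ =>
    (analyticAt_cgf (h.mem_interior_integrableExpSet hγ)).differentiableAt.hasDerivAt
  have hev : ∀ᶠ γ in 𝓝[>] (0 : ℝ), γ < 1 - ζ := by
    filter_upwards [Ioo_mem_nhdsGT hζ] with γ hγ using hγ.2
  -- L'Hôpital's rule reduces the second-order expansion to the slope of φ' at 0, which is the
  -- variance.
  refine HasDerivAt.lhopital_zero_nhdsGT (f' := fun γ => deriv φ γ - m) (g' := fun γ => 2 * γ)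
    ?_ ?_ ?_ ?_ ?_ ?_
  · filter_upwards [hev] with γ hγ
    have := (hdiff γ hγ).fun_sub ((hasDerivAt_id' γ).mul_const m)
    rw [one_mul] at this
    exact this
  · filter_upwards with γ
    have := hasDerivAt_pow 2 γ
    simpa using this
  · filter_upwards [self_mem_nhdsWithin] with γ hγ
    have : (0 : ℝ) < γ := hγ
    positivity
  · have hc : ContinuousAt (fun γ => φ γ - γ * m) 0 :=
      (hdiff 0 hζ).continuousAt.sub (by fun_prop)
    have h0 : φ 0 = 0 := by simp [hφ]
    have := hc.tendsto.mono_left (nhdsWithin_le_nhds (s := Set.Ioi 0))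
    simpa [h0] using this
  · have hc : Continuous fun γ : ℝ => γ ^ 2 := by fun_prop
    have := (hc.tendsto 0).mono_left (nhdsWithin_le_nhds (s := Set.Ioi 0))
    simpa using this
  · have := h.tendsto_deriv_cgf.div_const 2
    refine this.congr fun γ => ?_
    rw [div_div, mul_comm γ 2]

lemma tendsto_mgf (h : RegularDensity p b ζ) :
    Tendsto (mgf (surprisal p) (noiseLaw p)) (𝓝[>] 0) (𝓝 1) := by
  have := h.isProbabilityMeasure_noiseLaw
  have hc := (differentiableAt_mgf h.zero_mem_interior).continuousAt.tendsto
  rw [mgf_zero] at hc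
  exact hc.mono_left nhdsWithin_le_nhds

lemma tendsto_cgf_zero (h : RegularDensity p b ζ) :
    Tendsto (cgf (surprisal p) (noiseLaw p)) (𝓝[>] 0) (𝓝 0) := by
  have := h.isProbabilityMeasure_noiseLaw
  have hc := (analyticAt_cgf h.zero_mem_interior).continuousAt.tendsto
  rw [cgf_zero] at hc
  exact hc.mono_left nhdsWithin_le_nhds

lemma tendsto_deriv_cgf_zero (h : RegularDensity p b ζ) :
    Tendsto (deriv (cgf (surprisal p) (noiseLaw p))) (𝓝[>] 0)
    (𝓝 (∫ z, surprisal p z ∂noiseLaw p)) := by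
  have hc := h.hasDerivAt_deriv_cgf_zero.continuousAt.tendsto
  rw [h.deriv_cgf_zero_eq] at hc
  exact hc.mono_left nhdsWithin_le_nhds

end RegularDensity

/-- The function i - 1 + e ^ (-i) is nonnegative, quadratic near 0 and at least linear far out, so
it dominates i² / (4 T) for |i| ≤ T; beyond T the fourth power takes over. For the information
density its mean is at most the mutual information. -/
lemma sq_le_mul_add_pow_four_div {T : ℝ} (hT : 1 ≤ T) (i : ℝ) :
    i ^ 2 ≤ 4 * T * (i - 1 + Real.exp (-i)) + i ^ 4 / T ^ 2 := by
  have hpos : 0 ≤ i - 1 + Real.exp (-i) := by have := Real.add_one_le_exp (-i); linarith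
  have hT0 : 0 < T := by linarith
  by_cases hi : |i| ≤ T
  · have h4 : 0 ≤ i ^ 4 / T ^ 2 := by positivity
    have key : i ^ 2 ≤ 4 * T * (i - 1 + Real.exp (-i)) := by
      rcases le_total i 0 with h0 | h0
      · have h1 := Real.quadratic_le_exp_of_nonneg (x := -i) (by linarith)
        have h2 : i ^ 2 / 2 ≤ i - 1 + Real.exp (-i) := by nlinarith
        nlinarith
      · rcases le_total i 2 with h2 | h2
        · have h3 : (1 - i / 2) ^ 2 ≤ Real.exp (-i) := by
            have h5 : 1 - i / 2 ≤ Real.exp (-(i / 2)) := by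
              have := Real.add_one_le_exp (-(i / 2)); linarith
            have h6 : Real.exp (-i) = Real.exp (-(i / 2)) ^ 2 := by
              rw [← Real.exp_nat_mul]; congr 1; push_cast; ring
            rw [h6]
            exact pow_le_pow_left₀ (by linarith) h5 2
          nlinarith
        · have h3 : i / 2 ≤ i - 1 + Real.exp (-i) := by
            have := Real.exp_pos (-i); linarith
          have h5 : i ≤ T := (le_abs_self i).trans hi
          nlinarith
    linarith
  · have hi' : T ^ 2 ≤ i ^ 2 := by
      rw [← sq_abs i]
      exact pow_le_pow_left₀ hT0.le (not_le.1 hi).le 2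
    have h1 : i ^ 2 ≤ i ^ 4 / T ^ 2 := by
      rw [le_div_iff₀ (by positivity)]
      nlinarith [sq_nonneg i]
    have : 0 ≤ 4 * T * (i - 1 + Real.exp (-i)) := by positivity
    linarith

lemma add_add_pow_four_le (a b c : ℝ) : (a + b + c) ^ 4 ≤ 27 * (a ^ 4 + b ^ 4 + c ^ 4) := by
  have h1 : (a + b + c) ^ 2 ≤ 3 * (a ^ 2 + b ^ 2 + c ^ 2) := by
    nlinarith [sq_nonneg (a - b), sq_nonneg (b - c), sq_nonneg (a - c)]
  have h2 : ((a + b + c) ^ 2) ^ 2 ≤ (3 * (a ^ 2 + b ^ 2 + c ^ 2)) ^ 2 :=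
    pow_le_pow_left₀ (sq_nonneg _) h1 2
  nlinarith [sq_nonneg (a ^ 2 - b ^ 2), sq_nonneg (b ^ 2 - c ^ 2), sq_nonneg (a ^ 2 - c ^ 2)]

/-! ### The tilted law and the moments of the information density. -/

namespace RegularDensity

variable {p : ℝ → ℝ} {b ζ γ : ℝ}

lemma tiltedDensity_eq (h : RegularDensity p b ζ) (hγ : γ < 1 - ζ) (z : ℝ) :
    tiltedDensity p γ z = (mgf (surprisal p) (noiseLaw p) γ)⁻¹ * p z ^ (1 - γ) := by
  rw [tiltedDensity, h.mgf_surprisal (by have := h.pos; linarith)]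

lemma measurable_tiltedDensity (h : RegularDensity p b ζ) : Measurable (tiltedDensity p γ) :=
  (h.measurable.pow_const _).const_mul _

lemma tiltedDensity_nonneg (h : RegularDensity p b ζ) (z : ℝ) : 0 ≤ tiltedDensity p γ z :=
  mul_nonneg (inv_nonneg.2 (integral_nonneg fun t => Real.rpow_nonneg (h.nonneg t) _))
    (Real.rpow_nonneg (h.nonneg z) _)

lemma tiltedDensity_pos (h : RegularDensity p b ζ) (hγ : γ < 1 - ζ) {z : ℝ} (hz : 0 < p z) :
    0 < tiltedDensity p γ z := by
  rw [h.tiltedDensity_eq hγ]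
  have := h.mgf_surprisal_pos hγ.le
  positivity

lemma eq_zero_iff_tiltedDensity (h : RegularDensity p b ζ) (hγ : γ < 1 - ζ) (z : ℝ) :
    p z = 0 ↔ tiltedDensity p γ z = 0 := by
  have hζ := h.pos
  constructor
  · intro hz
    rw [h.tiltedDensity_eq hγ, hz, Real.zero_rpow (by linarith), mul_zero]
  · intro hz
    by_contra hne
    exact (h.tiltedDensity_pos hγ (lt_of_le_of_ne (h.nonneg z) (Ne.symm hne))).ne' hz

lemma integrable_tiltedDensity (h : RegularDensity p b ζ) (hγ0 : 0 ≤ γ) (hγ : γ < 1 - ζ) :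
    Integrable (tiltedDensity p γ) :=
  (h.integrable_rpow_of_mem (by linarith) (by linarith)).const_mul _

lemma isProbabilityMeasure_tilted (h : RegularDensity p b ζ) (hγ0 : 0 ≤ γ) (hγ : γ < 1 - ζ) :
    IsProbabilityMeasure (noiseLaw (tiltedDensity p γ)) := by
  have hζ := h.pos
  constructor
  rw [noiseLaw, withDensity_apply _ MeasurableSet.univ, setLIntegral_univ,
    ← ofReal_integral_eq_lintegral_ofReal (h.integrable_tiltedDensity hγ0 hγ)
      (ae_of_all _ h.tiltedDensity_nonneg)]
  unfold tiltedDensity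
  rw [integral_const_mul, inv_mul_cancel₀, ENNReal.ofReal_one]
  rw [← h.mgf_surprisal (by linarith)]
  exact (h.mgf_surprisal_pos hγ.le).ne'

/-- The tilted density is an exponential change of measure whose normalizer is the moment generating
function, so its surprisal moments can be read off from the latter. -/
lemma tilted_eq_withDensity (h : RegularDensity p b ζ) (hγ : γ < 1 - ζ) :
    noiseLaw (tiltedDensity p γ) = (noiseLaw p).withDensity fun z =>
      ENNReal.ofReal ((mgf (surprisal p) (noiseLaw p) γ)⁻¹ *
        Real.exp (γ * surprisal p z)) := by
  have hm := h.measurable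
  have hζ := h.pos
  have hu := h.measurable_surprisal
  have hm2 : Measurable fun z => ENNReal.ofReal ((mgf (surprisal p) (noiseLaw p) γ)⁻¹ *
        Real.exp (γ * surprisal p z)) := by fun_prop
  unfold noiseLaw at hm2 ⊢
  rw [← withDensity_mul _ (by fun_prop) hm2]
  congr 1
  ext z
  simp only [Pi.mul_apply]
  rw [← ENNReal.ofReal_mul (h.nonneg z), mul_left_comm, h.mul_exp_surprisal (by linarith),
    h.tiltedDensity_eq hγ]
  rfl

lemma integrable_tilted_iff (h : RegularDensity p b ζ) (hγ : γ < 1 - ζ) {k : ℝ → ℝ} :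
    Integrable k (noiseLaw (tiltedDensity p γ)) ↔
      Integrable (fun z => k z * Real.exp (γ * surprisal p z)) (noiseLaw p) := by
  have hu := h.measurable_surprisal
  have hpos := h.mgf_surprisal_pos hγ.le
  rw [h.tilted_eq_withDensity hγ, integrable_withDensity_iff_integrable_smul' (by fun_prop)
    (by simp)]
  have h1 : ∀ z, (ENNReal.ofReal ((mgf (surprisal p) (noiseLaw p) γ)⁻¹ *
        Real.exp (γ * surprisal p z))).toReal • k z = (mgf (surprisal p) (noiseLaw p) γ)⁻¹ *
        (k z * Real.exp (γ * surprisal p z)) := fun z => by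
    rw [ENNReal.toReal_ofReal (by positivity), smul_eq_mul]; ring
  simp_rw [h1]
  rw [integrable_const_mul_iff (IsUnit.mk0 _ (inv_ne_zero hpos.ne'))]

lemma integral_tilted (h : RegularDensity p b ζ) (hγ : γ < 1 - ζ) (k : ℝ → ℝ) :
    ∫ z, k z ∂noiseLaw (tiltedDensity p γ) =
      (∫ z, k z * Real.exp (γ * surprisal p z) ∂noiseLaw p) /
        mgf (surprisal p) (noiseLaw p) γ := by
  have hu := h.measurable_surprisal
  have hpos := h.mgf_surprisal_pos hγ.le
  rw [h.tilted_eq_withDensity hγ, integral_withDensity_eq_integral_toReal_smul (by fun_prop)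
    (by simp)]
  have h1 : ∀ z, (ENNReal.ofReal ((mgf (surprisal p) (noiseLaw p) γ)⁻¹ *
        Real.exp (γ * surprisal p z))).toReal • k z = (mgf (surprisal p) (noiseLaw p) γ)⁻¹ *
        (k z * Real.exp (γ * surprisal p z)) := fun z => by
    rw [ENNReal.toReal_ofReal (by positivity), smul_eq_mul]; ring
  simp_rw [h1]
  rw [integral_const_mul, div_eq_inv_mul]

lemma integrable_surprisal_pow_tilted (h : RegularDensity p b ζ) (hγ : γ < 1 - ζ) (j : ℕ) :
    Integrable (fun z => surprisal p z ^ j) (noiseLaw (tiltedDensity p γ)) := by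
  rw [h.integrable_tilted_iff hγ]
  exact integrable_pow_mul_exp_of_mem_interior_integrableExpSet
    (h.mem_interior_integrableExpSet hγ) j

lemma integrable_surprisal_tilted (h : RegularDensity p b ζ) (hγ : γ < 1 - ζ) :
    Integrable (surprisal p) (noiseLaw (tiltedDensity p γ)) := by
  simpa using h.integrable_surprisal_pow_tilted hγ 1

lemma integral_surprisal_tilted (h : RegularDensity p b ζ) (hγ : γ < 1 - ζ) :
    ∫ z, surprisal p z ∂noiseLaw (tiltedDensity p γ) =
      deriv (cgf (surprisal p) (noiseLaw p)) γ := by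
  rw [h.integral_tilted hγ, deriv_cgf (h.mem_interior_integrableExpSet hγ)]

lemma tendsto_integral_surprisal_pow_tilted (h : RegularDensity p b ζ) (j : ℕ) :
    Tendsto (fun γ => ∫ z, surprisal p z ^ j ∂noiseLaw (tiltedDensity p γ)) (𝓝[>] 0)
      (𝓝 (∫ z, surprisal p z ^ j ∂noiseLaw p)) := by
  have hζ : 0 < 1 - ζ := by have := h.lt_one; linarith
  have h1 := (hasDerivAt_integral_pow_mul_exp_real h.zero_mem_interior j).continuousAt.tendsto
  have h2 := (h1.mono_left (nhdsWithin_le_nhds (s := Set.Ioi 0))).div h.tendsto_mgf one_ne_zero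
  simp only [zero_mul, Real.exp_zero, mul_one, div_one] at h2
  refine h2.congr' ?_
  filter_upwards [Ioo_mem_nhdsGT hζ] with γ hγ
  exact (h.integral_tilted hγ.2 _).symm

lemma log_tiltedDensity (h : RegularDensity p b ζ) (hγ : γ < 1 - ζ) {z : ℝ} (hz : 0 < p z) :
    Real.log (tiltedDensity p γ z) =
      -(1 - γ) * surprisal p z - cgf (surprisal p) (noiseLaw p) γ := by
  have hpos := h.mgf_surprisal_pos hγ.le
  rw [h.tiltedDensity_eq hγ, Real.log_mul (inv_ne_zero hpos.ne')
    (Real.rpow_pos_of_pos hz _).ne', Real.log_inv, Real.log_rpow hz, cgf, surprisal]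
  ring

lemma log_tiltedDensity_div (h : RegularDensity p b ζ) (hγ : γ < 1 - ζ) {z : ℝ} (hz : 0 < p z) :
    Real.log (tiltedDensity p γ z / p z) =
      γ * surprisal p z - cgf (surprisal p) (noiseLaw p) γ := by
  rw [Real.log_div (h.tiltedDensity_pos hγ hz).ne' hz.ne', h.log_tiltedDensity hγ hz, surprisal]
  ring

lemma ae_pos_tilted (h : RegularDensity p b ζ) (hγ : γ < 1 - ζ) :
    ∀ᵐ z ∂noiseLaw (tiltedDensity p γ), 0 < p z := by
  rw [h.tilted_eq_withDensity hγ]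
  exact (withDensity_absolutelyContinuous _ _).ae_le h.ae_pos

section InformationDensity

lemma measurePreserving_add {PX : Measure ℝ}
    (hconv : PX.conv (noiseLaw p) = noiseLaw (tiltedDensity p γ)) :
    MeasurePreserving (fun q : ℝ × ℝ => q.1 + q.2) (PX.prod (noiseLaw p))
      (noiseLaw (tiltedDensity p γ)) :=
  ⟨by fun_prop, hconv⟩

variable {PX : Measure ℝ} [IsProbabilityMeasure PX]

lemma ae_log_ratio_eq (h : RegularDensity p b ζ) (hγ : γ < 1 - ζ)
    (hconv : PX.conv (noiseLaw p) = noiseLaw (tiltedDensity p γ)) :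
    ∀ᵐ q ∂PX.prod (noiseLaw p), 0 < p q.2 ∧ 0 < tiltedDensity p γ (q.1 + q.2) ∧
      Real.log (p q.2 / tiltedDensity p γ (q.1 + q.2)) = -surprisal p q.2 +
        (1 - γ) * surprisal p (q.1 + q.2) + cgf (surprisal p) (noiseLaw p) γ := by
  have := h.isProbabilityMeasure_noiseLaw
  filter_upwards [(measurePreserving_add hconv).quasiMeasurePreserving.ae (h.ae_pos_tilted hγ),
    (measurePreserving_snd (μ := PX) (ν := noiseLaw p)).quasiMeasurePreserving.ae h.ae_pos]
    with q h1 h2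
  have h3 := h.tiltedDensity_pos hγ h1
  refine ⟨h2, h3, ?_⟩
  rw [Real.log_div h2.ne' h3.ne', h.log_tiltedDensity hγ h1]
  simp only [surprisal]
  ring

/-- The moments of the information density. -/
lemma log_ratio_moments (h : RegularDensity p b ζ) (hγ0 : 0 ≤ γ) (hγ : γ < 1 - ζ)
    (hconv : PX.conv (noiseLaw p) = noiseLaw (tiltedDensity p γ)) :
    MemLp (fun q : ℝ × ℝ => Real.log (p q.2 / tiltedDensity p γ (q.1 + q.2))) 2
        (PX.prod (noiseLaw p)) ∧
      ∫ q, Real.log (p q.2 / tiltedDensity p γ (q.1 + q.2)) ∂PX.prod (noiseLaw p) =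
        (1 - γ) * deriv (cgf (surprisal p) (noiseLaw p)) γ +
          cgf (surprisal p) (noiseLaw p) γ - ∫ z, surprisal p z ∂noiseLaw p ∧
      ∀ T, 1 ≤ T → ∫ q, Real.log (p q.2 / tiltedDensity p γ (q.1 + q.2)) ^ 2
          ∂PX.prod (noiseLaw p) ≤
        4 * T * ((1 - γ) * deriv (cgf (surprisal p) (noiseLaw p)) γ +
          cgf (surprisal p) (noiseLaw p) γ - ∫ z, surprisal p z ∂noiseLaw p) +
        27 * (∫ z, surprisal p z ^ 4 ∂noiseLaw p +
          ∫ z, surprisal p z ^ 4 ∂noiseLaw (tiltedDensity p γ) +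
          cgf (surprisal p) (noiseLaw p) γ ^ 4) / T ^ 2 := by
  have := h.isProbabilityMeasure_noiseLaw
  have hpm := h.measurable
  have hqm : Measurable (tiltedDensity p γ) := h.measurable_tiltedDensity
  have hum := h.measurable_surprisal
  set φ := cgf (surprisal p) (noiseLaw p) with hφ
  set J := PX.prod (noiseLaw p) with hJ
  set q := tiltedDensity p γ with hq
  set i : ℝ × ℝ → ℝ := fun w => Real.log (p w.2 / q (w.1 + w.2)) with hi
  have him : Measurable i := by fun_prop
  have hae := h.ae_log_ratio_eq hγ hconv
  have hadd := measurePreserving_add hconv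
  have hsnd := measurePreserving_snd (μ := PX) (ν := noiseLaw p)
  have hpow0 : ∀ j : ℕ, Integrable (fun z => surprisal p z ^ j) (noiseLaw p) := fun j => by
    have := integrable_pow_mul_exp_of_mem_interior_integrableExpSet h.zero_mem_interior j
    simpa using this
  have h1 : ∀ j : ℕ, Integrable (fun w : ℝ × ℝ => surprisal p w.2 ^ j) J ∧
      ∫ w, surprisal p w.2 ^ j ∂J = ∫ z, surprisal p z ^ j ∂noiseLaw p := fun j => by
    refine ⟨hsnd.integrable_comp_of_integrable (hpow0 j), ?_⟩
    conv_rhs => rw [← hsnd.map_eq]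
    rw [integral_map hsnd.measurable.aemeasurable
      (Measurable.aestronglyMeasurable (by fun_prop))]
  have h2 : ∀ j : ℕ, Integrable (fun w : ℝ × ℝ => surprisal p (w.1 + w.2) ^ j) J ∧
      ∫ w, surprisal p (w.1 + w.2) ^ j ∂J = ∫ z, surprisal p z ^ j ∂noiseLaw q := fun j => by
    refine ⟨hadd.integrable_comp_of_integrable (h.integrable_surprisal_pow_tilted hγ j), ?_⟩
    conv_rhs => rw [hq, ← hadd.map_eq]
    rw [integral_map hadd.measurable.aemeasurable
      (Measurable.aestronglyMeasurable (by fun_prop))]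
  have h11 := h1 1
  have h21 := h2 1
  simp only [pow_one] at h11 h21
  have hi4 : Integrable (fun w => i w ^ 4) J ∧ ∫ w, i w ^ 4 ∂J ≤
      27 * (∫ z, surprisal p z ^ 4 ∂noiseLaw p + ∫ z, surprisal p z ^ 4 ∂noiseLaw q +
        φ γ ^ 4) := by
    have hle : ∀ᵐ w ∂J, i w ^ 4 ≤ 27 * (surprisal p w.2 ^ 4 +
        surprisal p (w.1 + w.2) ^ 4 + φ γ ^ 4) := by
      filter_upwards [hae] with w hw
      simp only [hi]
      rw [hw.2.2]
      refine (add_add_pow_four_le _ _ _).trans ?_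
      have h3 : ((1 - γ) * surprisal p (w.1 + w.2)) ^ 4 ≤ surprisal p (w.1 + w.2) ^ 4 := by
        rw [mul_pow]
        have h4 : (1 - γ) ^ 4 ≤ 1 := pow_le_one₀ (by have := h.pos; linarith) (by linarith)
        have h5 : 0 ≤ surprisal p (w.1 + w.2) ^ 4 := by positivity
        nlinarith
      have h6 : (-surprisal p w.2) ^ 4 = surprisal p w.2 ^ 4 := by ring
      rw [h6]
      linarith
    have hbi12 : Integrable (fun w : ℝ × ℝ => surprisal p w.2 ^ 4 +
        surprisal p (w.1 + w.2) ^ 4) J := (h1 4).1.add (h2 4).1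
    have hbi : Integrable (fun w : ℝ × ℝ => 27 * (surprisal p w.2 ^ 4 +
        surprisal p (w.1 + w.2) ^ 4 + φ γ ^ 4)) J :=
      (hbi12.add (integrable_const _)).const_mul _
    have hii : Integrable (fun w => i w ^ 4) J := by
      refine hbi.mono' (Measurable.aestronglyMeasurable (by fun_prop)) ?_
      filter_upwards [hle] with w hw
      rwa [Real.norm_of_nonneg (by positivity)]
    refine ⟨hii, (integral_mono_ae hii hbi hle).trans (le_of_eq ?_)⟩
    rw [integral_const_mul, integral_add hbi12 (integrable_const _),
      integral_add (h1 4).1 (h2 4).1, (h1 4).2, (h2 4).2]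
    simp
  have hmem4 : MemLp i 4 J := by
    have h3 := (integrable_norm_rpow_iff (f := i) (p := 4) him.aestronglyMeasurable
      (by norm_num) (by norm_num) (μ := J)).1
    refine h3 ?_
    have h4 : ∀ w, ‖i w‖ ^ (4 : ℝ≥0∞).toReal = i w ^ 4 := fun w => by
      have : (4 : ℝ≥0∞).toReal = ((4 : ℕ) : ℝ) := by norm_num
      rw [this, Real.rpow_natCast, Real.norm_eq_abs, ← abs_pow,
        abs_of_nonneg (by positivity)]
    simp_rw [h4]
    exact hi4.1
  have hmem2 : MemLp i 2 J := hmem4.mono_exponent (by norm_num)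
  have hii : Integrable i J := hmem2.integrable (by norm_num)
  -- This is the entropy of the output minus that of the noise; the mean surprisal of the output is
  -- φ'(γ).
  have hmean : ∫ w, i w ∂J = (1 - γ) * deriv φ γ + φ γ - ∫ z, surprisal p z ∂noiseLaw p := by
    have e1 : Integrable (fun w : ℝ × ℝ => -surprisal p w.2) J := h11.1.neg
    have e2 : Integrable (fun w : ℝ × ℝ => (1 - γ) * surprisal p (w.1 + w.2)) J :=
      h21.1.const_mul _
    have e3 : Integrable (fun w : ℝ × ℝ => -surprisal p w.2 +
        (1 - γ) * surprisal p (w.1 + w.2)) J := e1.add e2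
    rw [integral_congr_ae (hae.mono fun w hw => hw.2.2),
      integral_add e3 (integrable_const _), integral_add e1 e2, integral_neg,
      integral_const_mul, h11.2, h21.2, h.integral_surprisal_tilted hγ]
    simp
    ring
  -- Here e ^ (-i) = q(x + z) / p(z). For each x its mean over the noise is at most the total mass
  -- of a translate of q.
  have hexpl : ∫⁻ w, ENNReal.ofReal (Real.exp (-i w)) ∂J ≤ 1 := by
    have e1 : ∫⁻ w, ENNReal.ofReal (Real.exp (-i w)) ∂J =
        ∫⁻ w, ENNReal.ofReal (q (w.1 + w.2) / p w.2) ∂J := by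
      refine lintegral_congr_ae (hae.mono fun w hw => ?_)
      simp only [hi]
      rw [Real.exp_neg, Real.exp_log (div_pos hw.1 hw.2.1), inv_div]
    have hqprob := h.isProbabilityMeasure_tilted hγ0 hγ
    have e2 : ∫⁻ y, ENNReal.ofReal (q y) = 1 := by
      rw [← setLIntegral_univ, ← withDensity_apply _ MeasurableSet.univ]
      exact hqprob.measure_univ
    rw [e1, hJ, lintegral_prod _ (by fun_prop)]
    have e3 : ∀ x, ∫⁻ z, ENNReal.ofReal (q (x + z) / p z) ∂noiseLaw p ≤ 1 := by
      intro x
      rw [← e2, ← lintegral_add_left_eq_self (fun y => ENNReal.ofReal (q y)) x, noiseLaw,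
        lintegral_withDensity_eq_lintegral_mul _ (by fun_prop) (by fun_prop)]
      refine lintegral_mono fun z => ?_
      simp only [Pi.mul_apply]
      rw [← ENNReal.ofReal_mul (h.nonneg z)]
      refine ENNReal.ofReal_le_ofReal ?_
      rcases (h.nonneg z).eq_or_lt with h0 | h0
      · rw [← h0, zero_mul]
        exact h.tiltedDensity_nonneg _
      · rw [mul_div_cancel₀ _ h0.ne']
    refine (lintegral_mono e3).trans ?_
    simp
  have hexpi : Integrable (fun w => Real.exp (-i w)) J := by
    rw [← lintegral_ofReal_ne_top_iff_integrable
      (Measurable.aestronglyMeasurable (by fun_prop)) (ae_of_all _ fun y => Real.exp_nonneg _)]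
    exact ne_top_of_le_ne_top ENNReal.one_ne_top hexpl
  have hexp1 : ∫ w, Real.exp (-i w) ∂J ≤ 1 := by
    rw [integral_eq_lintegral_of_nonneg_ae (ae_of_all _ fun y => Real.exp_nonneg _)
      (Measurable.aestronglyMeasurable (by fun_prop))]
    exact ENNReal.toReal_mono ENNReal.one_ne_top hexpl
  refine ⟨hmem2, hmean, fun T hT => ?_⟩
  have hT0 : 0 < T := by linarith
  have e1 : Integrable (fun w => i w - 1) J := hii.sub (integrable_const 1)
  have e2 : Integrable (fun w => i w - 1 + Real.exp (-i w)) J := e1.add hexpi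
  have e3 : Integrable (fun w => 4 * T * (i w - 1 + Real.exp (-i w))) J := e2.const_mul _
  have e4 : Integrable (fun w => i w ^ 4 / T ^ 2) J := hi4.1.div_const _
  have hmono := integral_mono hmem2.integrable_sq (e3.add e4)
    fun w => sq_le_mul_add_pow_four_div hT (i w)
  have hsum : ∫ w, ((fun w => 4 * T * (i w - 1 + Real.exp (-i w))) + fun w => i w ^ 4 / T ^ 2) w
      ∂J = 4 * T * (∫ w, i w ∂J - 1 + ∫ w, Real.exp (-i w) ∂J) + (∫ w, i w ^ 4 ∂J) / T ^ 2 := by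
    rw [integral_add' e3 e4, integral_const_mul, integral_add e1 hexpi,
      integral_sub hii (integrable_const 1), integral_div]
    simp
  rw [hsum] at hmono
  refine hmono.trans (add_le_add ?_ ?_)
  · rw [← hmean]
    refine mul_le_mul_of_nonneg_left (by linarith) (by positivity)
  · exact div_le_div_of_nonneg_right hi4.2 (by positivity)

end InformationDensity

end RegularDensity

/-! ### Bounds for codes of length n. -/

lemma ae_pi_forall {ι Ω : Type*} [Fintype ι] [MeasurableSpace Ω] {P : Measure Ω}
    [IsProbabilityMeasure P] {q : Ω → Prop} (hq : ∀ᵐ z ∂P, q z) :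
    ∀ᵐ y ∂Measure.pi fun _ : ι => P, ∀ i, q (y i) :=
  ae_all_iff.2 fun i => (measurePreserving_eval (fun _ : ι => P) i).quasiMeasurePreserving.ae hq

lemma integrable_and_integral_pi_sum {ι Ω : Type*} [Fintype ι] [MeasurableSpace Ω]
    {P : Measure Ω} [IsProbabilityMeasure P] {k : Ω → ℝ} (hk : Measurable k)
    (hki : Integrable k P) :
    Integrable (fun y : ι → Ω => ∑ i, k (y i)) (Measure.pi fun _ : ι => P) ∧
      ∫ y : ι → Ω, ∑ i, k (y i) ∂(Measure.pi fun _ : ι => P) =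
        Fintype.card ι * ∫ z, k z ∂P := by
  have hi : ∀ i : ι, Integrable (fun y : ι → Ω => k (y i)) (Measure.pi fun _ : ι => P) :=
    fun i => (measurePreserving_eval (fun _ : ι => P) i).integrable_comp_of_integrable hki
  refine ⟨integrable_finsetSum _ fun i _ => hi i, ?_⟩
  rw [integral_finsetSum _ fun i _ => hi i]
  have h1 : ∀ i : ι, ∫ y : ι → Ω, k (y i) ∂(Measure.pi fun _ : ι => P) = ∫ z, k z ∂P := by
    intro i
    have hmp := measurePreserving_eval (fun _ : ι => P) i
    conv_rhs => rw [← hmp.map_eq]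
    rw [integral_map hmp.measurable.aemeasurable hk.aestronglyMeasurable]
  simp [h1]

namespace RegularDensity

variable {p : ℝ → ℝ} {b ζ γ : ℝ} {n : ℕ}

lemma isProbabilityMeasure_noiseLawN (h : RegularDensity p b ζ) :
    IsProbabilityMeasure (noiseLawN p n) := by
  have := h.isProbabilityMeasure_noiseLaw
  unfold noiseLawN
  infer_instance

lemma noiseLawN_eq (h : RegularDensity p b ζ) :
    noiseLawN p n = volume.withDensity fun y => ENNReal.ofReal (∏ i, p (y i)) :=
  pi_withDensity_ofReal h.nonneg h.integrable

/-- The converse for codes of length `n`. -/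
lemma log_numMsg_le (h : RegularDensity p b ζ) (hγ0 : 0 < γ) (hγ : γ < 1 - ζ) {Δ : ℝ}
    (hΔ : 0 ≤ Δ) (C : Code n) (hcov : C.IsCovert p Δ) :
    (1 - C.avgError p) * Real.log C.numMsg ≤ Real.log 2 +
      (Δ + n * cgf (surprisal p) (noiseLaw p) γ) / γ - Δ -
        n * ∫ z, surprisal p z ∂noiseLaw p := by
  have := h.isProbabilityMeasure_noiseLaw
  have := h.isProbabilityMeasure_noiseLawN (n := n)
  have hpm := h.measurable
  have hum := h.measurable_surprisal
  have hlog : ∀ᵐ y ∂noiseLawN p n, Real.log (∏ i, p (y i)) = ∑ i, -surprisal p (y i) := by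
    filter_upwards [ae_pi_forall (ι := Fin n) h.ae_pos] with y hy
    rw [Real.log_prod fun i _ => (hy i).ne']
    simp [surprisal]
  obtain ⟨hsi, hsint⟩ := integrable_and_integral_pi_sum (ι := Fin n) (P := noiseLaw p)
    (k := fun z => -surprisal p z) (by fun_prop) h.integrable_surprisal.neg
  have hexp : ∀ᵐ y ∂noiseLawN p n, Real.exp (-γ * Real.log (∏ i, p (y i))) =
      ∏ i, Real.exp (γ * surprisal p (y i)) := by
    filter_upwards [hlog] with y hy
    rw [hy, ← Real.exp_sum, Finset.mul_sum]
    simp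
  have hei : Integrable (fun y : Fin n → ℝ => ∏ i, Real.exp (γ * surprisal p (y i)))
      (noiseLawN p n) :=
    Integrable.fintype_prod (f := fun _ z => Real.exp (γ * surprisal p z))
      (μ := fun _ : Fin n => noiseLaw p) fun _ => h.integrable_exp_surprisal hγ.le
  have heint : ∫ y : Fin n → ℝ, ∏ i, Real.exp (γ * surprisal p (y i)) ∂noiseLawN p n =
      Real.exp (n * cgf (surprisal p) (noiseLaw p) γ) := by
    unfold noiseLawN
    rw [integral_fintype_prod_eq_pow (μ := noiseLaw p) (fun z => Real.exp (γ * surprisal p z)),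
      Real.exp_nat_mul, h.exp_cgf_surprisal hγ.le]
    simp [mgf]
  have hbound : ∀ y : Fin n → ℝ, ∏ i, p (y i) ≤ b ^ n := fun y => by
    refine (Finset.prod_le_prod (fun i _ => h.nonneg _) fun i _ => h.le_bound _).trans ?_
    simp
  have hmain := C.log_numMsg_le (f := fun y => ∏ i, p (y i)) (by fun_prop)
    (fun y => Finset.prod_nonneg fun i _ => h.nonneg _) (one_le_pow₀ h.one_le) hbound
    h.noiseLawN_eq (hsi.congr (hlog.mono fun y hy => hy.symm)) hγ0
    (by have := h.pos; linarith) hΔ (hei.congr (hexp.mono fun y hy => hy.symm))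
    ((integral_congr_ae hexp).trans heint) hcov
  rw [integral_congr_ae hlog] at hmain
  have hsint' : ∫ y : Fin n → ℝ, ∑ i, -surprisal p (y i) ∂noiseLawN p n =
      -(n * ∫ z, surprisal p z ∂noiseLaw p) := by
    unfold noiseLawN
    rw [hsint, integral_neg]
    simp
  rw [hsint'] at hmain
  linarith

/-- An upper bound on the single-letter factor that governs the rate of the key. -/
def keyFactor (p : ℝ → ℝ) (b ζ : ℝ) : ℝ := b ^ ((1 - ζ) / 2) * (2 * ((∫ z, p z ^ ζ) + 1))

lemma one_le_keyFactor (h : RegularDensity p b ζ) : 1 ≤ keyFactor p b ζ := by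
  have h1 : 1 ≤ b ^ ((1 - ζ) / 2) :=
    Real.one_le_rpow h.one_le (by have := h.lt_one; linarith)
  have h2 : 0 ≤ ∫ z, p z ^ ζ := integral_nonneg fun z => Real.rpow_nonneg (h.nonneg z) _
  unfold keyFactor
  nlinarith

/-- The bound is uniform in γ, so that one key rate serves every block length. -/
lemma integral_tiltedDensity_rpow_le (h : RegularDensity p b ζ) (hγ0 : 0 ≤ γ)
    (hγ : γ ≤ (1 - ζ) / 2) (hmgf : 1 / 2 ≤ mgf (surprisal p) (noiseLaw p) γ) :
    Integrable (fun z => b ^ ((1 - ζ) / 2) * tiltedDensity p γ z ^ (1 - (1 - ζ) / 2)) ∧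
    ∫ z, b ^ ((1 - ζ) / 2) * tiltedDensity p γ z ^ (1 - (1 - ζ) / 2) ≤ keyFactor p b ζ := by
  have hζ := h.pos
  have hζ1 := h.lt_one
  set s := (1 - ζ) / 2 with hs
  have hγ' : γ < 1 - ζ := by linarith
  have hpos := h.mgf_surprisal_pos hγ'.le
  set G := mgf (surprisal p) (noiseLaw p) γ with hG
  have heq : ∀ z, tiltedDensity p γ z ^ (1 - s) =
      (G⁻¹) ^ (1 - s) * p z ^ ((1 - γ) * (1 - s)) := fun z => by
    rw [h.tiltedDensity_eq hγ', Real.mul_rpow (inv_nonneg.2 hpos.le)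
      (Real.rpow_nonneg (h.nonneg z) _), ← Real.rpow_mul (h.nonneg z)]
  -- Both factors are at least (1 + ζ) / 2, whose square is at least ζ.
  have ha : ζ ≤ (1 - γ) * (1 - s) := by nlinarith
  have ha1 : (1 - γ) * (1 - s) ≤ 1 := by nlinarith
  simp_rw [heq]
  have hi := h.integrable_rpow_of_mem ha ha1
  refine ⟨(hi.const_mul _).const_mul _, ?_⟩
  rw [integral_const_mul, integral_const_mul]
  have hGinv : G⁻¹ ≤ 2 := by
    rw [inv_le_comm₀ hpos two_pos]; linarith
  have hGr : (G⁻¹) ^ (1 - s) ≤ 2 :=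
    (Real.rpow_le_rpow (inv_nonneg.2 hpos.le) hGinv (by linarith)).trans
      ((Real.rpow_le_rpow_of_exponent_le one_le_two (by linarith : 1 - s ≤ 1)).trans
        (by rw [Real.rpow_one]))
  have hint0 : 0 ≤ ∫ z, p z ^ ((1 - γ) * (1 - s)) :=
    integral_nonneg fun z => Real.rpow_nonneg (h.nonneg z) _
  unfold keyFactor
  refine mul_le_mul_of_nonneg_left ?_ (Real.rpow_nonneg (by linarith [h.one_le]) _)
  exact mul_le_mul hGr (h.integral_rpow_le ha ha1) hint0 zero_le_two

/-- The achievability bound for codes of length `n`. -/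
lemma exists_code_iid (h : RegularDensity p b ζ) (hγ0 : 0 ≤ γ)
    (hγ : γ ≤ (1 - ζ) / 2) (hmgf : 1 / 2 ≤ mgf (surprisal p) (noiseLaw p) γ)
    {PX : Measure ℝ} [IsProbabilityMeasure PX]
    (hconv : PX.conv (noiseLaw p) = noiseLaw (tiltedDensity p γ))
    {M K : ℕ} (hM : 0 < M) (hK : 0 < K) {I v τ Δ η ε : ℝ}
    (hI : (1 - γ) * deriv (cgf (surprisal p) (noiseLaw p)) γ +
      cgf (surprisal p) (noiseLaw p) γ - ∫ z, surprisal p z ∂noiseLaw p = I)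
    (hv : ∫ q, Real.log (p q.2 / tiltedDensity p γ (q.1 + q.2)) ^ 2 ∂PX.prod (noiseLaw p) ≤ v)
    (hτ : τ < n * I) (hΔ : 0 < Δ) (hη : 0 ≤ η) (hη1 : η ≤ 1) (hε : 0 < ε)
    (hcov : n * (γ * deriv (cgf (surprisal p) (noiseLaw p)) γ -
      cgf (surprisal p) (noiseLaw p) γ) +
      ((1 - ζ) / 2 * ((M : ℝ) * K) ^ ((1 - ζ) / 2))⁻¹ * keyFactor p b ζ ^ n ≤ (1 - η) * Δ)
    (herr : n * v / (n * I - τ) ^ 2 + M / Real.exp τ ≤ η * ε) :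
    ∃ C : Code n, C.numMsg = M ∧ C.numKey = K ∧ C.IsCovert p Δ ∧ C.avgError p ≤ ε := by
  have hζ := h.pos
  have hζ1 := h.lt_one
  have hγ' : γ < 1 - ζ := by linarith
  have hP := h.isProbabilityMeasure_noiseLaw
  have hPn := h.isProbabilityMeasure_noiseLawN (n := n)
  have hQ := h.isProbabilityMeasure_tilted hγ0 hγ'
  have hpm := h.measurable
  have hum := h.measurable_surprisal
  set q := tiltedDensity p γ with hq
  have hqm : Measurable q := h.measurable_tiltedDensity
  have hq0 : ∀ z, 0 ≤ q z := h.tiltedDensity_nonneg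
  have hQn : IsProbabilityMeasure (noiseLawN q n) := by unfold noiseLawN; infer_instance
  have hconvN : (Measure.pi fun _ : Fin n => PX).conv (noiseLawN p n) = noiseLawN q n := by
    unfold noiseLawN
    rw [conv_pi, hconv]
  have hρ : noiseLawN q n = volume.withDensity fun y => ENNReal.ofReal (∏ i, q (y i)) :=
    pi_withDensity_ofReal hq0 (h.integrable_tiltedDensity hγ0 hγ')
  have hfg : ∀ y : Fin n → ℝ, ∏ i, p (y i) = 0 ↔ ∏ i, q (y i) = 0 := fun y => by
    simp only [Finset.prod_eq_zero_iff, Finset.mem_univ, true_and, hq,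
      ← h.eq_zero_iff_tiltedDensity hγ']
  have hlog : ∀ᵐ y ∂noiseLawN q n, Real.log ((∏ i, q (y i)) / ∏ i, p (y i)) =
      ∑ i, (γ * surprisal p (y i) - cgf (surprisal p) (noiseLaw p) γ) := by
    filter_upwards [ae_pi_forall (ι := Fin n) (h.ae_pos_tilted hγ')] with y hy
    rw [← Finset.prod_div_distrib, Real.log_prod fun i _ =>
      (div_pos (h.tiltedDensity_pos hγ' (hy i)) (hy i)).ne']
    exact Finset.sum_congr rfl fun i _ => h.log_tiltedDensity_div hγ' (hy i)
  have hsi0 : Integrable (fun z => γ * surprisal p z) (noiseLaw q) :=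
    (h.integrable_surprisal_tilted hγ').const_mul γ
  obtain ⟨hsi, hsint⟩ := integrable_and_integral_pi_sum (ι := Fin n) (P := noiseLaw q)
    (k := fun z => γ * surprisal p z - cgf (surprisal p) (noiseLaw p) γ) (by fun_prop)
    (hsi0.sub (integrable_const _))
  have hsint' : ∫ y, Real.log ((∏ i, q (y i)) / ∏ i, p (y i)) ∂noiseLawN q n =
      n * (γ * deriv (cgf (surprisal p) (noiseLaw p)) γ -
        cgf (surprisal p) (noiseLaw p) γ) := by
    rw [integral_congr_ae hlog]
    unfold noiseLawN
    rw [hsint, integral_sub hsi0 (integrable_const _), integral_const_mul,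
      h.integral_surprisal_tilted hγ']
    simp
  have hT : ∫⁻ w, ENNReal.ofReal (((∏ i, p (w.2 i)) / ∏ i, q ((w.1 + w.2) i)) ^ ((1 - ζ) / 2))
      ∂((Measure.pi fun _ : Fin n => PX).prod (noiseLawN p n)) ≤
      ENNReal.ofReal (keyFactor p b ζ ^ n) := by
    obtain ⟨hti, htle⟩ := h.integral_tiltedDensity_rpow_le hγ0 hγ hmgf
    set s := (1 - ζ) / 2 with hs
    have hs0 : 0 < s := by linarith
    have hb0 : 0 ≤ b := by linarith [h.one_le]
    -- The crude bound p ≤ b leaves a function of the output alone, and the mean of q ^ (-s) under q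
    -- is ∫ q ^ (1 - s). The exponential loss only affects the key, whose length may be of order n.
    have h1 : ∀ w : (Fin n → ℝ) × (Fin n → ℝ), ((∏ i, p (w.2 i)) / ∏ i, q ((w.1 + w.2) i)) ^ s ≤
        ∏ i, (b ^ s * (q ((w.1 + w.2) i) ^ s)⁻¹) := fun w => by
      rw [← Finset.prod_div_distrib, ← Real.finsetProd_rpow _ _ fun i _ =>
        div_nonneg (h.nonneg _) (hq0 _)]
      refine Finset.prod_le_prod (fun i _ => Real.rpow_nonneg (div_nonneg (h.nonneg _) (hq0 _)) _)
        fun i _ => ?_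
      rw [Real.div_rpow (h.nonneg _) (hq0 _), div_eq_mul_inv]
      exact mul_le_mul_of_nonneg_right (Real.rpow_le_rpow (h.nonneg _) (h.le_bound _) hs0.le)
        (inv_nonneg.2 (Real.rpow_nonneg (hq0 _) _))
    refine (lintegral_mono fun w => ENNReal.ofReal_le_ofReal (h1 w)).trans ?_
    have hm : Measurable fun y : Fin n → ℝ =>
        ENNReal.ofReal (∏ i, (b ^ s * (q (y i) ^ s)⁻¹)) := by fun_prop
    have h2 := Measure.lintegral_conv (μ := Measure.pi fun _ : Fin n => PX)
      (ν := noiseLawN p n) hm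
    rw [lintegral_prod _ (by fun_prop), ← h2, hconvN, hρ,
      lintegral_withDensity_eq_lintegral_mul _ (by fun_prop) hm]
    have h3 : ∀ y : Fin n → ℝ, ENNReal.ofReal (∏ i, q (y i)) *
        ENNReal.ofReal (∏ i, (b ^ s * (q (y i) ^ s)⁻¹)) ≤
        ENNReal.ofReal (∏ i, (b ^ s * q (y i) ^ (1 - s))) := fun y => by
      rw [← ENNReal.ofReal_mul (Finset.prod_nonneg fun i _ => hq0 _), ← Finset.prod_mul_distrib]
      refine ENNReal.ofReal_le_ofReal (le_of_eq (Finset.prod_congr rfl fun i _ => ?_))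
      rcases (hq0 (y i)).eq_or_lt with h0 | h0
      · rw [← h0, Real.zero_rpow (by linarith : 1 - s ≠ 0)]
        simp
      · rw [Real.rpow_sub h0, Real.rpow_one]
        field_simp
    refine (lintegral_mono h3).trans ?_
    have hprod0 : ∀ y : Fin n → ℝ, 0 ≤ ∏ i, (b ^ s * q (y i) ^ (1 - s)) := fun y =>
      Finset.prod_nonneg fun i _ => mul_nonneg (Real.rpow_nonneg hb0 _)
        (Real.rpow_nonneg (hq0 _) _)
    have hprodi : Integrable fun y : Fin n → ℝ => ∏ i, (b ^ s * q (y i) ^ (1 - s)) :=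
      Integrable.fintype_prod (f := fun _ z => b ^ s * q z ^ (1 - s)) fun _ => hti
    rw [← ofReal_integral_eq_lintegral_ofReal hprodi (ae_of_all _ hprod0),
      integral_fintype_prod_volume_eq_pow (fun z => b ^ s * q z ^ (1 - s)), Fintype.card_fin]
    refine ENNReal.ofReal_le_ofReal (pow_le_pow_left₀ (integral_nonneg fun z => ?_) htle n)
    exact mul_nonneg (Real.rpow_nonneg hb0 _) (Real.rpow_nonneg (hq0 _) _)
  -- Chebyshev's inequality: the log-likelihood ratio is a sum of n independent terms of mean `I`
  -- and variance at most `v`, and falling to `τ` is a deviation of at least n I - τ.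
  have hcheb : ((Measure.pi fun _ : Fin n => PX).prod (noiseLawN p n))
      {w | (∏ i, p (w.2 i)) / ∏ i, q ((w.1 + w.2) i) ≤ Real.exp τ} ≤
      ENNReal.ofReal (n * v / (n * I - τ) ^ 2) := by
    obtain ⟨hmem, hmean, -⟩ := h.log_ratio_moments hγ0 hγ' hconv
    rw [← hq, hI] at hmean
    set i : ℝ × ℝ → ℝ := fun w => Real.log (p w.2 / q (w.1 + w.2)) with hi
    have him : Measurable i := by fun_prop
    have hset : MeasurableSet {w : (Fin n → ℝ) × (Fin n → ℝ) |
        (∏ i, p (w.2 i)) / ∏ i, q ((w.1 + w.2) i) ≤ Real.exp τ} :=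
      measurableSet_le (by fun_prop) measurable_const
    have hmp := measurePreserving_arrowProdEquivProdArrow ℝ ℝ (Fin n) (fun _ => PX)
      (fun _ => noiseLaw p)
    unfold noiseLawN
    rw [← hmp.measure_preimage hset.nullMeasurableSet]
    have hmean' := (integrable_and_integral_pi_sum (ι := Fin n) him
      (hmem.integrable (by norm_num))).2
    rw [hmean, Fintype.card_fin] at hmean'
    have hvar := variance_sum_pi (μ := fun _ : Fin n => PX.prod (noiseLaw p))
      (X := fun _ : Fin n => i) fun _ => hmem
    have hSmem : MemLp (∑ j : Fin n, fun w : Fin n → ℝ × ℝ => i (w j)) 2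
        (Measure.pi fun _ : Fin n => PX.prod (noiseLaw p)) :=
      memLp_finsetSum' _ fun j _ => hmem.comp_measurePreserving
        (measurePreserving_eval (fun _ : Fin n => PX.prod (noiseLaw p)) j)
    have hch := meas_ge_le_variance_div_sq hSmem (c := n * I - τ) (by linarith)
    have hSmean : ∫ w : Fin n → ℝ × ℝ, (∑ j : Fin n, fun w : Fin n → ℝ × ℝ => i (w j)) w
        ∂(Measure.pi fun _ : Fin n => PX.prod (noiseLaw p)) = n * I := by
      simp only [Finset.sum_apply]
      exact hmean'
    rw [hSmean, hvar] at hch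
    refine le_trans (measure_mono_ae ?_) (hch.trans (ENNReal.ofReal_le_ofReal ?_))
    · filter_upwards [ae_pi_forall (ι := Fin n) (h.ae_log_ratio_eq hγ' hconv)] with w hw hle
      have hle' : (∏ j, p (w j).2) / ∏ j, q ((w j).1 + (w j).2) ≤ Real.exp τ := hle
      rw [← Finset.prod_div_distrib] at hle'
      have hpos : ∀ j, 0 < p (w j).2 / q ((w j).1 + (w j).2) := fun j =>
        div_pos (hw j).1 (hw j).2.1
      have hlog' := Real.log_le_log (Finset.prod_pos fun j _ => hpos j) hle'
      rw [Real.log_exp, Real.log_prod fun j _ => (hpos j).ne'] at hlog'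
      change n * I - τ ≤ |(∑ j : Fin n, fun w : Fin n → ℝ × ℝ => i (w j)) w - n * I|
      rw [Finset.sum_apply, abs_sub_comm]
      refine le_trans ?_ (le_abs_self _)
      simp only [hi]
      linarith
    · refine div_le_div_of_nonneg_right ?_ (sq_nonneg _)
      rw [Finset.sum_const, Finset.card_univ, Fintype.card_fin, nsmul_eq_mul]
      refine mul_le_mul_of_nonneg_left ?_ (Nat.cast_nonneg n)
      exact (variance_le_expectation_sq him.aestronglyMeasurable).trans hv
  refine exists_code (PX := Measure.pi fun _ : Fin n => PX) (ρ := noiseLawN q n)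
    (f := fun y => ∏ i, p (y i)) (g := fun y => ∏ i, q (y i)) hM hK (by fun_prop)
    (fun y => Finset.prod_nonneg fun i _ => h.nonneg _) (by fun_prop)
    (fun y => Finset.prod_nonneg fun i _ => hq0 _) hfg h.noiseLawN_eq hρ hconvN
    (hsi.congr (hlog.mono fun y hy => hy.symm)) (s := (1 - ζ) / 2) (by linarith) (by linarith)
    (pow_nonneg (zero_le_one.trans h.one_le_keyFactor) n) hT (Real.exp_pos τ) ?_ hcheb hΔ hη hη1 hε
    (by rw [hsint']; exact hcov) herr
  have hv0 : 0 ≤ v := (integral_nonneg fun w => sq_nonneg _).trans hv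
  positivity

end RegularDensity

/-! ### Asymptotics with γ of order 1 / √n. -/

lemma tendsto_div_sqrt_nhdsGT {t : ℝ} (ht : 0 < t) :
    Tendsto (fun n : ℕ => t / Real.sqrt n) atTop (𝓝[>] 0) := by
  have h1 : Tendsto (fun n : ℕ => Real.sqrt n) atTop atTop :=
    Real.tendsto_sqrt_atTop.comp tendsto_natCast_atTop_atTop
  refine tendsto_nhdsWithin_iff.2 ⟨h1.const_div_atTop t, ?_⟩
  filter_upwards [eventually_gt_atTop 0] with n hn
  have : (0 : ℝ) < n := by exact_mod_cast hn
  exact div_pos ht (Real.sqrt_pos.2 this)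

namespace RegularDensity

variable {p : ℝ → ℝ} {b ζ : ℝ}

/-- The quotient is (φ'(γ) - m) / γ - φ'(γ) + γ (φ(γ) - γ m) / γ² + m; the first term tends to the
variance and the others cancel in the limit. -/
lemma tendsto_information_div (h : RegularDensity p b ζ) :
    Tendsto (fun γ => ((1 - γ) * deriv (cgf (surprisal p) (noiseLaw p)) γ +
      cgf (surprisal p) (noiseLaw p) γ - ∫ z, surprisal p z ∂noiseLaw p) / γ) (𝓝[>] 0)
      (𝓝 (variance (fun z => Real.log (p z)) (noiseLaw p))) := by
  set m := ∫ z, surprisal p z ∂noiseLaw p with hm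
  have hid : Tendsto (fun γ : ℝ => γ) (𝓝[>] 0) (𝓝 0) :=
    tendsto_id.mono_left nhdsWithin_le_nhds
  have h1 := (h.tendsto_deriv_cgf.sub h.tendsto_deriv_cgf_zero).add
    ((hid.mul h.tendsto_cgf).add_const m)
  rw [← hm, zero_mul, zero_add, sub_add_cancel] at h1
  refine h1.congr' ?_
  filter_upwards [self_mem_nhdsWithin] with γ hγ
  have hγ0 : γ ≠ 0 := (Set.mem_Ioi.1 hγ).ne'
  field_simp
  ring

lemma tendsto_divergence_div (h : RegularDensity p b ζ) :
    Tendsto (fun γ => (γ * deriv (cgf (surprisal p) (noiseLaw p)) γ -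
      cgf (surprisal p) (noiseLaw p) γ) / γ ^ 2) (𝓝[>] 0)
      (𝓝 (variance (fun z => Real.log (p z)) (noiseLaw p) / 2)) := by
  have h1 := h.tendsto_deriv_cgf.sub h.tendsto_cgf
  rw [sub_half] at h1
  refine h1.congr' ?_
  filter_upwards [self_mem_nhdsWithin] with γ hγ
  have hγ0 : γ ≠ 0 := (Set.mem_Ioi.1 hγ).ne'
  field_simp
  ring

/-- The level T is fixed first, making the bounded fourth-moment term small; then γ makes the
information small against 4 T. The bounds do not involve the input law, hence the uniformity in
`PX`. -/
lemma eventually_log_ratio_sq_le (h : RegularDensity p b ζ) {δ : ℝ} (hδ : 0 < δ) :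
    ∀ᶠ γ in 𝓝[>] (0 : ℝ), ∀ PX : Measure ℝ, IsProbabilityMeasure PX →
      PX.conv (noiseLaw p) = noiseLaw (tiltedDensity p γ) →
      ∫ q, Real.log (p q.2 / tiltedDensity p γ (q.1 + q.2)) ^ 2 ∂PX.prod (noiseLaw p) ≤ δ := by
  have hζ : 0 < 1 - ζ := by have := h.lt_one; linarith
  have hid : Tendsto (fun γ : ℝ => γ) (𝓝[>] 0) (𝓝 0) :=
    tendsto_id.mono_left nhdsWithin_le_nhds
  have hI : Tendsto (fun γ => (1 - γ) * deriv (cgf (surprisal p) (noiseLaw p)) γ +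
      cgf (surprisal p) (noiseLaw p) γ - ∫ z, surprisal p z ∂noiseLaw p) (𝓝[>] 0) (𝓝 0) := by
    have h1 := h.tendsto_information_div.mul hid
    rw [mul_zero] at h1
    refine h1.congr' ?_
    filter_upwards [self_mem_nhdsWithin] with γ hγ
    exact div_mul_cancel₀ _ (Set.mem_Ioi.1 hγ).ne'
  have hM := (((h.tendsto_integral_surprisal_pow_tilted 4).const_add
    (∫ z, surprisal p z ^ 4 ∂noiseLaw p)).add (h.tendsto_cgf_zero.pow 4)).const_mul 27
  set A : ℝ := 27 * (∫ z, surprisal p z ^ 4 ∂noiseLaw p + ∫ z, surprisal p z ^ 4 ∂noiseLaw p +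
    0 ^ 4) with hA
  have hA0 : 0 ≤ A := by
    have : 0 ≤ ∫ z, surprisal p z ^ 4 ∂noiseLaw p := integral_nonneg fun z => by positivity
    positivity
  obtain ⟨T, hT1, hT⟩ : ∃ T : ℝ, 1 ≤ T ∧ (A + 1) / T ^ 2 ≤ δ / 2 := by
    have ht : Tendsto (fun T : ℝ => (A + 1) / T ^ 2) atTop (𝓝 0) :=
      (tendsto_pow_atTop two_ne_zero).const_div_atTop _
    obtain ⟨T, h1, h2⟩ := ((eventually_ge_atTop (1 : ℝ)).and
      (ht.eventually_le_const (half_pos hδ))).exists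
    exact ⟨T, h1, h2⟩
  have hI' := (hI.const_mul (4 * T))
  rw [mul_zero] at hI'
  filter_upwards [Ioo_mem_nhdsGT hζ, hI'.eventually_le_const (half_pos hδ),
    hM.eventually_le_const (lt_add_one A)] with γ hγ h1 h2 PX hPX hconv
  refine ((h.log_ratio_moments hγ.1.le hγ.2 hconv).2.2 T hT1).trans ?_
  have h3 : 27 * (∫ z, surprisal p z ^ 4 ∂noiseLaw p +
          ∫ z, surprisal p z ^ 4 ∂noiseLaw (tiltedDensity p γ) +
          cgf (surprisal p) (noiseLaw p) γ ^ 4) / T ^ 2 ≤ δ / 2 :=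
    (div_le_div_of_nonneg_right h2 (sq_nonneg T)).trans hT
  linarith

/-- The asymptotic converse. -/
lemma eventually_log_numMsg_le (h : RegularDensity p b ζ) {Δ a : ℝ} (hΔ : 0 < Δ)
    (ha0 : 0 < a)
    (ha : 2 * Δ * variance (fun z => Real.log (p z)) (noiseLaw p) < a ^ 2) :
    ∀ᶠ n : ℕ in atTop, ∀ C : Code n, C.IsCovert p Δ →
      (1 - C.avgError p) * Real.log C.numMsg ≤ a * Real.sqrt n := by
  set V := variance (fun z => Real.log (p z)) (noiseLaw p) with hV
  set m := ∫ z, surprisal p z ∂noiseLaw p with hm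
  set φ := cgf (surprisal p) (noiseLaw p) with hφ
  have hζ : 0 < 1 - ζ := by have := h.lt_one; linarith
  -- With this t the limit Δ / t + t V / 2 equals a / 2 + Δ V / a, which is below a exactly when 2 Δ
  -- V < a². Defining t by a rather than by √(2 Δ / V) covers V = 0.
  set t : ℝ := 2 * Δ / a with ht
  have ht0 : 0 < t := by positivity
  have hγ := tendsto_div_sqrt_nhdsGT ht0
  have hsqrt : Tendsto (fun n : ℕ => Real.sqrt n) atTop atTop :=
    Real.tendsto_sqrt_atTop.comp tendsto_natCast_atTop_atTop
  have hlim : Tendsto (fun n : ℕ => (Real.log 2 - Δ) / Real.sqrt n + (Δ / t +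
      t * ((φ (t / Real.sqrt n) - t / Real.sqrt n * m) / (t / Real.sqrt n) ^ 2))) atTop
      (𝓝 (0 + (Δ / t + t * (V / 2)))) :=
    (hsqrt.const_div_atTop _).add (((h.tendsto_cgf.comp hγ).const_mul t).const_add _)
  have hlt : 0 + (Δ / t + t * (V / 2)) < a := by
    have h1 : 0 + (Δ / t + t * (V / 2)) = a / 2 + Δ * V / a := by
      rw [ht]; field_simp; ring
    have h2 : Δ * V / a < a / 2 := by
      rw [div_lt_div_iff₀ ha0 two_pos]
      nlinarith
    linarith
  filter_upwards [hlim.eventually_le_const hlt, eventually_gt_atTop 0,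
    hγ.eventually (Ioo_mem_nhdsGT hζ)] with n hn hn0 hγn C hcov
  have hnpos : (0 : ℝ) < n := by exact_mod_cast hn0
  have hs : 0 < Real.sqrt n := Real.sqrt_pos.2 hnpos
  refine (h.log_numMsg_le hγn.1 hγn.2 hΔ.le C hcov).trans ?_
  have h1 := mul_le_mul_of_nonneg_right hn hs.le
  refine le_trans (le_of_eq ?_) h1
  have hsq : (n : ℝ) = Real.sqrt n ^ 2 := (Real.sq_sqrt hnpos.le).symm
  rw [← hm, ← hφ]
  generalize φ (t / Real.sqrt n) = x
  rw [hsq]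
  generalize Real.sqrt n = r at hs
  rw [Real.sqrt_sq hs.le]
  field_simp
  ring

end RegularDensity

/-! ### Sizes of the message and key sets, and asymptotic achievability. -/

lemma exp_le_ceil_le {x : ℝ} (hx : 0 ≤ x) :
    0 < ⌈Real.exp x⌉₊ ∧ Real.exp x ≤ ⌈Real.exp x⌉₊ ∧ (⌈Real.exp x⌉₊ : ℝ) ≤ 2 * Real.exp x := by
  refine ⟨Nat.ceil_pos.2 (Real.exp_pos x), Nat.le_ceil _, ?_⟩
  have h1 := Nat.ceil_lt_add_one (Real.exp_pos x).le
  have h2 := Real.one_le_exp hx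
  linarith

lemma log_ceil_exp_le {x : ℝ} (hx : 0 ≤ x) :
    x ≤ Real.log ⌈Real.exp x⌉₊ ∧ Real.log ⌈Real.exp x⌉₊ ≤ x + Real.log 2 := by
  obtain ⟨h0, h1, h2⟩ := exp_le_ceil_le hx
  have h0' : (0 : ℝ) < ⌈Real.exp x⌉₊ := by exact_mod_cast h0
  constructor
  · rw [Real.le_log_iff_exp_le h0']
    exact h1
  · refine (Real.log_le_log h0' h2).trans (le_of_eq ?_)
    rw [Real.log_mul two_ne_zero (Real.exp_ne_zero x), Real.log_exp, add_comm]

namespace RegularDensity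

variable {p : ℝ → ℝ} {b ζ : ℝ}

/-- The rate of the key. -/
def keyRate (p : ℝ → ℝ) (b ζ : ℝ) : ℝ := (Real.log (keyFactor p b ζ) + 1) / ((1 - ζ) / 2)

lemma keyRate_nonneg (h : RegularDensity p b ζ) : 0 ≤ keyRate p b ζ := by
  have h1 := Real.log_nonneg h.one_le_keyFactor
  have h2 := h.lt_one
  exact div_nonneg (by linarith) (by linarith)

/-- The key rate is chosen so that |K| ^ s is at least `keyFactor` ^ n times e ^ n; its summand 1
supplies the decay left over. -/
lemma key_term_le (h : RegularDensity p b ζ) {n M : ℕ} (hM : 0 < M) :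
    ((1 - ζ) / 2 * ((M : ℝ) * ⌈Real.exp (keyRate p b ζ * n)⌉₊) ^ ((1 - ζ) / 2))⁻¹ *
      keyFactor p b ζ ^ n ≤ ((1 - ζ) / 2)⁻¹ * Real.exp (-n) := by
  have hs : 0 < (1 - ζ) / 2 := by have := h.lt_one; linarith
  set s := (1 - ζ) / 2 with hsdef
  have hκ : 0 < keyFactor p b ζ := zero_lt_one.trans_le h.one_le_keyFactor
  have hM1 : (1 : ℝ) ≤ M := by exact_mod_cast hM
  have h1 : Real.exp (keyRate p b ζ * n) ≤ (M : ℝ) * ⌈Real.exp (keyRate p b ζ * n)⌉₊ := by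
    have := Nat.le_ceil (Real.exp (keyRate p b ζ * n))
    nlinarith [Real.exp_pos (keyRate p b ζ * n)]
  have h2 := Real.rpow_le_rpow (Real.exp_pos _).le h1 hs.le
  have h3 : Real.exp (keyRate p b ζ * n) ^ s = keyFactor p b ζ ^ n * Real.exp n := by
    rw [← Real.exp_mul, keyRate, ← hsdef]
    have : (Real.log (keyFactor p b ζ) + 1) / s * n * s = n * Real.log (keyFactor p b ζ) + n := by
      field_simp
    rw [this, Real.exp_add, Real.exp_nat_mul, Real.exp_log hκ]
  rw [h3] at h2
  have h4 : 0 < keyFactor p b ζ ^ n * Real.exp n := by positivity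
  rw [mul_inv, mul_assoc]
  refine mul_le_mul_of_nonneg_left ?_ (inv_nonneg.2 hs.le)
  calc _ ≤ (keyFactor p b ζ ^ n * Real.exp n)⁻¹ * keyFactor p b ζ ^ n :=
        mul_le_mul_of_nonneg_right (inv_anti₀ h4 h2) (by positivity)
    _ = Real.exp (-n) := by
        rw [Real.exp_neg]
        field_simp

/-- The asymptotic achievability. -/
lemma eventually_exists_code (h : RegularDensity p b ζ) {ξ : ℝ} (hξ : 0 < ξ)
    (hdec : ∀ γ : ℝ, 0 ≤ γ → γ < ξ → ∃ PX : Measure ℝ, IsProbabilityMeasure PX ∧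
      PX.conv (noiseLaw p) = noiseLaw (tiltedDensity p γ))
    {Δ a ε : ℝ} (hΔ : 0 < Δ) (ha0 : 0 ≤ a)
    (ha : a ^ 2 < 2 * Δ * variance (fun z => Real.log (p z)) (noiseLaw p)) (hε : 0 < ε) :
    ∀ᶠ n : ℕ in atTop, ∃ C : Code n, C.IsCovert p Δ ∧ C.avgError p ≤ ε ∧
      Real.log C.numKey ≤ (keyRate p b ζ + 1) * n ∧ a * Real.sqrt n ≤ Real.log C.numMsg ∧
      Real.log C.numMsg ≤ a * Real.sqrt n + Real.log 2 := by
  set V := variance (fun z => Real.log (p z)) (noiseLaw p) with hV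
  set m := ∫ z, surprisal p z ∂noiseLaw p with hm
  set φ := cgf (surprisal p) (noiseLaw p) with hφ
  have hζ : 0 < (1 - ζ) / 2 := by have := h.lt_one; linarith
  have hVpos : 0 < V := by
    by_contra hcon
    nlinarith [sq_nonneg a]
  -- t V > a secures the rate and t² V / 2 < Δ the covertness; both are possible because a² < 2 Δ V.
  obtain ⟨t, ht0, hta, htΔ⟩ : ∃ t : ℝ, 0 < t ∧ a < t * V ∧ t ^ 2 * (V / 2) < Δ := by
    have h1 : a / V < Real.sqrt (2 * Δ / V) := by
      refine Real.lt_sqrt_of_sq_lt ?_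
      rw [div_pow, div_lt_div_iff₀ (by positivity) hVpos]
      nlinarith
    obtain ⟨t, h2, h3⟩ := exists_between h1
    have ht0 : 0 < t := lt_of_le_of_lt (by positivity) h2
    refine ⟨t, ht0, (div_lt_iff₀ hVpos).1 h2, ?_⟩
    rw [Real.lt_sqrt ht0.le, lt_div_iff₀ hVpos] at h3
    linarith
  -- The gap t V - a = 2 δ is spent as δ / 2 on the convergence of the information, δ between the
  -- rate and the threshold a + δ, and δ / 2 on Chebyshev's inequality.
  set δ : ℝ := (t * V - a) / 2 with hδ
  have hδ0 : 0 < δ := by rw [hδ]; linarith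
  obtain ⟨η, hη0, hη1, hη⟩ : ∃ η : ℝ, 0 < η ∧ η ≤ 1 ∧ t ^ 2 * (V / 2) < (1 - η) * Δ := by
    refine ⟨(1 - t ^ 2 * (V / 2) / Δ) / 2, ?_, ?_, ?_⟩
    · have : t ^ 2 * (V / 2) / Δ < 1 := (div_lt_one hΔ).2 htΔ
      linarith
    · have : 0 ≤ t ^ 2 * (V / 2) / Δ := by positivity
      linarith
    · have h1 : (1 - (1 - t ^ 2 * (V / 2) / Δ) / 2) * Δ = (Δ + t ^ 2 * (V / 2)) / 2 := by
        field_simp; ring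
      rw [h1]; linarith
  -- Makes the Chebyshev term n v / (δ √n / 2)² equal to η ε / 2.
  set v : ℝ := η * ε / 2 * (δ / 2) ^ 2 with hv
  have hv0 : 0 < v := by positivity
  have hγ := tendsto_div_sqrt_nhdsGT ht0
  have hsqrt : Tendsto (fun n : ℕ => Real.sqrt n) atTop atTop :=
    Real.tendsto_sqrt_atTop.comp tendsto_natCast_atTop_atTop
  have hIlim := ((h.tendsto_information_div.comp hγ).const_mul t)
  have hDlim : Tendsto (fun n : ℕ => t ^ 2 * ((t / Real.sqrt n * deriv φ (t / Real.sqrt n) -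
      φ (t / Real.sqrt n)) / (t / Real.sqrt n) ^ 2) + ((1 - ζ) / 2)⁻¹ * Real.exp (-n)) atTop
      (𝓝 (t ^ 2 * (V / 2) + ((1 - ζ) / 2)⁻¹ * 0)) :=
    ((h.tendsto_divergence_div.comp hγ).const_mul (t ^ 2)).add
      (((Real.tendsto_exp_neg_atTop_nhds_zero).comp tendsto_natCast_atTop_atTop).const_mul _)
  rw [mul_zero, add_zero] at hDlim
  have hElim : Tendsto (fun n : ℕ => 2 * Real.exp (-(δ * Real.sqrt n))) atTop (𝓝 (2 * 0)) :=
    ((Real.tendsto_exp_neg_atTop_nhds_zero).comp (hsqrt.const_mul_atTop hδ0)).const_mul 2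
  rw [mul_zero] at hElim
  filter_upwards [hDlim.eventually_le_const hη,
    hElim.eventually_le_const (show (0 : ℝ) < η * ε / 2 by positivity),
    hIlim.eventually_const_le (show t * V - δ / 2 < t * V by linarith),
    hγ.eventually (h.eventually_log_ratio_sq_le hv0), hγ.eventually (Ioo_mem_nhdsGT hζ),
    hγ.eventually (Ioo_mem_nhdsGT hξ), eventually_gt_atTop 0,
    hγ.eventually (h.tendsto_mgf.eventually_const_le (show (1 : ℝ) / 2 < 1 by norm_num))]
    with n hD hE hI hsq hγζ hγξ hn0 hmgf
  have hnpos : (0 : ℝ) < n := by exact_mod_cast hn0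
  have hr : 0 < Real.sqrt n := Real.sqrt_pos.2 hnpos
  have hnr : (n : ℝ) = Real.sqrt n ^ 2 := (Real.sq_sqrt hnpos.le).symm
  obtain ⟨PX, hPX, hconv⟩ := hdec _ hγξ.1.le hγξ.2
  set γ := t / Real.sqrt n with hγdef
  have hγ0 : 0 < γ := hγζ.1
  have htr : t = γ * Real.sqrt n := by rw [hγdef]; field_simp
  set I := (1 - γ) * deriv φ γ + φ γ - m with hIdef
  have hI' : (t * V - δ / 2) * Real.sqrt n ≤ n * I := by
    have h1 := mul_le_mul_of_nonneg_right hI hr.le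
    refine h1.trans (le_of_eq ?_)
    change t * (I / γ) * Real.sqrt n = n * I
    rw [htr]
    conv_rhs => rw [hnr]
    field_simp
  have hτ : (t * V - δ / 2) * Real.sqrt n - (a + δ) * Real.sqrt n = δ / 2 * Real.sqrt n := by
    rw [hδ]; ring
  have hgap : δ / 2 * Real.sqrt n ≤ n * I - (a + δ) * Real.sqrt n := by linarith
  have hgap0 : 0 < δ / 2 * Real.sqrt n := by positivity
  have hax : 0 ≤ a * Real.sqrt n := by positivity
  obtain ⟨hMpos, -, hMle⟩ := exp_le_ceil_le hax
  have hkx : 0 ≤ keyRate p b ζ * n := mul_nonneg h.keyRate_nonneg hnpos.le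
  have hcovb : n * (γ * deriv φ γ - φ γ) + ((1 - ζ) / 2 * ((⌈Real.exp (a * Real.sqrt n)⌉₊ : ℝ) *
      ⌈Real.exp (keyRate p b ζ * n)⌉₊) ^ ((1 - ζ) / 2))⁻¹ * keyFactor p b ζ ^ n ≤
      (1 - η) * Δ := by
    refine le_trans (add_le_add (le_of_eq ?_) (h.key_term_le hMpos)) hD
    rw [htr]
    conv_lhs => rw [hnr]
    field_simp
  have herrb : n * v / (n * I - (a + δ) * Real.sqrt n) ^ 2 +
      (⌈Real.exp (a * Real.sqrt n)⌉₊ : ℝ) / Real.exp ((a + δ) * Real.sqrt n) ≤ η * ε := by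
    have h1 : n * v / (n * I - (a + δ) * Real.sqrt n) ^ 2 ≤ η * ε / 2 := by
      have h2 : (δ / 2 * Real.sqrt n) ^ 2 ≤ (n * I - (a + δ) * Real.sqrt n) ^ 2 :=
        pow_le_pow_left₀ hgap0.le hgap 2
      refine (div_le_div_of_nonneg_left (by positivity) (by positivity) h2).trans
        (le_of_eq ?_)
      rw [hv, mul_pow]
      conv_lhs => rw [← hnr]
      field_simp
    have h2 : (⌈Real.exp (a * Real.sqrt n)⌉₊ : ℝ) / Real.exp ((a + δ) * Real.sqrt n) ≤
        η * ε / 2 := by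
      refine le_trans ?_ hE
      rw [div_le_iff₀ (Real.exp_pos _), mul_assoc, ← Real.exp_add]
      refine hMle.trans (le_of_eq ?_)
      congr 2
      ring
    linarith
  obtain ⟨C, hCM, hCK, hcov, herr⟩ := h.exists_code_iid (n := n) hγ0.le hγζ.2.le hmgf hconv
    hMpos (exp_le_ceil_le hkx).1 (I := I) (v := v) (τ := (a + δ) * Real.sqrt n) (Δ := Δ)
    (η := η) (ε := ε) rfl (hsq PX hPX hconv) (by linarith) hΔ hη0.le hη1 hε hcovb herrb
  refine ⟨C, hcov, herr, ?_, ?_, ?_⟩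
  · rw [hCK]
    refine (log_ceil_exp_le hkx).2.trans ?_
    have h1 : Real.log 2 ≤ 1 := by have := Real.log_two_lt_d9; linarith
    have h2 : (1 : ℝ) ≤ n := by exact_mod_cast hn0
    linarith
  · rw [hCM]
    exact (log_ceil_exp_le hax).1
  · rw [hCM]
    exact (log_ceil_exp_le hax).2

end RegularDensity

/-! ### The trivial code, and passing to another version of the density. -/

namespace Code

/-- The code with a single codeword, the origin. -/
def trivial (n : ℕ) : Code n where
  numMsg := 1
  numKey := 1
  numMsg_pos := one_pos
  numKey_pos := one_pos
  enc := fun _ _ => 0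
  dec := fun _ _ => 0
  measurable_dec := fun _ => measurable_const

variable {n : ℕ}

lemma isCovert_trivial (p : ℝ → ℝ) [SigmaFinite (noiseLawN p n)] (Δ : ℝ) :
    (trivial n).IsCovert p Δ := by
  have h : (trivial n).outputLaw p = noiseLawN p n := by
    change (((1 : ℕ) : ℝ≥0∞) * ((1 : ℕ) : ℝ≥0∞))⁻¹ •
      ∑ _m : Fin 1, ∑ _k : Fin 1, (noiseLawN p n).map (fun z => 0 + z) = _
    simp
  rw [IsCovert, h, InformationTheory.klDiv_self]
  exact zero_le

lemma avgError_trivial (p : ℝ → ℝ) : (trivial n).avgError p = 0 := by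
  have h : ∀ m k, {z | (trivial n).dec ((trivial n).enc m k + z) k ≠ m} = ∅ := fun m k =>
    Set.eq_empty_of_forall_notMem fun z hz => hz (Subsingleton.elim (α := Fin 1) _ _)
  simp only [avgError, h, measureReal_empty, Finset.sum_const_zero, mul_zero]

lemma isCovert_congr {p p' : ℝ → ℝ} (h : noiseLaw p = noiseLaw p') (C : Code n) {Δ : ℝ} :
    C.IsCovert p Δ ↔ C.IsCovert p' Δ := by
  simp only [IsCovert, outputLaw, noiseLawN, h]

lemma avgError_congr {p p' : ℝ → ℝ} (h : noiseLaw p = noiseLaw p') (C : Code n) :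
    C.avgError p = C.avgError p' := by
  simp only [avgError, noiseLawN, h]

end Code

lemma isScalingConstant_congr {p p' : ℝ → ℝ} (h : noiseLaw p = noiseLaw p') {Δ L : ℝ} :
    IsScalingConstant p Δ L ↔ IsScalingConstant p' Δ L := by
  have h1 : ∀ n ε, maxLogMsg p n Δ ε = maxLogMsg p' n Δ ε := fun n ε => by
    simp only [maxLogMsg, Code.isCovert_congr h, Code.avgError_congr h]
  simp only [IsScalingConstant, h1]

lemma tiltedDensity_ae_eq {p p' : ℝ → ℝ} (h : p =ᵐ[volume] p') (γ : ℝ) :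
    tiltedDensity p γ =ᵐ[volume] tiltedDensity p' γ := by
  have h1 : ∫ t, p t ^ (1 - γ) = ∫ t, p' t ^ (1 - γ) :=
    integral_congr_ae (h.mono fun t ht => by simp only [ht])
  filter_upwards [h] with z hz
  simp only [tiltedDensity, h1, hz]

/-- A density that satisfies the assumptions has a regular version. -/
lemma exists_regularDensity {p : ℝ → ℝ} (hp : IsPDF p) (hint : IntegrabilityConditions p)
    (hassum : NoiseAssumption p) :
    ∃ (p' : ℝ → ℝ) (b ζ : ℝ), RegularDensity p' b ζ ∧ p =ᵐ[volume] p' := by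
  obtain ⟨ζ, hζ0, hζ1, -, hrpow, -⟩ := hint
  obtain ⟨b, -, hb⟩ := hassum.bounded
  set k := hp.integrable.aestronglyMeasurable.mk p with hk
  have hkm : Measurable k := hp.integrable.aestronglyMeasurable.stronglyMeasurable_mk.measurable
  -- A measurable version obeys the bounds only almost everywhere, so it is clipped to [0, max b 1].
  have hae : p =ᵐ[volume] fun z => max 0 (min (max b 1) (k z)) := by
    filter_upwards [hp.integrable.aestronglyMeasurable.ae_eq_mk] with z hz
    rw [← hk] at hz
    rw [← hz, min_eq_right ((hb z).trans (le_max_left _ _)), max_eq_right (hp.nonneg z)]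
  refine ⟨fun z => max 0 (min (max b 1) (k z)), max b 1, ζ, ?_, hae⟩
  exact
    { measurable := by fun_prop
      nonneg := fun z => le_max_left _ _
      integrable := hp.integrable.congr hae
      integral_eq_one := by rw [← integral_congr_ae hae]; exact hp.integral_eq_one
      one_le := le_max_right _ _
      le_bound := fun z => max_le (zero_le_one.trans (le_max_right _ _)) (min_le_left _ _)
      pos := hζ0
      lt_one := hζ1
      integrable_rpow := hrpow.congr (hae.mono fun z hz => by simp only [hz]) }

/-! ### The scaling constant and an optimal sequence of codes. -/

namespace RegularDensity

variable {p : ℝ → ℝ} {b ζ : ℝ}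

lemma exists_code_near (h : RegularDensity p b ζ) {ξ : ℝ} (hξ : 0 < ξ)
    (hdec : ∀ γ : ℝ, 0 ≤ γ → γ < ξ → ∃ PX : Measure ℝ, IsProbabilityMeasure PX ∧
      PX.conv (noiseLaw p) = noiseLaw (tiltedDensity p γ))
    {Δ ε : ℝ} (hΔ : 0 < Δ) (hε : 0 < ε) :
    ∀ᶠ n : ℕ in atTop, ∃ C : Code n, C.IsCovert p Δ ∧ C.avgError p ≤ ε ∧
      Real.log C.numKey ≤ (keyRate p b ζ + 1) * n ∧
      |Real.log C.numMsg / Real.sqrt (n * Δ) - Real.sqrt 2 * Real.sqrt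
        (variance (fun z => Real.log (p z)) (noiseLaw p))| ≤ ε := by
  set V := variance (fun z => Real.log (p z)) (noiseLaw p) with hV
  set L := Real.sqrt 2 * Real.sqrt V with hL
  have hV0 : 0 ≤ V := variance_nonneg _ _
  have hL0 : 0 ≤ L := by positivity
  have hL2 : L ^ 2 = 2 * V := by
    rw [hL, mul_pow, Real.sq_sqrt zero_le_two, Real.sq_sqrt hV0]
  have hsΔ : 0 < Real.sqrt Δ := Real.sqrt_pos.2 hΔ
  -- When the variance is 0 there is no rate to attain, and the single-codeword code suffices.
  rcases hL0.eq_or_lt with hL0' | hLpos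
  · filter_upwards with n
    have := h.isProbabilityMeasure_noiseLawN (n := n)
    refine ⟨Code.trivial n, Code.isCovert_trivial p Δ, ?_, ?_, ?_⟩
    · rw [Code.avgError_trivial]; exact hε.le
    · have h1 := h.keyRate_nonneg
      have h2 : Real.log (Code.trivial n).numKey = 0 := by simp [Code.trivial]
      rw [h2]; positivity
    · have h2 : Real.log (Code.trivial n).numMsg = 0 := by simp [Code.trivial]
      rw [h2, ← hL0']
      simpa using hε.le
  · obtain ⟨a', ha1, ha2⟩ := exists_between (show max 0 (L - ε / 2) < L by
      simp [hLpos, hε])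
    have ha0 : 0 ≤ a' := (le_max_left _ _).trans ha1.le
    have haε : L - ε / 2 < a' := (le_max_right _ _).trans_lt ha1
    have hsq : (a' * Real.sqrt Δ) ^ 2 < 2 * Δ * V := by
      rw [mul_pow, Real.sq_sqrt hΔ.le]
      have : a' ^ 2 < L ^ 2 := pow_lt_pow_left₀ ha2 ha0 two_ne_zero
      nlinarith
    have hsmall : Tendsto (fun n : ℕ => Real.log 2 / Real.sqrt (n * Δ)) atTop (𝓝 0) :=
      (Real.tendsto_sqrt_atTop.comp
        (tendsto_natCast_atTop_atTop.atTop_mul_const hΔ)).const_div_atTop _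
    filter_upwards [h.eventually_exists_code hξ hdec hΔ (by positivity) hsq hε,
      hsmall.eventually_le_const (half_pos hε), eventually_gt_atTop 0] with n hn hs hn0
    obtain ⟨C, hcov, herr, hkey, hlow, hup⟩ := hn
    have hnpos : (0 : ℝ) < n := by exact_mod_cast hn0
    have hsqrt : Real.sqrt (n * Δ) = Real.sqrt Δ * Real.sqrt n := by
      rw [Real.sqrt_mul hnpos.le, mul_comm]
    have hspos : 0 < Real.sqrt (n * Δ) := Real.sqrt_pos.2 (by positivity)
    rw [mul_assoc, ← hsqrt] at hlow hup
    have h1 : a' ≤ Real.log C.numMsg / Real.sqrt (n * Δ) := (le_div_iff₀ hspos).2 hlow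
    have h2 : Real.log C.numMsg / Real.sqrt (n * Δ) ≤ a' + Real.log 2 / Real.sqrt (n * Δ) := by
      rw [div_le_iff₀ hspos, add_mul, div_mul_cancel₀ _ hspos.ne']
      exact hup
    refine ⟨C, hcov, herr, hkey, ?_⟩
    rw [abs_le]
    constructor <;> linarith

/-- A sequence of covert codes that attains the scaling constant. -/
lemma exists_code_sequence (h : RegularDensity p b ζ) {ξ : ℝ} (hξ : 0 < ξ)
    (hdec : ∀ γ : ℝ, 0 ≤ γ → γ < ξ → ∃ PX : Measure ℝ, IsProbabilityMeasure PX ∧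
      PX.conv (noiseLaw p) = noiseLaw (tiltedDensity p γ))
    {Δ : ℝ} (hΔ : 0 < Δ) :
    ∃ C : (n : ℕ) → Code n, (∀ n, (C n).IsCovert p Δ) ∧
      Tendsto (fun n => (C n).avgError p) atTop (𝓝 0) ∧
      Tendsto (fun n : ℕ => Real.log (C n).numMsg / Real.sqrt (n * Δ)) atTop
        (𝓝 (Real.sqrt 2 * Real.sqrt (variance (fun z => Real.log (p z)) (noiseLaw p)))) ∧
      (fun n => Real.log (C n).numKey) =O[atTop] fun n : ℕ => (n : ℝ) := by
  classical
  set L := Real.sqrt 2 * Real.sqrt (variance (fun z => Real.log (p z)) (noiseLaw p)) with hL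
  let good : ℕ → ℕ → Prop := fun k n => ∃ C : Code n, C.IsCovert p Δ ∧
    C.avgError p ≤ 1 / ((k : ℝ) + 1) ∧ Real.log C.numKey ≤ (keyRate p b ζ + 1) * n ∧
    |Real.log C.numMsg / Real.sqrt (n * Δ) - L| ≤ 1 / ((k : ℝ) + 1)
  have hgood : ∀ k, ∀ᶠ n in atTop, good k n := fun k =>
    h.exists_code_near hξ hdec hΔ (by positivity)
  -- Diagonal choice: length n uses the largest k ≤ n whose accuracy 1 / (k + 1) is attainable, and
  -- the trivial code if there is none, so that covertness holds at every length.
  have hcode : ∀ n, ∃ C : Code n, C.IsCovert p Δ ∧ ∀ k ≤ n, good k n →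
      C.avgError p ≤ 1 / ((k : ℝ) + 1) ∧ Real.log C.numKey ≤ (keyRate p b ζ + 1) * n ∧
      |Real.log C.numMsg / Real.sqrt (n * Δ) - L| ≤ 1 / ((k : ℝ) + 1) := by
    intro n
    have := h.isProbabilityMeasure_noiseLawN (n := n)
    by_cases hex : ∃ k ≤ n, good k n
    · obtain ⟨k₀, hk₀, hgk₀⟩ := hex
      obtain ⟨C, hcov, herr, hkey, hmsg⟩ :=
        Nat.findGreatest_spec (P := fun k => good k n) hk₀ hgk₀
      refine ⟨C, hcov, fun k hk hgk => ?_⟩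
      have hle : k ≤ Nat.findGreatest (fun k => good k n) n :=
        Nat.le_findGreatest hk hgk
      have hmono : 1 / ((Nat.findGreatest (fun k => good k n) n : ℝ) + 1) ≤ 1 / ((k : ℝ) + 1) :=
        one_div_le_one_div_of_le (by positivity) (by
          have : (k : ℝ) ≤ Nat.findGreatest (fun k => good k n) n := by exact_mod_cast hle
          linarith)
      exact ⟨herr.trans hmono, hkey, hmsg.trans hmono⟩
    · refine ⟨Code.trivial n, Code.isCovert_trivial p Δ, fun k hk hgk => ?_⟩
      exact absurd ⟨k, hk, hgk⟩ hex
  choose C hcov hC using hcode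
  have hev : ∀ k : ℕ, ∀ᶠ n in atTop, (C n).avgError p ≤ 1 / ((k : ℝ) + 1) ∧
      Real.log (C n).numKey ≤ (keyRate p b ζ + 1) * n ∧
      |Real.log (C n).numMsg / Real.sqrt (n * Δ) - L| ≤ 1 / ((k : ℝ) + 1) := fun k => by
    filter_upwards [hgood k, eventually_ge_atTop k] with n hn hk
    exact hC n k hk hn
  have herr0 : ∀ n, 0 ≤ (C n).avgError p := fun n =>
    mul_nonneg (inv_nonneg.2 (C n).numMsg_mul_numKey_pos.le)
      (Finset.sum_nonneg fun _ _ => Finset.sum_nonneg fun _ _ => measureReal_nonneg)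
  refine ⟨C, hcov, ?_, ?_, ?_⟩
  · rw [Metric.tendsto_nhds]
    intro ε hε
    obtain ⟨k, hk⟩ := exists_nat_one_div_lt hε
    filter_upwards [hev k] with n hn
    rw [Real.dist_eq, sub_zero, abs_of_nonneg (herr0 n)]
    exact hn.1.trans_lt hk
  · rw [Metric.tendsto_nhds]
    intro ε hε
    obtain ⟨k, hk⟩ := exists_nat_one_div_lt hε
    filter_upwards [hev k] with n hn
    rw [Real.dist_eq]
    exact hn.2.2.trans_lt hk
  · refine Asymptotics.IsBigO.of_bound (keyRate p b ζ + 1) ?_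
    filter_upwards [hev 0] with n hn
    rw [Real.norm_of_nonneg (Real.log_natCast_nonneg _), Real.norm_of_nonneg (Nat.cast_nonneg n)]
    exact hn.2.1

/-- The converse bounds (1 - error) ln |M|, so tolerating error ε costs the factor 1 / (1 - ε); it
disappears only as ε ↓ 0. -/
lemma liminf_maxLogMsg_le (h : RegularDensity p b ζ) {Δ ε a : ℝ} (hΔ : 0 < Δ)
    (hε : ε < 1)
    (ha : Real.sqrt 2 * Real.sqrt (variance (fun z => Real.log (p z)) (noiseLaw p)) < a) :
    liminf (fun n : ℕ => maxLogMsg p n Δ ε / ENNReal.ofReal (Real.sqrt (n * Δ))) atTop ≤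
      ENNReal.ofReal (a / (1 - ε)) := by
  set V := variance (fun z => Real.log (p z)) (noiseLaw p) with hV
  have hV0 : 0 ≤ V := variance_nonneg _ _
  have ha0 : 0 < a := lt_of_le_of_lt (by positivity) ha
  have hsΔ : 0 < Real.sqrt Δ := Real.sqrt_pos.2 hΔ
  have hε' : 0 < 1 - ε := by linarith
  have hsq : 2 * Δ * V < (a * Real.sqrt Δ) ^ 2 := by
    have h1 := pow_lt_pow_left₀ ha (by positivity) two_ne_zero
    rw [mul_pow, Real.sq_sqrt zero_le_two, Real.sq_sqrt hV0] at h1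
    rw [mul_pow, Real.sq_sqrt hΔ.le]
    nlinarith
  refine liminf_le_of_frequently_le' (Eventually.frequently ?_)
  filter_upwards [h.eventually_log_numMsg_le hΔ (by positivity) hsq, eventually_gt_atTop 0]
    with n hn hn0
  have hnpos : (0 : ℝ) < n := by exact_mod_cast hn0
  have hsqrt : Real.sqrt (n * Δ) = Real.sqrt Δ * Real.sqrt n := by
    rw [Real.sqrt_mul hnpos.le, mul_comm]
  have hspos : 0 < Real.sqrt (n * Δ) := Real.sqrt_pos.2 (by positivity)
  refine ENNReal.div_le_of_le_mul ?_
  rw [← ENNReal.ofReal_mul (by positivity)]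
  refine iSup₂_le fun C hC => ENNReal.ofReal_le_ofReal ?_
  have h1 := hn C hC.1
  rw [mul_assoc, ← hsqrt] at h1
  have h2 : (1 - ε) * Real.log C.numMsg ≤ a * Real.sqrt (n * Δ) :=
    (mul_le_mul_of_nonneg_right (by linarith [hC.2]) (Real.log_natCast_nonneg _)).trans h1
  rw [div_mul_eq_mul_div, le_div_iff₀ hε']
  linarith

lemma isScalingConstant (h : RegularDensity p b ζ) {ξ : ℝ} (hξ : 0 < ξ)
    (hdec : ∀ γ : ℝ, 0 ≤ γ → γ < ξ → ∃ PX : Measure ℝ, IsProbabilityMeasure PX ∧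
      PX.conv (noiseLaw p) = noiseLaw (tiltedDensity p γ))
    {Δ : ℝ} (hΔ : 0 < Δ) :
    IsScalingConstant p Δ
      (Real.sqrt 2 * Real.sqrt (variance (fun z => Real.log (p z)) (noiseLaw p))) := by
  set L := Real.sqrt 2 * Real.sqrt (variance (fun z => Real.log (p z)) (noiseLaw p)) with hL
  refine ⟨by positivity, ?_⟩
  obtain ⟨C, hcov, herr, hmsg, -⟩ := h.exists_code_sequence hξ hdec hΔ
  have hupper : Tendsto (fun ε : ℝ => ENNReal.ofReal (L / (1 - ε))) (𝓝[>] 0)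
      (𝓝 (ENNReal.ofReal L)) := by
    have h1 : Tendsto (fun ε : ℝ => 1 - ε) (𝓝[>] 0) (𝓝 (1 - 0)) :=
      (tendsto_const_nhds.sub tendsto_id).mono_left nhdsWithin_le_nhds
    have h2 := (tendsto_const_nhds (x := L)).div h1 (by norm_num)
    rw [sub_zero, div_one] at h2
    exact ENNReal.tendsto_ofReal h2
  refine tendsto_of_tendsto_of_tendsto_of_le_of_le' tendsto_const_nhds hupper ?_ ?_
  · filter_upwards [self_mem_nhdsWithin] with ε hε
    -- A single sequence with vanishing error eventually meets every tolerance ε > 0, and its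
    -- normalized rates converge to L.
    rw [← (ENNReal.tendsto_ofReal hmsg).liminf_eq]
    refine liminf_le_liminf ?_
    filter_upwards [herr.eventually_le_const hε, eventually_gt_atTop 0] with n hn hn0
    have hnpos : (0 : ℝ) < n := by exact_mod_cast hn0
    rw [ENNReal.ofReal_div_of_pos (Real.sqrt_pos.2 (by positivity))]
    exact ENNReal.div_le_div_right (le_iSup₂_of_le (C n) ⟨hcov n, hn⟩ le_rfl) _
  · filter_upwards [Ioo_mem_nhdsGT one_pos] with ε hε
    have h1 : Tendsto (fun a : ℝ => ENNReal.ofReal (a / (1 - ε))) (𝓝[>] L)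
        (𝓝 (ENNReal.ofReal (L / (1 - ε)))) :=
      ENNReal.tendsto_ofReal ((tendsto_id.div_const _).mono_left nhdsWithin_le_nhds)
    refine ge_of_tendsto h1 ?_
    filter_upwards [self_mem_nhdsWithin] with a ha
    exact h.liminf_maxLogMsg_le hΔ hε.2 ha

end RegularDensity

end CovertChannel

end

/-- There is a number `L`, the scaling constant of the channel with value
`√2 √Var[ln p_Z(Z)]`, and a sequence of covert codes, one for each length, with vanishing average
error, `ln |M_n| / √(n Δ) → L` and key lengths `ln |K_n| = O(n)`. -/
theorem proposition1 (p : ℝ → ℝ) (hp : CovertChannel.IsPDF p)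
    (hint : CovertChannel.IntegrabilityConditions p)
    (hassum : CovertChannel.NoiseAssumption p)
    (Δ : ℝ) (hΔ : 0 < Δ) :
    ∃ L : ℝ,
      CovertChannel.IsScalingConstant p Δ L ∧
      L = Real.sqrt 2 * Real.sqrt
        (ProbabilityTheory.variance (fun z => Real.log (p z)) (CovertChannel.noiseLaw p)) ∧
      ∃ C : (n : ℕ) → CovertChannel.Code n,
        (∀ n, (C n).IsCovert p Δ) ∧
        Filter.Tendsto (fun n => (C n).avgError p) Filter.atTop (nhds 0) ∧
        Filter.Tendsto (fun n : ℕ => Real.log (C n).numMsg / Real.sqrt (n * Δ))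
          Filter.atTop (nhds L) ∧
        Asymptotics.IsBigO Filter.atTop (fun n => Real.log (C n).numKey)
          (fun n : ℕ => (n : ℝ)) := by
  -- Laws, codes and the variance depend on the density only up to null sets, so a bounded
  -- measurable version may replace it.
  obtain ⟨p', b, ζ, hreg, hae⟩ := CovertChannel.exists_regularDensity hp hint hassum
  obtain ⟨ξ, hξ, -, hdec⟩ := hassum.decomposable
  have hlaw : ∀ {q q' : ℝ → ℝ}, q =ᵐ[volume] q' →
      CovertChannel.noiseLaw q = CovertChannel.noiseLaw q' := fun hq =>
    withDensity_congr_ae (hq.mono fun z hz => by simp only [hz])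
  have hP := hlaw hae
  have hdec' : ∀ γ : ℝ, 0 ≤ γ → γ < ξ → ∃ PX : Measure ℝ, IsProbabilityMeasure PX ∧
      PX.conv (CovertChannel.noiseLaw p') =
        CovertChannel.noiseLaw (CovertChannel.tiltedDensity p' γ) := fun γ h0 h1 => by
    obtain ⟨PX, hPX, hconv⟩ := hdec γ h0 h1
    refine ⟨PX, hPX, ?_⟩
    rw [← hP, ← hlaw (CovertChannel.tiltedDensity_ae_eq hae γ)]
    exact hconv
  have hvar : variance (fun z => Real.log (p z)) (CovertChannel.noiseLaw p) =
      variance (fun z => Real.log (p' z)) (CovertChannel.noiseLaw p') := by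
    rw [hP]
    refine variance_congr ?_
    filter_upwards [(withDensity_absolutelyContinuous _ _).ae_le hae] with z hz
    rw [hz]
  refine ⟨_, ?_, rfl, ?_⟩
  · rw [hvar, CovertChannel.isScalingConstant_congr hP]
    exact hreg.isScalingConstant hξ hdec' hΔ
  · obtain ⟨C, hcov, herr, hmsg, hkey⟩ := hreg.exists_code_sequence hξ hdec' hΔ
    refine ⟨C, fun n => (CovertChannel.Code.isCovert_congr hP (C n)).2 (hcov n), ?_, ?_, hkey⟩
    · simp only [CovertChannel.Code.avgError_congr hP]
      exact herr
    · rw [hvar]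
      exact hmsg
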